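/- Let $n\ge 1$, let $M$ be an $n\times n$ integer matrix all of whose (complex) eigenvalues have absolute value greater than $1$, let $\lambda_0$ be the least absolute value of an eigenvalue of $M$, and put $m=|\det M|$. Let $T\subset\mathbb R^n$ be a compact set generating a self-affine lattice tiling: $\bigcup_{\nu\in\mathbb Z^n}(T+\nu)=\mathbb R^n$ and $\bigcup_{\gamma\in\Gamma_0}(T+\gamma)=MT$, both unions being disjoint up to null sets, where $\Gamma_0\subset\mathbb Z^n$ is a finite set containing exactly one representative of each coset of $M\mathbb Z^n$ in $\mathbb Z^n$. Let $Q_0=T+a$ be a translate of $T$ and $r>0$ a number with $\{u:|u|<r\}\subset Q_0$, and put $Q_l(x)=M^{-l}Q_0+x$ for $l\ge 0$, $x\in\mathbb R^n$. Let $s>0$, let $k\ge 0$ be an integer with $k+1>s$, and let $1\le p,q\le\infty$. For $|\alpha|\le k$ let $p_\alpha(x)=x^\alpha$ on the interior of $T$ and $p_\alpha=0$ elsewhere. A dual family is a family $(\tilde p_\alpha)_{|\alpha|\le k}$ of measurable functions with $\operatorname{ess\,sup}_{x\in T}\sum_{\nu\in\mathbb Z^n}|\tilde p_\alpha(x-\nu)|<\infty$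 and $\int p_\alpha(x-\mu)\overline{\tilde p_\beta(x-\nu)}\,dx=\delta_{\mu\nu}\delta_{\alpha\beta}$ for all $|\alpha|,|\beta|\le k$ and $\mu,\nu\in\mathbb Z^n$. Given a dual family, put $$p_\alpha^{Q_l(x)}(y)=m^{l/2}p_\alpha(M^l(y-x)-a),\qquad \tilde p_\alpha^{Q_l(x)}(y)=m^{l/2}\tilde p_\alpha(M^l(y-x)-a),$$ $$P_{Q_l(x)}f=\sum_{|\alpha|\le k}\Big(\int f\,\overline{\tilde p_\alpha^{Q_l(x)}}\Big)p_\alpha^{Q_l(x)} .$$ Put $$\operatorname{osc}^k_pf(x,l)=\inf_{\deg P\le k}\Big(\frac1{|Q_l(x)|}\int_{Q_l(x)}|f-P|^p\Big)^{1/p},\qquad \Omega^k_pf(x,l)=\Big(\frac1{|Q_l(x)|}\int_{Q_l(x)}|f-P_{Q_l(x)}f|^p\Big)^{1/p},$$ and $\triangle_uf(x)=f(x+u)-f(x)$. Define $$\|f\|_{B^s_{pq}(M)}=\|f\|_p+\Big(\sum_{l\ge0}\big(\lambda_0^{ls}\|\operatorname{osc}^k_pf(\cdot,l)\|_p\big)^q\Big)^{1/q},$$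 $$|||f|||_1=\|f\|_p+\Big(\sum_{l\ge0}\big(\lambda_0^{ls}\|\Omega^k_pf(\cdot,l)\|_p\big)^q\Big)^{1/q},\qquad |||f|||_2=\|f\|_p+\Big(\sum_{l\ge0}\big(\lambda_0^{ls}\sup_{(k+1)|M^lu|<r/2}\|\triangle_u^{k+1}f\|_p\big)^q\Big)^{1/q},$$ with values in $[0,\infty]$ and with the usual modifications for $p=\infty$ and $q=\infty$. Then a dual family exists, and for every dual family the three quantities $\|f\|_{B^s_{pq}(M)}$, $|||f|||_1$, $|||f|||_2$ are equivalent: there is a constant $C>0$, independent of $f$, such that for every measurable $f:\mathbb R^n\to\mathbb C$ $$C^{-1}\|f\|_{B^s_{pq}(M)}\le|||f|||_1\le C\|f\|_{B^s_{pq}(M)},\qquad C^{-1}\|f\|_{B^s_{pq}(M)}\le|||f|||_2\le C\|f\|_{B^s_{pq}(M)}.$$ In particular, if one of the three is finite, so are the others. -/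

import Mathlib

open MeasureTheory
open scoped ENNReal NNReal

noncomputable section

namespace SelfAffine

/-- `ℝⁿ` with its Euclidean norm and Lebesgue measure. -/
abbrev E (n : ℕ) : Type := EuclideanSpace ℝ (Fin n)

/-- A lattice point `ν ∈ ℤⁿ`, seen as a vector of `ℝⁿ`. -/
def latVec {n : ℕ} (ν : Fin n → ℤ) : E n := WithLp.toLp 2 (fun i => (ν i : ℝ))

/-- The linear map `x ↦ M x` of `ℝⁿ` given by an integer matrix `M`. -/
def dilMap {n : ℕ} (M : Matrix (Fin n) (Fin n) ℤ) : E n →ₗ[ℝ] E n :=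
  Matrix.toEuclideanLin (M.map (fun z : ℤ => (z : ℝ)))

/-- The set of complex eigenvalues of `M`. -/
def eigenvalues {n : ℕ} (M : Matrix (Fin n) (Fin n) ℤ) : Set ℂ :=
  spectrum ℂ (M.map (fun z : ℤ => (z : ℂ)))

/-- `M` is a dilation matrix (for the lattice `ℤⁿ`): its entries are integers and all its
eigenvalues have absolute value greater than one. -/
def IsDilation {n : ℕ} (M : Matrix (Fin n) (Fin n) ℤ) : Prop :=
  ∀ μ ∈ eigenvalues M, 1 < ‖μ‖

/-- `λ₀`, the least absolute value of an eigenvalue of `M`. -/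
def lambda0 {n : ℕ} (M : Matrix (Fin n) (Fin n) ℤ) : ℝ :=
  sInf ((fun μ : ℂ => ‖μ‖) '' eigenvalues M)

/-- The translate `T + v` of a set `T`. -/
def shiftSet {n : ℕ} (T : Set (E n)) (v : E n) : Set (E n) := (fun x => x + v) '' T

/-- `D` is a set of digits: a finite complete set of representatives, one for each coset, of
`ℤⁿ / M ℤⁿ`. -/
def IsDigitSet {n : ℕ} (M : Matrix (Fin n) (Fin n) ℤ) (D : Finset (Fin n → ℤ)) : Prop :=
  ∀ ν : Fin n → ℤ, ∃! δ : Fin n → ℤ, δ ∈ D ∧ ∃ κ : Fin n → ℤ, ν = δ + M.mulVec κ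

/-- The compact set `T` generates a self-affine lattice tiling `{T + ν}`, `ν ∈ ℤⁿ`, of `ℝⁿ` with
dilation matrix `M`. -/
structure IsSelfAffineTile {n : ℕ} (M : Matrix (Fin n) (Fin n) ℤ) (T : Set (E n)) : Prop where
  isCompact : IsCompact T
  cover : (⋃ ν : Fin n → ℤ, shiftSet T (latVec ν)) = Set.univ
  aedisjoint : Pairwise fun ν κ : Fin n → ℤ =>
    AEDisjoint volume (shiftSet T (latVec ν)) (shiftSet T (latVec κ))
  selfAffine : ∃ D : Finset (Fin n → ℤ), IsDigitSet M D ∧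
    (⋃ δ ∈ D, shiftSet T (latVec δ)) = dilMap M '' T ∧
    (D : Set (Fin n → ℤ)).Pairwise fun ν κ =>
      AEDisjoint volume (shiftSet T (latVec ν)) (shiftSet T (latVec κ))

/-- The multi-indices `α ∈ ℤ₊ⁿ` with `|α| ≤ k`. -/
def multiIdx (n k : ℕ) : Finset (Fin n → ℕ) :=
  (Fintype.piFinset fun _ => Finset.range (k + 1)).filter fun α => ∑ i, α i ≤ k

theorem mem_multiIdx {n k : ℕ} (α : Fin n → ℕ) : α ∈ multiIdx n k ↔ ∑ i, α i ≤ k := by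
  simp only [multiIdx, Finset.mem_filter, Fintype.mem_piFinset, Finset.mem_range,
    and_iff_right_iff_imp]
  intro h i
  have := Finset.single_le_sum (f := α) (fun _ _ => Nat.zero_le _) (Finset.mem_univ i)
  omega

/-- The tile monomial `p_α`: equal to `x ^ α` on the interior of `T`, and to `0` elsewhere. -/
def tileMonomial {n : ℕ} (T : Set (E n)) (α : Fin n → ℕ) : E n → ℂ :=
  (interior T).indicator fun x => ∏ i, ((x i : ℝ) : ℂ) ^ α i

/-- The space `𝓛^∞`: measurable `φ` for which the `L^∞(T)` norm of `∑_ν |φ(x - ν)|` is finite. -/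
def MemCalLinfty {n : ℕ} (T : Set (E n)) (φ : E n → ℂ) : Prop :=
  AEStronglyMeasurable φ volume ∧
    eLpNorm (fun x => ∑' ν : Fin n → ℤ, ‖φ (x - latVec ν)‖ₑ) ∞ (volume.restrict T) < ∞

/-- The pairing `⟨f, g⟩ = ∫ f(y) conj(g(y)) dy`. -/
def pairing {n : ℕ} (f g : E n → ℂ) : ℂ := ∫ y, f y * (starRingEnd ℂ) (g y)

/-- `p̃_α`, `|α| ≤ k`, is a family of functions in `𝓛^∞` dual to the tile monomials `p_α`,
`|α| ≤ k`. -/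
def IsDualFamily {n : ℕ} (T : Set (E n)) (k : ℕ) (pd : (Fin n → ℕ) → E n → ℂ) : Prop :=
  (∀ α ∈ multiIdx n k, MemCalLinfty T (pd α)) ∧
  ∀ α ∈ multiIdx n k, ∀ β ∈ multiIdx n k, ∀ μ ν : Fin n → ℤ,
    pairing (fun x => tileMonomial T α (x - latVec μ)) (fun x => pd β (x - latVec ν)) =
      if μ = ν ∧ α = β then 1 else 0

/-- `Q_l(x) = M^{-l} Q₀ + x` where `Q₀ = T + a` (written as a preimage under the bijection
`y ↦ M^l (y - x)`). -/
def cell {n : ℕ} (M : Matrix (Fin n) (Fin n) ℤ) (T : Set (E n)) (a : E n) (l : ℕ) (x : E n) :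
    Set (E n) :=
  {y | (dilMap M ^ l) (y - x) ∈ shiftSet T a}

/-- For a function `g` attached to `T`, the function
`g^{Q_l(x₀)}(y) = m^{l/2} g'(M^l (y - x₀))`, where `m = |det M|` and `g' = g(· - a)` is the
translate of `g` that corresponds to `Q₀ = T + a`. -/
def rescale {n : ℕ} (M : Matrix (Fin n) (Fin n) ℤ) (a : E n) (l : ℕ) (x₀ : E n)
    (g : E n → ℂ) (y : E n) : ℂ :=
  (((|(M.det : ℝ)|) ^ ((l : ℝ) / 2) : ℝ) : ℂ) * g ((dilMap M ^ l) (y - x₀) - a)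

/-- The quasi-interpolant
`P_{Q_l(x₀)} f = ∑_{|α| ≤ k} ⟨f, p̃_α^{Q_l(x₀)}⟩ p_α^{Q_l(x₀)}`. -/
def quasiInterp {n : ℕ} (M : Matrix (Fin n) (Fin n) ℤ) (T : Set (E n)) (a : E n) (k : ℕ)
    (pd : (Fin n → ℕ) → E n → ℂ) (f : E n → ℂ) (l : ℕ) (x₀ : E n) (y : E n) : ℂ :=
  ∑ α ∈ multiIdx n k,
    pairing f (rescale M a l x₀ (pd α)) * rescale M a l x₀ (tileMonomial T α) y

/-- The normalized norm `((1/|Q|) ∫_Q |g|^p)^{1/p}` (the essential supremum over `Q` if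
`p = ∞`). -/
def avgNorm {n : ℕ} (p : ℝ≥0∞) (Q : Set (E n)) (g : E n → ℂ) : ℝ≥0∞ :=
  eLpNorm g p ((volume Q)⁻¹ • volume.restrict Q)

/-- The local oscillation `osc^k_p f(x, l)`: infimum over polynomials of degree at most `k`. -/
def osc {n : ℕ} (M : Matrix (Fin n) (Fin n) ℤ) (T : Set (E n)) (a : E n) (k : ℕ) (p : ℝ≥0∞)
    (f : E n → ℂ) (l : ℕ) (x : E n) : ℝ≥0∞ :=
  ⨅ (P : MvPolynomial (Fin n) ℂ) (_ : P.totalDegree ≤ k),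
    avgNorm p (cell M T a l x)
      (fun y => f y - MvPolynomial.eval (fun i => ((y i : ℝ) : ℂ)) P)

/-- The quasi-interpolation error `Ω^k_p f(x, l)`. -/
def Omega {n : ℕ} (M : Matrix (Fin n) (Fin n) ℤ) (T : Set (E n)) (a : E n) (k : ℕ)
    (pd : (Fin n → ℕ) → E n → ℂ) (p : ℝ≥0∞) (f : E n → ℂ) (l : ℕ) (x : E n) : ℝ≥0∞ :=
  avgNorm p (cell M T a l x) (fun y => f y - quasiInterp M T a k pd f l x y)

/-- `(∑_{l ≥ 0} a_l ^ q)^{1/q}`, and `sup_l a_l` if `q = ∞`. -/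
def lqNorm (q : ℝ≥0∞) (a : ℕ → ℝ≥0∞) : ℝ≥0∞ :=
  if q = ∞ then ⨆ l, a l else (∑' l, a l ^ q.toReal) ^ (1 / q.toReal)

/-- The weight `λ₀^{ls}`. -/
def weight {n : ℕ} (M : Matrix (Fin n) (Fin n) ℤ) (s : ℝ) (l : ℕ) : ℝ≥0∞ :=
  ENNReal.ofReal (lambda0 M ^ ((l : ℝ) * s))

/-- The norm of the Besov space `B^s_{pq}(M)`, with value in `[0, ∞]`. -/
def besovNorm {n : ℕ} (M : Matrix (Fin n) (Fin n) ℤ) (T : Set (E n)) (a : E n) (k : ℕ) (s : ℝ)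
    (p q : ℝ≥0∞) (f : E n → ℂ) : ℝ≥0∞ :=
  eLpNorm f p volume +
    lqNorm q fun l => weight M s l * eLpNorm (fun x => osc M T a k p f l x) p volume

/-- The norm with the error of quasi-interpolation in place of the oscillation. -/
def besovNormOmega {n : ℕ} (M : Matrix (Fin n) (Fin n) ℤ) (T : Set (E n)) (a : E n) (k : ℕ)
    (pd : (Fin n → ℕ) → E n → ℂ) (s : ℝ) (p q : ℝ≥0∞) (f : E n → ℂ) : ℝ≥0∞ :=
  eLpNorm f p volume +
    lqNorm q fun l => weight M s l * eLpNorm (fun x => Omega M T a k pd p f l x) p volume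

/-- The norm given by the differences `Δ_u^{k+1} f` with `(k+1) |M^l u| < r/2`. -/
def besovNormDiff {n : ℕ} (M : Matrix (Fin n) (Fin n) ℤ) (r : ℝ) (k : ℕ) (s : ℝ)
    (p q : ℝ≥0∞) (f : E n → ℂ) : ℝ≥0∞ :=
  eLpNorm f p volume +
    lqNorm q fun l => weight M s l *
      ⨆ (u : E n) (_ : ((k : ℝ) + 1) * ‖(dilMap M ^ l) u‖ < r / 2),
        eLpNorm ((fwdDiff u)^[k + 1] f) p volume

end SelfAffine

end

/-!
The three norms are compared scale by scale: for every `l`, the `L^p` norms of `osc^k_p f(·, l)` and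
of `Ω^k_p f(·, l)` and the supremum of the norms of `Δ_u^{k+1} f` over `(k+1) |M^l u| < r/2` are
bounded by each other, with constants that do not depend on `l`. Such a comparison passes to weighted
`ℓ^q` norms with arbitrary weights (`add_lqNorm_le`). If `‖f‖_p = ∞` all the norms are infinite.

* `osc ≤ Ω` holds pointwise (`osc_le_Omega`), since the quasi-interpolant agrees almost everywhere on
  the cell with a polynomial of degree at most `k`. This needs that the boundary of the tile is a
  null set (`IsSelfAffineTile.volume_frontier`): the tile contains a ball, so for large `l` one of
  the `m^l` translates of `T` that make up `M^l T` lies in the interior of `M^l T`, and does not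
  contribute to its boundary.
* Differences are controlled by `osc` (`exists_eLpNorm_fwdDiff_le_osc`): `Δ_u^{k+1}` annihilates
  polynomials, and for `(k+1) |M^l u| < r/2` and `|M^l z| < r/2` all the points `x + z + j u`
  lie in the cell `Q_l(x)`. Averaging over `z` gives the bound for the `L^p` norm.
* `Ω` is controlled by differences (`exists_eLpNorm_Omega_le_fwdDiff`). The change of variables
  `y ↦ M^l y` reduces this to the unit scale (`Omega_eq_unitOmega`). There, `g` is approximated near
  each point `x` by a polynomial `τ x` of degree at most `k`, with an error that is bounded in `L^p`
  by the modulus of smoothness (`exists_polynomial_approx`). Quasi-interpolation reproduces piecewise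
  polynomials (`integral_piecewise_polynomial`), so its error is bounded by that of the approximation
  by the polynomials `τ (x + ν)` on the tiles `T + x + ν`, integrated against the dual functions
  (`exists_eLpNorm_unitOmega_le`). The dual functions are integrable, although their support may be
  unbounded, and Minkowski's inequality applies.

The local approximation is a version of Whitney's theorem. The average `∫ ψ(t) Δ_{-t}^{k+1} g(x) dt`
against a kernel `ψ` of integral one is `± g(x)` plus a combination of the functions
`∫ ψ(t) g(x - j t) dt`, `1 ≤ j ≤ k + 1` (`eq_average_sub_sum_conv`), and these are smooth. For `ψ` a
tensor product of spline functions their derivatives of order `k + 1` are convolutions of mixed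
differences of order `k + 1` (`KernelFamily.hasPartials_chain`), and mixed differences reduce to pure
ones by Kemperman's identity (`mixDiff_eq_sum_fwdDiff`). So the remainder of Taylor's formula is
controlled by the modulus of smoothness, and the Taylor polynomials are the polynomials wanted.

A dual family is obtained by inverting the Gram matrix of the tile monomials
(`exists_isDualFamily`).
-/

namespace SelfAffine

open Filter Topology

variable {n : ℕ}

/-! ### The dilation and its powers -/

theorem isUnit_map_intCast {M : Matrix (Fin n) (Fin n) ℤ} (hM : IsDilation M) :
    IsUnit (M.map (fun z : ℤ => (z : ℂ))) := by
  by_contra h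
  have h0 : (0 : ℂ) ∈ eigenvalues M := by
    rw [eigenvalues, spectrum.zero_mem_iff]; exact h
  have := hM 0 h0
  norm_num at this

theorem det_ne_zero {M : Matrix (Fin n) (Fin n) ℤ} (hM : IsDilation M) : (M.det : ℝ) ≠ 0 := by
  have h := isUnit_map_intCast hM
  rw [Matrix.isUnit_iff_isUnit_det, isUnit_iff_ne_zero] at h
  have e : (M.map (fun z : ℤ => (z : ℂ))).det = (M.det : ℂ) :=
    (RingHom.map_det (Int.castRingHom ℂ) M).symm
  rw [e] at h
  exact_mod_cast h

theorem det_dilMap (M : Matrix (Fin n) (Fin n) ℤ) : LinearMap.det (dilMap M) = (M.det : ℝ) := by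
  have e : (M.map (fun z : ℤ => (z : ℝ))).det = (M.det : ℝ) :=
    (RingHom.map_det (Int.castRingHom ℝ) M).symm
  rw [← e]
  exact LinearMap.det_toLpLin 2 _

theorem det_dilMap_pow (M : Matrix (Fin n) (Fin n) ℤ) (l : ℕ) :
    LinearMap.det (dilMap M ^ l) = (M.det : ℝ) ^ l := by
  rw [map_pow, det_dilMap]

/-- The complexification `ℝⁿ → ℂⁿ`, an isometric embedding. -/
noncomputable def complexify (x : E n) : EuclideanSpace ℂ (Fin n) :=
  WithLp.toLp 2 fun i => ((x i : ℝ) : ℂ)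

theorem norm_complexify (x : E n) : ‖complexify x‖ = ‖x‖ := by
  rw [EuclideanSpace.norm_eq, EuclideanSpace.norm_eq]
  simp [complexify]

theorem complexify_dilMap_pow (M : Matrix (Fin n) (Fin n) ℤ) (l : ℕ) (x : E n) :
    (complexify ((dilMap M ^ l) x)).ofLp =
      ((M.map (fun z : ℤ => (z : ℂ))) ^ l).mulVec (complexify x).ofLp := by
  induction l with
  | zero => simp
  | succ l ih =>
    rw [pow_succ', pow_succ', ← Matrix.mulVec_mulVec, ← ih]
    ext i
    simp [complexify, dilMap, Matrix.mulVec, dotProduct]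

open scoped Matrix.Norms.L2Operator in
/-- Some power of a dilation expands all distances by as large a factor as desired. This is
Gelfand's formula for the inverse matrix, whose spectral radius is less than one. -/
theorem exists_pow_expanding (hn : 0 < n) {M : Matrix (Fin n) (Fin n) ℤ} (hM : IsDilation M)
    {ε : ℝ} (hε : 0 < ε) : ∃ l : ℕ, ∀ x : E n, ‖x‖ ≤ ε * ‖(dilMap M ^ l) x‖ := by
  have : Nonempty (Fin n) := ⟨⟨0, hn⟩⟩
  obtain ⟨u, hu⟩ := isUnit_map_intCast hM
  set N : Matrix (Fin n) (Fin n) ℂ := ((u⁻¹ : (Matrix (Fin n) (Fin n) ℂ)ˣ) :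
    Matrix (Fin n) (Fin n) ℂ) with hN
  have hspec : spectralRadius ℂ N < (1 : ℝ≥0) := by
    refine spectrum.spectralRadius_lt_of_forall_lt N fun z hz => ?_
    have hz0 : z ≠ 0 := by
      rintro rfl
      exact (spectrum.zero_mem_iff (R := ℂ)).1 hz ⟨u⁻¹, rfl⟩
    have hz' : z⁻¹ ∈ eigenvalues M := by
      have := spectrum.inv_mem_iff (r := Units.mk0 z hz0) (a := u⁻¹)
      rw [inv_inv] at this
      have h2 := this.1 hz
      rw [hu] at h2
      simpa [eigenvalues] using h2
    have h1 := hM _ hz'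
    rw [norm_inv] at h1
    have h2 : ‖z‖ < 1 := by
      by_contra hge
      exact absurd h1 (not_lt.2 (inv_le_one_of_one_le₀ (not_lt.1 hge)))
    exact_mod_cast h2
  have hlim := spectrum.pow_nnnorm_pow_one_div_tendsto_nhds_spectralRadius N
  obtain ⟨ρ, hρ1, hρ2⟩ := ENNReal.lt_iff_exists_nnreal_btwn.1 hspec
  have hρ2' : ρ < 1 := by exact_mod_cast hρ2
  have hev := hlim.eventually_lt_const hρ1
  have hpow : Tendsto (fun l : ℕ => (ρ : ℝ) ^ l) atTop (𝓝 0) :=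
    tendsto_pow_atTop_nhds_zero_of_lt_one ρ.2 (by exact_mod_cast hρ2')
  have hev2 := hpow.eventually_lt_const hε
  obtain ⟨l, ⟨h1, h2⟩, hl⟩ := ((hev.and hev2).and (eventually_gt_atTop 0)).exists
  refine ⟨l, fun x => ?_⟩
  have hl0 : (l : ℝ) ≠ 0 := by exact_mod_cast hl.ne'
  have h3 : ‖N ^ l‖ ≤ (ρ : ℝ) ^ l := by
    have := ENNReal.rpow_le_rpow h1.le (z := l) (by positivity)
    rw [← ENNReal.rpow_mul, one_div, inv_mul_cancel₀ hl0, ENNReal.rpow_one,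
      ENNReal.rpow_natCast] at this
    have h4 : ‖N ^ l‖₊ ≤ ρ ^ l := by exact_mod_cast this
    exact_mod_cast h4
  have hNM : N ^ l * (M.map (fun z : ℤ => (z : ℂ))) ^ l = 1 := by
    rw [← hu, hN, ← Units.val_pow_eq_pow_val, ← Units.val_pow_eq_pow_val, ← Units.val_mul,
      inv_pow, inv_mul_cancel, Units.val_one]
  have h5 : complexify x = WithLp.toLp 2 ((N ^ l).mulVec
      (complexify ((dilMap M ^ l) x)).ofLp) := by
    rw [complexify_dilMap_pow, Matrix.mulVec_mulVec, hNM, Matrix.one_mulVec]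
  calc ‖x‖ = ‖complexify x‖ := (norm_complexify x).symm
    _ ≤ ‖N ^ l‖ * ‖complexify ((dilMap M ^ l) x)‖ := by
        rw [h5]; exact Matrix.l2_opNorm_mulVec _ _
    _ ≤ ε * ‖(dilMap M ^ l) x‖ := by
        rw [norm_complexify]
        gcongr
        exact h3.trans h2.le

/-- The power `M^l` of a dilation as a linear automorphism of `ℝⁿ`. -/
noncomputable def dilEquiv (M : Matrix (Fin n) (Fin n) ℤ) (hM : IsDilation M) (l : ℕ) :
    E n ≃L[ℝ] E n :=
  (LinearEquiv.ofIsUnitDet (f := dilMap M ^ l) (v := (EuclideanSpace.basisFun (Fin n) ℝ).toBasis)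
    (v' := (EuclideanSpace.basisFun (Fin n) ℝ).toBasis) (by
      rw [LinearMap.det_toMatrix, det_dilMap_pow, isUnit_iff_ne_zero]
      exact pow_ne_zero _ (det_ne_zero hM))).toContinuousLinearEquiv

@[simp] theorem dilEquiv_apply (M : Matrix (Fin n) (Fin n) ℤ) (hM : IsDilation M) (l : ℕ)
    (x : E n) : dilEquiv M hM l x = (dilMap M ^ l) x := rfl

/-! ### Self-affine tiles -/

theorem latVec_add (μ ν : Fin n → ℤ) : (latVec (μ + ν) : E n) = latVec μ + latVec ν := by
  ext i; simp [latVec]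

@[simp] theorem latVec_zero : (latVec 0 : E n) = 0 := by
  ext i; simp [latVec]

theorem dilMap_latVec (M : Matrix (Fin n) (Fin n) ℤ) (ν : Fin n → ℤ) :
    dilMap M (latVec ν) = latVec (M.mulVec ν) := by
  ext i
  simp [latVec, dilMap, Matrix.mulVec, dotProduct]

theorem shiftSet_eq_preimage (T : Set (E n)) (v : E n) :
    shiftSet T v = (fun x => x - v) ⁻¹' T := by
  ext x; simp [shiftSet, sub_eq_add_neg]

theorem mem_shiftSet {T : Set (E n)} {v x : E n} : x ∈ shiftSet T v ↔ x - v ∈ T := by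
  rw [shiftSet_eq_preimage]; rfl

theorem volume_shiftSet (T : Set (E n)) (v : E n) : volume (shiftSet T v) = volume T := by
  simp_rw [shiftSet_eq_preimage, sub_eq_add_neg]
  exact measure_preimage_add_right _ _ _

theorem shiftSet_eq_image_homeomorph (T : Set (E n)) (v : E n) :
    shiftSet T v = (Homeomorph.addRight v) '' T := rfl

theorem interior_shiftSet (T : Set (E n)) (v : E n) :
    interior (shiftSet T v) = shiftSet (interior T) v := by
  rw [shiftSet_eq_image_homeomorph, shiftSet_eq_image_homeomorph, Homeomorph.image_interior]

theorem frontier_shiftSet (T : Set (E n)) (v : E n) :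
    frontier (shiftSet T v) = shiftSet (frontier T) v := by
  rw [shiftSet_eq_image_homeomorph, shiftSet_eq_image_homeomorph, Homeomorph.image_frontier]

/-- The interiors of two different translates of a tile do not meet: their intersection is an open
null set. -/
theorem IsSelfAffineTile.interior_disjoint {M : Matrix (Fin n) (Fin n) ℤ} {T : Set (E n)}
    (hT : IsSelfAffineTile M T) {x : E n} {μ ν : Fin n → ℤ} (hμ : x - latVec μ ∈ interior T)
    (hν : x - latVec ν ∈ interior T) : μ = ν := by
  by_contra hne
  have h0 : volume (shiftSet T (latVec μ) ∩ shiftSet T (latVec ν)) = 0 := hT.aedisjoint hne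
  have hx : x ∈ interior (shiftSet T (latVec μ) ∩ shiftSet T (latVec ν)) := by
    rw [interior_inter, interior_shiftSet, interior_shiftSet]
    exact ⟨mem_shiftSet.2 hμ, mem_shiftSet.2 hν⟩
  have := MeasureTheory.Measure.interior_eq_empty_of_null h0
  rw [this] at hx
  exact hx

theorem ball_neg_subset_of_ball_subset_shiftSet {T : Set (E n)} {a : E n} {r : ℝ}
    (hQ : Metric.ball (0 : E n) r ⊆ shiftSet T a) : Metric.ball (-a) r ⊆ T := by
  intro x hx
  have := hQ (show x + a ∈ Metric.ball (0 : E n) r by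
    simpa [dist_eq_norm, sub_neg_eq_add] using hx)
  rw [mem_shiftSet] at this
  simpa using this

/-- The `l`-th dilate of a tile is a union of at most `N ^ l` lattice translates of it, if the tile
has `N` digits. -/
theorem exists_pow_image_eq {M : Matrix (Fin n) (Fin n) ℤ} {T : Set (E n)}
    {D : Finset (Fin n → ℤ)} (hD : (⋃ δ ∈ D, shiftSet T (latVec δ)) = dilMap M '' T) (l : ℕ) :
    ∃ Γ : Finset (Fin n → ℤ), Γ.card ≤ D.card ^ l ∧
      (dilMap M ^ l) '' T = ⋃ γ ∈ Γ, shiftSet T (latVec γ) := by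
  classical
  induction l with
  | zero => exact ⟨{0}, by simp, by simp [shiftSet]⟩
  | succ l ih =>
    obtain ⟨Γ, hc, hΓ⟩ := ih
    refine ⟨(Γ ×ˢ D).image fun z => M.mulVec z.1 + z.2, ?_, ?_⟩
    · refine Finset.card_image_le.trans ?_
      rw [Finset.card_product, pow_succ]
      exact Nat.mul_le_mul_right _ hc
    · have hstep : ∀ γ : Fin n → ℤ, dilMap M '' shiftSet T (latVec γ) =
          ⋃ δ ∈ D, shiftSet T (latVec (M.mulVec γ + δ)) := by
        intro γ
        have : dilMap M '' shiftSet T (latVec γ) = shiftSet (dilMap M '' T)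
            (latVec (M.mulVec γ)) := by
          simp only [shiftSet, Set.image_image, map_add, dilMap_latVec]
        rw [this, ← hD]
        ext x
        simp only [mem_shiftSet, Set.mem_iUnion, latVec_add]
        simp only [sub_sub]
      have : (dilMap M ^ (l + 1)) '' T = dilMap M '' ((dilMap M ^ l) '' T) := by
        rw [Set.image_image, pow_succ']; rfl
      rw [this, hΓ, Set.image_iUnion₂]
      ext x
      simp only [hstep, Set.mem_iUnion, Finset.mem_image, Finset.mem_product, Prod.exists]
      constructor
      · rintro ⟨γ, hγ, δ, hδ, hx⟩
        exact ⟨_, ⟨γ, δ, ⟨hγ, hδ⟩, rfl⟩, hx⟩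
      · rintro ⟨_, ⟨γ, δ, ⟨hγ, hδ⟩, rfl⟩, hx⟩
        exact ⟨γ, hγ, δ, hδ, hx⟩

theorem IsSelfAffineTile.measurableSet_shift {M : Matrix (Fin n) (Fin n) ℤ} {T : Set (E n)}
    (hT : IsSelfAffineTile M T) (v : E n) : MeasurableSet (shiftSet T v) := by
  rw [shiftSet_eq_preimage]
  exact hT.isCompact.measurableSet.preimage (by fun_prop)

/-- The boundary of a self-affine tile with interior points is a null set. For large `l` one of the
translates of `T` that make up `M^l T` lies in the interior of `M^l T`, so that the boundary of
`M^l T` is covered by the boundaries of the others; comparing volumes,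
`m ^ l |∂T| ≤ (m ^ l - 1) |∂T|`. -/
theorem IsSelfAffineTile.volume_frontier (hn : 0 < n) {M : Matrix (Fin n) (Fin n) ℤ}
    (hM : IsDilation M) {T : Set (E n)} (hT : IsSelfAffineTile M T) {c : E n} {r : ℝ} (hr : 0 < r)
    (hc : Metric.ball c r ⊆ T) : volume (frontier T) = 0 := by
  classical
  obtain ⟨D, -, hD, hdisj⟩ := hT.selfAffine
  have hTpos : volume T ≠ 0 := fun h =>
    (Metric.measure_ball_pos volume c hr).ne' (measure_mono_null hc h)
  have hTfin : volume T ≠ ∞ := hT.isCompact.measure_lt_top.ne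
  have hcard : (D.card : ℝ≥0∞) = ENNReal.ofReal |(M.det : ℝ)| := by
    have h1 : volume (dilMap M '' T) = D.card * volume T := by
      rw [← hD, measure_biUnion_finset₀ hdisj
        fun δ _ => (hT.measurableSet_shift _).nullMeasurableSet]
      simp [volume_shiftSet]
    rw [Measure.addHaar_image_linearMap, det_dilMap] at h1
    exact ((ENNReal.mul_left_inj hTpos hTfin).1 h1).symm
  obtain ⟨d, hd0, hd⟩ : ∃ d : ℝ, 0 < d ∧ ∀ x ∈ T, ∀ y ∈ T, ‖x - y‖ < d := by
    obtain ⟨R, hR⟩ := hT.isCompact.isBounded.exists_norm_le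
    refine ⟨2 * |R| + 1, by positivity, fun x hx y hy => ?_⟩
    have h1 := (hR x hx).trans (le_abs_self R)
    have h2 := (hR y hy).trans (le_abs_self R)
    linarith [norm_sub_le x y]
  obtain ⟨l, hl⟩ := exists_pow_expanding hn hM (ε := r / d) (by positivity)
  obtain ⟨Γ, hΓc, hΓ⟩ := exists_pow_image_eq hD l
  set A := dilEquiv M hM l with hA
  have hAT : A '' T = ⋃ γ ∈ Γ, shiftSet T (latVec γ) := hΓ
  have hcT : c ∈ T := hc (Metric.mem_ball_self hr)
  obtain ⟨γ₀, hγ₀, hcγ⟩ : ∃ γ ∈ Γ, A c ∈ shiftSet T (latVec γ) := by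
    have : A c ∈ A '' T := ⟨c, hcT, rfl⟩
    rw [hAT] at this
    simpa using this
  have hsub : shiftSet T (latVec γ₀) ⊆ interior (A '' T) := by
    intro x hx
    have hball : A '' Metric.ball c r ⊆ interior (A '' T) :=
      interior_maximal (Set.image_mono hc) (A.toHomeomorph.isOpenMap _ Metric.isOpen_ball)
    refine hball ⟨A.symm x, ?_, by simp⟩
    rw [Metric.mem_ball, dist_eq_norm]
    have h1 := hl (A.symm x - c)
    have h2 : (dilMap M ^ l) (A.symm x - c) = x - A c := by
      change A (A.symm x - c) = _
      simp
    rw [h2] at h1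
    have h3 := hd _ (mem_shiftSet.1 hx) _ (mem_shiftSet.1 hcγ)
    rw [sub_sub_sub_cancel_right] at h3
    calc _ ≤ r / d * ‖x - A c‖ := h1
      _ < r / d * d := by gcongr
      _ = r := by field_simp
  have hfr : frontier (A '' T) ⊆ ⋃ γ ∈ Γ.erase γ₀, shiftSet (frontier T) (latVec γ) := by
    intro x hx
    have hxmem : x ∈ A '' T :=
      (hT.isCompact.image A.continuous).isClosed.frontier_subset hx
    have hxint : x ∉ interior (A '' T) := hx.2
    have hx2 := hxmem
    rw [hAT] at hx2
    simp only [Set.mem_iUnion] at hx2 ⊢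
    obtain ⟨γ, hγ, hxγ⟩ := hx2
    refine ⟨γ, Finset.mem_erase.2 ⟨?_, hγ⟩, ?_⟩
    · rintro rfl
      exact hxint (hsub hxγ)
    · rw [← frontier_shiftSet]
      refine ⟨subset_closure hxγ, fun hi => hxint ?_⟩
      refine interior_mono ?_ hi
      rw [hAT]
      exact Set.subset_biUnion_of_mem (u := fun γ => shiftSet T (latVec γ)) hγ
  have hvol : volume (frontier (A '' T)) = (D.card : ℝ≥0∞) ^ l * volume (frontier T) := by
    have : frontier (A '' T) = (dilMap M ^ l) '' frontier T :=
      (A.toHomeomorph.image_frontier T).symm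
    rw [this, Measure.addHaar_image_linearMap, det_dilMap_pow, abs_pow,
      ENNReal.ofReal_pow (abs_nonneg _), hcard]
  have hle : volume (frontier (A '' T)) ≤ ((Γ.erase γ₀).card : ℝ≥0∞) * volume (frontier T) := by
    refine (measure_mono hfr).trans ((measure_biUnion_finset_le _ _).trans ?_)
    simp [volume_shiftSet]
  have hffin : volume (frontier T) ≠ ∞ :=
    ((measure_mono hT.isCompact.isClosed.frontier_subset).trans_lt
      hT.isCompact.measure_lt_top).ne
  by_contra hne
  rw [hvol] at hle
  have h1 : ((D.card ^ l : ℕ) : ℝ≥0∞) ≤ ((Γ.erase γ₀).card : ℝ≥0∞) := by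
    push_cast
    exact (ENNReal.mul_le_mul_iff_left hne hffin).1 hle
  have h2 : D.card ^ l ≤ (Γ.erase γ₀).card := by exact_mod_cast h1
  rw [Finset.card_erase_of_mem hγ₀] at h2
  have : 0 < Γ.card := Finset.card_pos.2 ⟨γ₀, hγ₀⟩
  omega

/-- Up to a null set, every point lies in the interior of a lattice translate of the tile. -/
theorem IsSelfAffineTile.ae_mem_interior {M : Matrix (Fin n) (Fin n) ℤ} {T : Set (E n)}
    (hT : IsSelfAffineTile M T) (h0 : volume (frontier T) = 0) :
    ∀ᵐ x : E n, ∃ ν : Fin n → ℤ, x - latVec ν ∈ interior T := by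
  have : ∀ᵐ x : E n, ∀ ν : Fin n → ℤ, x ∉ shiftSet (frontier T) (latVec ν) := by
    rw [ae_all_iff]
    intro ν
    rw [ae_iff]
    simpa [volume_shiftSet] using h0
  filter_upwards [this] with x hx
  have hxu : x ∈ ⋃ ν : Fin n → ℤ, shiftSet T (latVec ν) := by rw [hT.cover]; trivial
  obtain ⟨ν, hν⟩ := Set.mem_iUnion.1 hxu
  refine ⟨ν, by_contra fun hi => hx ν (mem_shiftSet.2 ⟨subset_closure (mem_shiftSet.1 hν), hi⟩)⟩

theorem ae_mem_interior_of_volume_frontier {T : Set (E n)} (hT : IsCompact T)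
    (h0 : volume (frontier T) = 0) : ∀ᵐ x ∂(volume.restrict T), x ∈ interior T := by
  rw [ae_restrict_iff' hT.measurableSet]
  have : ∀ᵐ x : E n, x ∉ frontier T := by rw [ae_iff]; simpa using h0
  filter_upwards [this] with x hx hxT
  exact by_contra fun hi => hx ⟨subset_closure hxT, hi⟩

/-! ### Mixed norms and Minkowski's inequality -/

section MixedNorm

variable {X W : Type*} [MeasurableSpace X] [MeasurableSpace W] {ν : Measure X}
  {μ : Measure W}

theorem eLpNorm_top_le_of_ae {F : X → ℝ≥0∞} {c : ℝ≥0∞} (h : ∀ᵐ x ∂ν, F x ≤ c) :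
    eLpNorm F ∞ ν ≤ c := by
  rw [eLpNorm_exponent_top]
  exact eLpNormEssSup_le_of_ae_enorm_bound (by simpa using h)

theorem ae_le_eLpNorm_top (F : X → ℝ≥0∞) : ∀ᵐ x ∂ν, F x ≤ eLpNorm F ∞ ν := by
  rw [eLpNorm_exponent_top]
  simpa using enorm_ae_le_eLpNormEssSup F ν

theorem lintegral_rpow_eq_eLpNorm_rpow {p : ℝ≥0∞} (hp : 1 ≤ p) (hp' : p ≠ ∞) (F : X → ℝ≥0∞) :
    ∫⁻ x, F x ^ p.toReal ∂ν = eLpNorm F p ν ^ p.toReal := by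
  have hp0 : p ≠ 0 := (zero_lt_one.trans_le hp).ne'
  rw [eLpNorm_eq_lintegral_rpow_enorm_toReal hp0 hp', one_div, ← ENNReal.rpow_mul,
    inv_mul_cancel₀ (ENNReal.toReal_ne_zero.2 ⟨hp0, hp'⟩), ENNReal.rpow_one]
  rfl

theorem eLpNorm_eq_of_lintegral {p : ℝ≥0∞} (hp : 1 ≤ p) (hp' : p ≠ ∞) (F : X → ℝ≥0∞) :
    eLpNorm F p ν = (∫⁻ x, F x ^ p.toReal ∂ν) ^ (1 / p.toReal) := by
  have hp0 : p ≠ 0 := (zero_lt_one.trans_le hp).ne'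
  rw [eLpNorm_eq_lintegral_rpow_enorm_toReal hp0 hp']
  rfl

/-- If the sections `F(·, w)` are bounded in `L^p(ν)`, then `F` belongs to the mixed norm space
`L^p(ν; L^p(μ))`. The inner norm is replaced by a measurable majorant, since for `p = ∞` its
measurability would be an additional matter. -/
theorem exists_measurable_majorant [SFinite ν] [IsFiniteMeasure μ] {F : X → W → ℝ≥0∞}
    (hF : Measurable (Function.uncurry F)) {p c : ℝ≥0∞} (hp : 1 ≤ p)
    (h : ∀ᵐ w ∂μ, eLpNorm (fun x => F x w) p ν ≤ c) :
    ∃ N : X → ℝ≥0∞, Measurable N ∧ (∀ᵐ x ∂ν, eLpNorm (F x) p μ ≤ N x) ∧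
      eLpNorm N p ν ≤ μ Set.univ ^ (1 / p.toReal) * c := by
  have hp0 : p ≠ 0 := (zero_lt_one.trans_le hp).ne'
  rcases eq_or_ne p ∞ with rfl | hp'
  · refine ⟨fun _ => c, measurable_const, ?_, ?_⟩
    · have h1 : ∀ᵐ w ∂μ, ∀ᵐ x ∂ν, F x w ≤ c := by
        filter_upwards [h] with w hw
        filter_upwards [ae_le_eLpNorm_top (ν := ν) fun x => F x w] with x hx using hx.trans hw
      have h2 := (Measure.ae_ae_comm (μ := ν) (ν := μ) (p := fun x w => F x w ≤ c)
        (measurableSet_le hF measurable_const)).2 h1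
      filter_upwards [h2] with x hx using eLpNorm_top_le_of_ae hx
    · simpa using eLpNorm_top_le_of_ae (Eventually.of_forall fun _ => le_rfl)
  · have hpos : 0 < p.toReal := ENNReal.toReal_pos hp0 hp'
    refine ⟨fun x => eLpNorm (F x) p μ, ?_, Eventually.of_forall fun _ => le_rfl, ?_⟩
    · simp_rw [eLpNorm_eq_of_lintegral hp hp']
      exact (Measurable.lintegral_prod_right' (hF.pow_const _)).pow_const _
    · have hsec : ∀ w, ∫⁻ x, F x w ^ p.toReal ∂ν = eLpNorm (fun x => F x w) p ν ^ p.toReal :=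
        fun w => lintegral_rpow_eq_eLpNorm_rpow hp hp' _
      rw [eLpNorm_eq_of_lintegral hp hp']
      simp_rw [← lintegral_rpow_eq_eLpNorm_rpow hp hp']
      rw [lintegral_lintegral_swap (hF.pow_const _).aemeasurable]
      simp_rw [hsec]
      calc _ ≤ (∫⁻ _ : W, c ^ p.toReal ∂μ) ^ (1 / p.toReal) := by
            gcongr ?_ ^ _
            refine lintegral_mono_ae ?_
            filter_upwards [h] with w hw
            gcongr
        _ = _ := by
            rw [lintegral_const, ENNReal.mul_rpow_of_nonneg _ _ (by positivity), ← ENNReal.rpow_mul,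
              mul_one_div_cancel hpos.ne', ENNReal.rpow_one, mul_comm]

/-- Minkowski's integral inequality, for a family that is bounded in `L^p`. -/
theorem eLpNorm_lintegral_le [SFinite ν] [IsFiniteMeasure μ] {F : X → W → ℝ≥0∞}
    (hF : Measurable (Function.uncurry F)) {p c : ℝ≥0∞} (hp : 1 ≤ p)
    (h : ∀ᵐ w ∂μ, eLpNorm (fun x => F x w) p ν ≤ c) :
    eLpNorm (fun x => ∫⁻ w, F x w ∂μ) p ν ≤ μ Set.univ * c := by
  rcases eq_or_ne μ 0 with rfl | hμ
  · simp
  have hμ0 : μ Set.univ ≠ 0 := by simpa using hμ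
  obtain ⟨N, hN, hFN, hNc⟩ := exists_measurable_majorant hF hp h
  have h1 : ∀ᵐ x ∂ν, ∫⁻ w, F x w ∂μ ≤ N x * μ Set.univ ^ (1 - 1 / p.toReal) := by
    filter_upwards [hFN] with x hx
    have h2 := eLpNorm_le_eLpNorm_mul_rpow_measure_univ (μ := μ) hp (f := F x)
      (hF.comp measurable_prodMk_left).aestronglyMeasurable
    rw [eLpNorm_one_eq_lintegral_enorm, ENNReal.toReal_one, one_div_one] at h2
    exact h2.trans (by gcongr)
  calc _ ≤ eLpNorm (fun x => μ Set.univ ^ (1 - 1 / p.toReal) * N x) p ν := by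
        refine eLpNorm_mono_enorm_ae ?_
        filter_upwards [h1] with x hx
        rw [mul_comm]
        exact hx
    _ ≤ μ Set.univ ^ (1 - 1 / p.toReal) * eLpNorm N p ν := by
        have hp0 : p ≠ 0 := (zero_lt_one.trans_le hp).ne'
        rcases eq_or_ne p ∞ with rfl | hp'
        · refine eLpNorm_top_le_of_ae ?_
          filter_upwards [ae_le_eLpNorm_top (ν := ν) N] with x hx
          gcongr
        · have hpos : 0 < p.toReal := ENNReal.toReal_pos hp0 hp'
          rw [eLpNorm_eq_of_lintegral hp hp', eLpNorm_eq_of_lintegral hp hp']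
          simp_rw [ENNReal.mul_rpow_of_nonneg _ _ hpos.le]
          rw [lintegral_const_mul _ (hN.pow_const _),
            ENNReal.mul_rpow_of_nonneg _ _ (by positivity), ← ENNReal.rpow_mul,
            mul_one_div_cancel hpos.ne', ENNReal.rpow_one]
    _ ≤ μ Set.univ ^ (1 - 1 / p.toReal) * (μ Set.univ ^ (1 / p.toReal) * c) := by gcongr
    _ = _ := by
        rw [← mul_assoc, ← ENNReal.rpow_add _ _ hμ0 (measure_ne_top _ _)]
        simp

theorem ae_lt_top_of_eLpNorm {F : X → ℝ≥0∞} (hF : Measurable F) {p : ℝ≥0∞} (hp : 1 ≤ p)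
    (h : eLpNorm F p ν ≠ ∞) : ∀ᵐ x ∂ν, F x < ∞ := by
  rcases eq_or_ne p ∞ with rfl | hp'
  · filter_upwards [ae_le_eLpNorm_top (ν := ν) F] with x hx using hx.trans_lt h.lt_top
  · have hp0 : p ≠ 0 := (zero_lt_one.trans_le hp).ne'
    have hpos : 0 < p.toReal := ENNReal.toReal_pos hp0 hp'
    have h1 : ∫⁻ x, F x ^ p.toReal ∂ν ≠ ∞ := by
      rw [lintegral_rpow_eq_eLpNorm_rpow hp hp']
      exact ENNReal.rpow_ne_top_of_nonneg hpos.le h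
    filter_upwards [ae_lt_top (hF.pow_const _) h1] with x hx
    exact (ENNReal.rpow_lt_top_iff_of_pos hpos).1 hx

end MixedNorm

/-- A function is controlled by its averages: if the `L^p` norm of `G` over `x + K` is at most
`R x`, then the `L^p` norm of `G` is at most a constant times that of `R`, which need not be
measurable. -/
theorem eLpNorm_le_of_local {G : E n → ℂ} (hG : Measurable G) {K : Set (E n)}
    (hK0 : volume K ≠ 0) {p : ℝ≥0∞} (hp : 1 ≤ p) {R : E n → ℝ≥0∞}
    (hR : ∀ x, eLpNorm (fun z => G (x + z)) p (volume.restrict K) ≤ R x) :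
    volume K ^ (1 / p.toReal) * eLpNorm G p volume ≤ eLpNorm R p volume := by
  have hp0 : p ≠ 0 := (zero_lt_one.trans_le hp).ne'
  have hmeas : Measurable fun z : E n × E n => ‖G (z.1 + z.2)‖ₑ :=
    (hG.comp (measurable_fst.add measurable_snd)).enorm
  have htrans : ∀ z : E n, eLpNorm (fun x => G (x + z)) p volume = eLpNorm G p volume := fun z =>
    eLpNorm_comp_measurePreserving hG.aestronglyMeasurable (measurePreserving_add_right volume z)
  rcases eq_or_ne p ∞ with rfl | hp'
  · have h1 : ∀ᵐ x : E n, ∀ᵐ z ∂(volume.restrict K), ‖G (x + z)‖ₑ ≤ eLpNorm R ∞ volume := by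
      filter_upwards [ae_le_eLpNorm_top (ν := volume) R] with x hx
      have := enorm_ae_le_eLpNormEssSup (fun z => G (x + z)) (volume.restrict K)
      rw [← eLpNorm_exponent_top] at this
      filter_upwards [this] with z hz using hz.trans ((hR x).trans hx)
    have h2 := (Measure.ae_ae_comm (μ := (volume : Measure (E n))) (ν := volume.restrict K)
      (p := fun x z => ‖G (x + z)‖ₑ ≤ eLpNorm R ∞ volume)
      (measurableSet_le hmeas measurable_const)).1 h1
    have : NeZero (volume.restrict K) := ⟨by simpa using hK0⟩
    obtain ⟨z, hz⟩ := h2.exists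
    have h3 : eLpNorm (fun x => G (x + z)) ∞ volume ≤ eLpNorm R ∞ volume := by
      rw [eLpNorm_exponent_top]
      exact eLpNormEssSup_le_of_ae_enorm_bound hz
    rw [htrans] at h3
    simpa using h3
  · have hpos : 0 < p.toReal := ENNReal.toReal_pos hp0 hp'
    have h1 : volume K * eLpNorm G p volume ^ p.toReal ≤ ∫⁻ x, R x ^ p.toReal := by
      calc _ = ∫⁻ z in K, ∫⁻ x : E n, ‖G (x + z)‖ₑ ^ p.toReal := by
            have : ∀ z : E n, ∫⁻ x : E n, ‖G (x + z)‖ₑ ^ p.toReal =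
                eLpNorm G p volume ^ p.toReal := by
              intro z
              rw [lintegral_rpow_eq_eLpNorm_rpow hp hp', ← htrans z,
                eLpNorm_enorm (fun x => G (x + z))]
            simp_rw [this]
            simp [mul_comm]
        _ = ∫⁻ x : E n, ∫⁻ z in K, ‖G (x + z)‖ₑ ^ p.toReal :=
            (lintegral_lintegral_swap (hmeas.pow_const _).aemeasurable).symm
        _ ≤ _ := by
            refine lintegral_mono fun x => ?_
            rw [lintegral_rpow_eq_eLpNorm_rpow hp hp', eLpNorm_enorm (fun z => G (x + z))]
            gcongr
            exact hR x
    have h2 := ENNReal.rpow_le_rpow h1 (z := 1 / p.toReal) (by positivity)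
    rwa [ENNReal.mul_rpow_of_nonneg _ _ (by positivity), ← ENNReal.rpow_mul,
      mul_one_div_cancel hpos.ne', ENNReal.rpow_one, ← eLpNorm_eq_of_lintegral hp hp'] at h2

/-! ### Affine changes of variables -/

/-- The factor by which an affine map with linear part `A⁻¹` changes Lebesgue measure. -/
noncomputable def volFactor (A : E n ≃L[ℝ] E n) : ℝ≥0∞ :=
  ENNReal.ofReal |(LinearMap.det (A : E n →ₗ[ℝ] E n))⁻¹|

theorem det_equiv_ne_zero (A : E n ≃L[ℝ] E n) : LinearMap.det (A : E n →ₗ[ℝ] E n) ≠ 0 :=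
  (LinearEquiv.isUnit_det' A.toLinearEquiv).ne_zero

theorem volFactor_ne_zero (A : E n ≃L[ℝ] E n) : volFactor A ≠ 0 := by
  simp [volFactor, det_equiv_ne_zero A]

theorem volFactor_ne_top (A : E n ≃L[ℝ] E n) : volFactor A ≠ ∞ := ENNReal.ofReal_ne_top

theorem map_affine_volume (A : E n ≃L[ℝ] E n) (a : E n) :
    Measure.map (fun x => A x + a) volume = volFactor A • (volume : Measure (E n)) := by
  have h1 : (fun x => A x + a) = (fun y => y + a) ∘ ⇑(A : E n →ₗ[ℝ] E n) := rfl
  rw [h1, ← Measure.map_map (by fun_prop)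
      (show Measurable ⇑(A : E n →ₗ[ℝ] E n) from A.continuous.measurable),
    Measure.map_linearMap_addHaar_eq_smul_addHaar volume (det_equiv_ne_zero A), Measure.map_smul,
    map_add_right_eq_self]
  rfl

theorem measurableEmbedding_affine (A : E n ≃L[ℝ] E n) (a : E n) :
    MeasurableEmbedding (fun x => A x + a) :=
  (A.toHomeomorph.trans (Homeomorph.addRight a)).measurableEmbedding

/-- Since affine automorphisms are measurable embeddings, `F` need not be measurable. -/
theorem eLpNorm_comp_affine {ε : Type*} [TopologicalSpace ε] [ContinuousENorm ε] (A : E n ≃L[ℝ] E n)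
    (a : E n) (F : E n → ε) (p : ℝ≥0∞) :
    eLpNorm (fun x => F (A x + a)) p volume =
      volFactor A ^ (1 / p).toReal * eLpNorm F p volume := by
  have h := (measurableEmbedding_affine A a).eLpNorm_map_measure (g := F) (p := p)
    (μ := (volume : Measure (E n)))
  rw [map_affine_volume, eLpNorm_smul_measure_of_ne_zero (volFactor_ne_zero A)] at h
  exact h.symm

theorem integral_comp_affine (A : E n ≃L[ℝ] E n) (a : E n) (F : E n → ℂ) :
    ∫ x, F (A x + a) = ((volFactor A).toReal : ℂ) * ∫ y, F y := by
  have h := (measurableEmbedding_affine A a).integral_map (μ := (volume : Measure (E n))) F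
  rw [map_affine_volume, integral_smul_measure] at h
  rw [← h]
  simp

/-! ### Weighted sequence norms -/

theorem lqNorm_le_mul {q : ℝ≥0∞} (hq : 1 ≤ q) {C : ℝ≥0∞} {b c : ℕ → ℝ≥0∞}
    (h : ∀ l, b l ≤ C * c l) : lqNorm q b ≤ C * lqNorm q c := by
  unfold lqNorm
  split_ifs with hq'
  · refine iSup_le fun l => (h l).trans ?_
    gcongr
    exact le_iSup c l
  · have hpos : 0 < q.toReal := ENNReal.toReal_pos (zero_lt_one.trans_le hq).ne' hq'
    calc _ ≤ (∑' l, C ^ q.toReal * c l ^ q.toReal) ^ (1 / q.toReal) := by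
          gcongr with l
          rw [← ENNReal.mul_rpow_of_nonneg _ _ hpos.le]
          gcongr
          exact h l
      _ = _ := by
          rw [ENNReal.tsum_mul_left, ENNReal.mul_rpow_of_nonneg _ _ (by positivity),
            ← ENNReal.rpow_mul, mul_one_div_cancel hpos.ne', ENNReal.rpow_one]

/-! ### Oscillation: comparison with differences and with quasi-interpolation -/

theorem toReal_one_div (p : ℝ≥0∞) : (1 / p).toReal = 1 / p.toReal := by simp

/-- Here `F` need not be measurable, as is required for the oscillation, an infimum over uncountably
many polynomials. -/
theorem eLpNorm_const_mul_le {X : Type*} [MeasurableSpace X] {ν : Measure X} {C : ℝ≥0∞}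
    (hC : C ≠ ∞) (F : X → ℝ≥0∞) {p : ℝ≥0∞} (hp : 1 ≤ p) :
    eLpNorm (fun x => C * F x) p ν ≤ C * eLpNorm F p ν := by
  have hp0 : p ≠ 0 := (zero_lt_one.trans_le hp).ne'
  rcases eq_or_ne p ∞ with rfl | hp'
  · refine eLpNorm_top_le_of_ae ?_
    filter_upwards [ae_le_eLpNorm_top (ν := ν) F] with x hx
    gcongr
  · have hpos : 0 < p.toReal := ENNReal.toReal_pos hp0 hp'
    rw [eLpNorm_eq_of_lintegral hp hp', eLpNorm_eq_of_lintegral hp hp']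
    simp_rw [ENNReal.mul_rpow_of_nonneg _ _ hpos.le]
    rw [lintegral_const_mul' _ _ (ENNReal.rpow_ne_top_of_nonneg hpos.le hC),
      ENNReal.mul_rpow_of_nonneg _ _ (by positivity), ← ENNReal.rpow_mul,
      mul_one_div_cancel hpos.ne', ENNReal.rpow_one]

theorem avgNorm_eq {Q : Set (E n)} (hQ0 : volume Q ≠ 0) (hQ : volume Q ≠ ∞) (p : ℝ≥0∞)
    (g : E n → ℂ) :
    eLpNorm g p (volume.restrict Q) = volume Q ^ (1 / p.toReal) * avgNorm p Q g := by
  rw [avgNorm, eLpNorm_smul_measure_of_ne_zero (ENNReal.inv_ne_zero.2 hQ), toReal_one_div,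
    smul_eq_mul, ← mul_assoc, ENNReal.inv_rpow, ENNReal.mul_inv_cancel, one_mul]
  · simp [hQ0, hQ]
  · exact ENNReal.rpow_ne_top_of_nonneg (by positivity) hQ

theorem volume_preimage_affine (A : E n ≃L[ℝ] E n) (v : E n) (S : Set (E n)) :
    volume ((fun y => A y + v) ⁻¹' S) = volFactor A * volume S := by
  rw [← (measurableEmbedding_affine A v).map_apply, map_affine_volume]
  rfl

theorem cell_eq_preimage {M : Matrix (Fin n) (Fin n) ℤ} (hM : IsDilation M) (T : Set (E n))
    (a : E n) (l : ℕ) (x : E n) :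
    cell M T a l x =
      (fun y => dilEquiv M hM l y + (-dilEquiv M hM l x - a)) ⁻¹' T := by
  ext y
  simp only [cell, Set.mem_ofPred_eq, mem_shiftSet, Set.mem_preimage, map_sub, dilEquiv_apply]
  rw [show ∀ b c d : E n, b - c - d = b + (-c - d) from fun b c d => by abel]

/-- Differences of order `k + 1` annihilate polynomials of degree at most `k`. -/
theorem fwdDiff_iter_eval_eq_zero {k : ℕ} {P : MvPolynomial (Fin n) ℂ} (hP : P.totalDegree ≤ k)
    (u : E n) :
    (fwdDiff u)^[k + 1] (fun y : E n => MvPolynomial.eval (fun i => ((y i : ℝ) : ℂ)) P) = 0 := by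
  funext y
  set Q : Polynomial ℂ := MvPolynomial.aeval
    (fun i => Polynomial.C ((u i : ℝ) : ℂ) * Polynomial.X + Polynomial.C ((y i : ℝ) : ℂ)) P
    with hQ
  have hdeg : Q.natDegree < k + 1 := by
    have := MvPolynomial.aeval_natDegree_le P hP (n := 1)
      (fun i => Polynomial.C ((u i : ℝ) : ℂ) * Polynomial.X + Polynomial.C ((y i : ℝ) : ℂ))
      fun i => Polynomial.natDegree_linear_le
    exact lt_of_le_of_lt this (by omega)
  have h0 := congrFun (Polynomial.fwdDiff_iter_eq_zero_of_degree_lt hdeg) 0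
  rw [fwdDiff_iter_eq_sum_shift] at h0 ⊢
  refine Eq.trans ?_ h0
  refine Finset.sum_congr rfl fun j _ => ?_
  congr 1
  rw [hQ, MvPolynomial.aeval_def, MvPolynomial.eval₂_eq', MvPolynomial.eval_eq',
    Polynomial.eval_finsetSum]
  refine Finset.sum_congr rfl fun d _ => ?_
  rw [Polynomial.eval_mul, Polynomial.eval_prod]
  congr 1
  · simp
  · refine Finset.prod_congr rfl fun i _ => ?_
    simp
    ring

/-- The sum of the absolute values of the coefficients of a difference of order `N`. -/
noncomputable def diffConst (N : ℕ) : ℝ≥0∞ :=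
  ∑ j ∈ Finset.range (N + 1), ‖(((-1 : ℤ) ^ (N - j) * N.choose j : ℤ) : ℂ)‖ₑ

theorem diffConst_ne_top (N : ℕ) : diffConst N ≠ ∞ := by
  simp [diffConst, ENNReal.sum_eq_top]

theorem diffConst_ne_zero (N : ℕ) : diffConst N ≠ 0 := by
  intro h
  have := (Finset.sum_eq_zero_iff.1 h) N (by simp)
  simp at this

theorem measurable_fwdDiff_iter {g : E n → ℂ} (hg : Measurable g) (u : E n) (N : ℕ) :
    Measurable ((fwdDiff u)^[N] g) := by
  have : (fwdDiff u)^[N] g = fun y => ∑ j ∈ Finset.range (N + 1),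
      ((-1 : ℤ) ^ (N - j) * N.choose j) • g (y + j • u) := by
    funext y; exact fwdDiff_iter_eq_sum_shift u g N y
  rw [this]
  refine Finset.measurable_sum _ fun j _ => ?_
  have h : Measurable fun y : E n => g (y + j • u) := hg.comp (by fun_prop)
  simpa only [zsmul_eq_mul] using h.const_mul _

theorem eLpNorm_comp_add_restrict_le {h : E n → ℂ} {p : ℝ≥0∞} {K Q : Set (E n)}
    {v : E n} (hKQ : ∀ z ∈ K, z + v ∈ Q) :
    eLpNorm (fun z => h (z + v)) p (volume.restrict K) ≤ eLpNorm h p (volume.restrict Q) := by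
  have he : MeasurableEmbedding fun z : E n => z + v :=
    (Homeomorph.addRight v).measurableEmbedding
  have h1 := he.eLpNorm_map_measure (g := h) (p := p)
    (μ := (volume : Measure (E n)).restrict ((fun z => z + v) ⁻¹' Q))
  rw [← he.restrict_map, map_add_right_eq_self] at h1
  rw [h1]
  exact eLpNorm_mono_measure _ (Measure.restrict_mono hKQ le_rfl)

theorem eLpNorm_fwdDiff_restrict_le {h : E n → ℂ} (hh : Measurable h) {p : ℝ≥0∞} (hp : 1 ≤ p)
    {K Q : Set (E n)} {x u : E n} {N : ℕ} (hKQ : ∀ z ∈ K, ∀ j ≤ N, z + (x + j • u) ∈ Q) :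
    eLpNorm (fun z => (fwdDiff u)^[N] h (x + z)) p (volume.restrict K) ≤
      diffConst N * eLpNorm h p (volume.restrict Q) := by
  have h1 : (fun z => (fwdDiff u)^[N] h (x + z)) = ∑ j ∈ Finset.range (N + 1),
      (((-1 : ℤ) ^ (N - j) * N.choose j : ℤ) : ℂ) • fun z => h (z + (x + j • u)) := by
    funext z
    rw [fwdDiff_iter_eq_sum_shift, Finset.sum_apply]
    refine Finset.sum_congr rfl fun j _ => ?_
    rw [Pi.smul_apply, zsmul_eq_mul, smul_eq_mul,
      show x + z + j • u = z + (x + j • u) by abel]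
  rw [h1, diffConst, Finset.sum_mul]
  refine (eLpNorm_sum_le (fun j _ => ?_) hp).trans (Finset.sum_le_sum fun j hj => ?_)
  · exact ((hh.comp (by fun_prop)).aestronglyMeasurable).const_smul _
  · rw [eLpNorm_const_smul]
    gcongr
    exact eLpNorm_comp_add_restrict_le fun z hz =>
      hKQ z hz j (by have := Finset.mem_range.1 hj; omega)

/-- Differences of order `k + 1` are controlled by the oscillation, on every scale. -/
theorem exists_eLpNorm_fwdDiff_le_osc {M : Matrix (Fin n) (Fin n) ℤ} (hM : IsDilation M)
    {T : Set (E n)} (hT : IsCompact T) {a : E n} {r : ℝ} (hr : 0 < r)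
    (hQ : Metric.ball (0 : E n) r ⊆ shiftSet T a) (k : ℕ) {p : ℝ≥0∞} (hp : 1 ≤ p) :
    ∃ C : ℝ≥0∞, C ≠ ∞ ∧ ∀ f : E n → ℂ, Measurable f → ∀ (l : ℕ) (u : E n),
      ((k : ℝ) + 1) * ‖(dilMap M ^ l) u‖ < r / 2 →
      eLpNorm ((fwdDiff u)^[k + 1] f) p volume ≤
        C * eLpNorm (fun x => osc M T a k p f l x) p volume := by
  set e : ℝ := 1 / p.toReal with he
  have he0 : 0 ≤ e := by positivity
  have hT0 : volume T ≠ 0 := fun h => by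
    have := measure_mono_null (ball_neg_subset_of_ball_subset_shiftSet hQ) h
    exact (Metric.measure_ball_pos volume (-a) hr).ne' this
  have hTtop : volume T ≠ ∞ := hT.measure_lt_top.ne
  set β : ℝ≥0∞ := volume (Metric.ball (0 : E n) (r / 2)) with hβ
  have hβ0 : β ≠ 0 := (Metric.measure_ball_pos volume 0 (half_pos hr)).ne'
  have hβtop : β ≠ ∞ := measure_ball_lt_top.ne
  refine ⟨(β ^ e)⁻¹ * (diffConst (k + 1) * volume T ^ e), ?_, fun f hf l u hu => ?_⟩
  · refine ENNReal.mul_ne_top ?_ (ENNReal.mul_ne_top (diffConst_ne_top _)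
      (ENNReal.rpow_ne_top_of_nonneg he0 hTtop))
    simp [hβ0, hβtop, ENNReal.rpow_eq_zero_iff]
  set A := dilEquiv M hM l with hA
  set κ := volFactor A with hκ
  have hκ0 : κ ≠ 0 := volFactor_ne_zero A
  have hκtop : κ ≠ ∞ := volFactor_ne_top A
  -- For `z ∈ K`, all the points `x + z + j u` lie in the cell with base point `x`.
  set K : Set (E n) := (fun y => A y + 0) ⁻¹' Metric.ball (0 : E n) (r / 2) with hK
  have hKvol : volume K = κ * β := volume_preimage_affine A 0 _
  have hcell : ∀ x, volume (cell M T a l x) = κ * volume T := fun x => by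
    rw [cell_eq_preimage hM, volume_preimage_affine]
  have hKcell : ∀ x, ∀ z ∈ K, ∀ j ≤ k + 1, z + (x + j • u) ∈ cell M T a l x := by
    intro x z hz j hj
    have hz' : ‖A z‖ < r / 2 := by simpa [hK] using hz
    change A (z + (x + j • u) - x) ∈ shiftSet T a
    apply hQ
    rw [mem_ball_zero_iff, show z + (x + j • u) - x = z + j • u by abel, map_add, map_nsmul]
    have hj' : (j : ℝ) ≤ (k : ℝ) + 1 := by exact_mod_cast hj
    calc ‖A z + j • A u‖ ≤ ‖A z‖ + ‖j • A u‖ := norm_add_le _ _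
      _ ≤ ‖A z‖ + j * ‖A u‖ := by gcongr; exact norm_nsmul_le
      _ ≤ ‖A z‖ + ((k : ℝ) + 1) * ‖A u‖ := by gcongr
      _ < r / 2 + r / 2 := add_lt_add hz' hu
      _ = r := by ring
  set B : ℝ≥0∞ := diffConst (k + 1) * (κ * volume T) ^ e with hB
  have hB0 : B ≠ 0 := mul_ne_zero (diffConst_ne_zero _) (by
    simp [ENNReal.rpow_eq_zero_iff, hκ0, hT0, ENNReal.mul_eq_top, hκtop, hTtop])
  have hBtop : B ≠ ∞ := ENNReal.mul_ne_top (diffConst_ne_top _)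
    (ENNReal.rpow_ne_top_of_nonneg he0 (ENNReal.mul_ne_top hκtop hTtop))
  have hloc : ∀ x, eLpNorm (fun z => (fwdDiff u)^[k + 1] f (x + z)) p (volume.restrict K) ≤
      B * osc M T a k p f l x := by
    intro x
    rw [osc, ENNReal.mul_iInf_of_ne hB0 hBtop]
    refine le_iInf fun P => ?_
    rw [ENNReal.mul_iInf_of_ne hB0 hBtop]
    refine le_iInf fun hP => ?_
    set ev : E n → ℂ := fun y => MvPolynomial.eval (fun i => ((y i : ℝ) : ℂ)) P with hev
    have hevm : Measurable ev := by
      have : ev = fun y : E n => ∑ d ∈ P.support, P.coeff d * ∏ i, ((y i : ℝ) : ℂ) ^ d i := by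
        funext y; exact MvPolynomial.eval_eq' _ _
      rw [this]
      fun_prop
    have hsub : (fwdDiff u)^[k + 1] f = (fwdDiff u)^[k + 1] (fun y => f y - ev y) := by
      have h1 : f = (fun y => f y - ev y) + ev := by funext y; simp
      conv_lhs => rw [h1, fwdDiff_iter_add, fwdDiff_iter_eval_eq_zero hP, add_zero]
    rw [hsub]
    refine (eLpNorm_fwdDiff_restrict_le (hf.sub hevm) hp (hKcell x)).trans (le_of_eq ?_)
    rw [avgNorm_eq (by rw [hcell]; exact mul_ne_zero hκ0 hT0)
      (by rw [hcell]; exact ENNReal.mul_ne_top hκtop hTtop), hcell, hB, mul_assoc]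
    rfl
  have hmain := eLpNorm_le_of_local (measurable_fwdDiff_iter hf u (k + 1))
    (by rw [hKvol]; exact mul_ne_zero hκ0 hβ0) hp hloc
  replace hmain := hmain.trans (eLpNorm_const_mul_le hBtop _ hp)
  rw [hKvol, hB, ENNReal.mul_rpow_of_nonneg _ _ he0, ENNReal.mul_rpow_of_nonneg _ _ he0] at hmain
  have hκe0 : κ ^ e ≠ 0 := by simp [ENNReal.rpow_eq_zero_iff, hκ0, hκtop]
  have hκetop : κ ^ e ≠ ∞ := ENNReal.rpow_ne_top_of_nonneg he0 hκtop
  have hβe0 : β ^ e ≠ 0 := by simp [ENNReal.rpow_eq_zero_iff, hβ0, hβtop]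
  have hβetop : β ^ e ≠ ∞ := ENNReal.rpow_ne_top_of_nonneg he0 hβtop
  set D := eLpNorm ((fwdDiff u)^[k + 1] f) p volume
  set O := eLpNorm (fun x => osc M T a k p f l x) p volume
  have h1 : κ ^ e * (β ^ e * D) ≤ κ ^ e * (diffConst (k + 1) * volume T ^ e * O) := by
    calc _ = κ ^ e * β ^ e * D := by ring
      _ ≤ _ := hmain
      _ = _ := by ring
  have h2 := (ENNReal.mul_le_mul_iff_right hκe0 hκetop).1 h1
  calc D = (β ^ e)⁻¹ * (β ^ e * D) := by
        rw [← mul_assoc, ENNReal.inv_mul_cancel hβe0 hβetop, one_mul]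
    _ ≤ (β ^ e)⁻¹ * (diffConst (k + 1) * volume T ^ e * O) := by gcongr
    _ = _ := by ring

theorem exists_affine_polynomial (A : E n ≃L[ℝ] E n) (v : E n) (i : Fin n) :
    ∃ L : MvPolynomial (Fin n) ℂ, L.totalDegree ≤ 1 ∧
      ∀ y : E n, MvPolynomial.eval (fun i => ((y i : ℝ) : ℂ)) L = (((A y + v) i : ℝ) : ℂ) := by
  refine ⟨(∑ j, MvPolynomial.C (((A (EuclideanSpace.single j 1)) i : ℝ) : ℂ) *
    MvPolynomial.X j) + MvPolynomial.C ((v i : ℝ) : ℂ), ?_, fun y => ?_⟩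
  · refine (MvPolynomial.totalDegree_add _ _).trans (max_le ?_ (by simp))
    refine MvPolynomial.totalDegree_finsetSum_le fun j _ => ?_
    refine (MvPolynomial.totalDegree_mul _ _).trans ?_
    simp
  · have hy : y = ∑ j, y j • (EuclideanSpace.single j 1 : E n) := by
      have := (EuclideanSpace.basisFun (Fin n) ℝ).sum_repr y
      simpa using this.symm
    have hAy : (A y) i = ∑ j, y j * (A (EuclideanSpace.single j 1)) i := by
      conv_lhs => rw [hy]
      simp [map_sum]
    simp only [map_add, map_sum, map_mul, MvPolynomial.eval_C, MvPolynomial.eval_X,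
      PiLp.add_apply, hAy, Complex.ofReal_add, Complex.ofReal_sum, Complex.ofReal_mul]
    congr 1
    exact Finset.sum_congr rfl fun j _ => mul_comm _ _

/-- The quasi-interpolant is a polynomial on the interior of the cell, hence almost everywhere on
the cell, so that it competes in the definition of the oscillation. -/
theorem osc_le_Omega {M : Matrix (Fin n) (Fin n) ℤ} (hM : IsDilation M)
    {T : Set (E n)} (hT : IsCompact T) (h0 : volume (frontier T) = 0) (a : E n) (k : ℕ)
    (pd : (Fin n → ℕ) → E n → ℂ) (p : ℝ≥0∞) (f : E n → ℂ) (l : ℕ) (x : E n) :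
    osc M T a k p f l x ≤ Omega M T a k pd p f l x := by
  set A := dilEquiv M hM l with hA
  set v : E n := -A x - a with hv
  choose L hLdeg hL using exists_affine_polynomial A v
  set c : (Fin n → ℕ) → ℂ := fun α => pairing f (rescale M a l x (pd α)) *
    (((|(M.det : ℝ)|) ^ ((l : ℝ) / 2) : ℝ) : ℂ) with hc
  set P : MvPolynomial (Fin n) ℂ := ∑ α ∈ multiIdx n k, MvPolynomial.C (c α) * ∏ i, L i ^ α i
    with hP
  have hPdeg : P.totalDegree ≤ k := by
    refine MvPolynomial.totalDegree_finsetSum_le fun α hα => ?_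
    refine (MvPolynomial.totalDegree_mul _ _).trans ?_
    rw [MvPolynomial.totalDegree_C, zero_add]
    refine (MvPolynomial.totalDegree_finsetProd _ _).trans ?_
    refine le_trans (Finset.sum_le_sum fun i _ => ?_) ((mem_multiIdx α).1 hα)
    exact (MvPolynomial.totalDegree_pow _ _).trans
      ((Nat.mul_le_mul_left _ (hLdeg i)).trans (by simp))
  refine (iInf₂_le P hPdeg).trans (le_of_eq ?_)
  rw [Omega, avgNorm, avgNorm]
  refine eLpNorm_congr_ae ?_
  have hcellm : MeasurableSet (cell M T a l x) := by
    rw [cell_eq_preimage hM]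
    exact (measurableEmbedding_affine A v).measurable hT.measurableSet
  refine Measure.ae_smul_measure ?_ _
  rw [ae_restrict_iff' hcellm]
  have hnull : ∀ᵐ y : E n, A y + v ∉ frontier T := by
    rw [ae_iff]
    have := volume_preimage_affine A v (frontier T)
    rw [h0, mul_zero] at this
    simp only [not_not]
    exact this
  filter_upwards [hnull] with y hy hyc
  rw [cell_eq_preimage hM] at hyc
  have hyT : A y + v ∈ interior T := by_contra fun hi => hy ⟨subset_closure hyc, hi⟩
  congr 1
  rw [hP, map_sum, quasiInterp]
  refine Finset.sum_congr rfl fun α _ => ?_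
  have harg : (dilMap M ^ l) (y - x) - a = A y + v := by
    rw [hv, map_sub]
    change A y - A x - a = _
    abel
  rw [rescale, harg, tileMonomial, Set.indicator_of_mem hyT, map_mul, MvPolynomial.eval_C,
    map_prod, hc]
  simp only [map_pow, hL]
  ring

/-! ### Tile monomials and existence of a dual family -/

/-- The monomial `x ^ α` as a complex valued function on all of `ℝⁿ`. -/
def mono (α : Fin n → ℕ) (x : E n) : ℂ := ∏ i, ((x i : ℝ) : ℂ) ^ α i

theorem continuous_mono (α : Fin n → ℕ) : Continuous (mono α : E n → ℂ) := by
  unfold mono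
  fun_prop

theorem tileMonomial_of_mem {T : Set (E n)} {x : E n} (hx : x ∈ interior T) (α : Fin n → ℕ) :
    tileMonomial T α x = mono α x := by
  rw [tileMonomial, Set.indicator_of_mem hx]; rfl

theorem tileMonomial_of_notMem {T : Set (E n)} {x : E n} (hx : x ∉ interior T) (α : Fin n → ℕ) :
    tileMonomial T α x = 0 := by
  rw [tileMonomial, Set.indicator_of_notMem hx]

theorem measurable_tileMonomial (T : Set (E n)) (α : Fin n → ℕ) :
    Measurable (tileMonomial T α) :=
  (continuous_mono α).measurable.indicator isOpen_interior.measurableSet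

theorem exists_tileMonomial_le {T : Set (E n)} (hT : IsCompact T) (α : Fin n → ℕ) :
    ∃ B : ℝ, 0 ≤ B ∧ ∀ x, ‖tileMonomial T α x‖ ≤ B := by
  obtain ⟨B, hB⟩ := hT.exists_bound_of_continuousOn (continuous_mono α).continuousOn
  refine ⟨|B|, abs_nonneg B, fun x => ?_⟩
  by_cases hx : x ∈ interior T
  · rw [tileMonomial_of_mem hx]
    exact (hB x (interior_subset hx)).trans (le_abs_self B)
  · rw [tileMonomial_of_notMem hx, norm_zero]
    exact abs_nonneg B

theorem integrable_tileMonomial_mul {T : Set (E n)} (hT : IsCompact T) (α β : Fin n → ℕ) :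
    Integrable fun x => tileMonomial T α x * tileMonomial T β x := by
  have : (fun x => tileMonomial T α x * tileMonomial T β x) =
      (interior T).indicator fun x => mono α x * mono β x := by
    funext x
    by_cases hx : x ∈ interior T
    · rw [Set.indicator_of_mem hx, tileMonomial_of_mem hx, tileMonomial_of_mem hx]
    · rw [Set.indicator_of_notMem hx, tileMonomial_of_notMem hx, zero_mul]
  rw [this, integrable_indicator_iff isOpen_interior.measurableSet]
  exact (((continuous_mono α).mul (continuous_mono β)).continuousOn.integrableOn_compact hT).mono_set
    interior_subset

/-- A combination of monomials that vanishes on a nonempty open set is trivial. -/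
theorem coeff_eq_zero_of_forall_sum_mono_eq_zero {U : Set (E n)} (hU : IsOpen U) (hne : U.Nonempty)
    {S : Finset (Fin n → ℕ)} {v : (Fin n → ℕ) → ℂ} (h : ∀ x ∈ U, ∑ γ ∈ S, v γ * mono γ x = 0) :
    ∀ γ ∈ S, v γ = 0 := by
  classical
  set e : (Fin n →₀ ℕ) ≃ (Fin n → ℕ) := Finsupp.equivFunOnFinite with he
  set P : MvPolynomial (Fin n) ℂ := ∑ γ ∈ S, MvPolynomial.monomial (e.symm γ) (v γ) with hP
  have heval : ∀ y : Fin n → ℂ, MvPolynomial.eval y P = ∑ γ ∈ S, v γ * ∏ i, y i ^ γ i := by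
    intro y
    rw [hP, map_sum]
    refine Finset.sum_congr rfl fun γ _ => ?_
    rw [MvPolynomial.eval_monomial, Finsupp.prod_fintype _ _ (by simp)]
    rfl
  obtain ⟨c, hc⟩ := hne
  set V : Set (Fin n → ℝ) := (fun y => (WithLp.toLp 2 y : E n)) ⁻¹' U with hV
  have hVo : IsOpen V := hU.preimage (PiLp.continuous_toLp 2 _)
  have hcV : c.ofLp ∈ V := hc
  obtain ⟨ε, hε, hball⟩ := Metric.isOpen_iff.1 hVo _ hcV
  have hP0 : P = 0 := by
    refine MvPolynomial.funext_set
      (fun i => (fun t : ℝ => (t : ℂ)) '' Metric.ball (c i) ε) (fun i => ?_) fun y hy => ?_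
    · refine Set.Infinite.image Complex.ofReal_injective.injOn ?_
      rw [Real.ball_eq_Ioo]
      exact Set.Ioo_infinite (by linarith)
    · have hy' : ∀ i, ∃ t ∈ Metric.ball (c i) ε, (t : ℂ) = y i := fun i => hy i trivial
      choose t ht hty using hy'
      have htU : (WithLp.toLp 2 t : E n) ∈ U := by
        have : t ∈ Metric.ball c.ofLp ε := by
          rw [Metric.mem_ball, dist_pi_lt_iff hε]
          exact ht
        exact hball this
      rw [heval, map_zero, ← h _ htU]
      simp [mono, hty]
  intro γ hγ
  have : MvPolynomial.coeff (e.symm γ) P = v γ := by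
    rw [hP, MvPolynomial.coeff_sum]
    simp [MvPolynomial.coeff_monomial, hγ]
  rw [← this, hP0, MvPolynomial.coeff_zero]

/-- The Gram matrix of the tile monomials, which are real valued, so that no complex conjugate is
needed. -/
noncomputable def gram (T : Set (E n)) (k : ℕ) :
    Matrix (multiIdx n k) (multiIdx n k) ℂ :=
  fun α β => ∫ x, tileMonomial T α x * tileMonomial T β x

/-- A vector `v` in the kernel of the Gram matrix satisfies `∫ |∑ v_γ p_γ|² = 0`, so that the
polynomial `∑ v_γ x^γ` vanishes on the interior of the tile. -/
theorem gram_mulVec_injective {T : Set (E n)} (hT : IsCompact T) (hne : (interior T).Nonempty)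
    (k : ℕ) : Function.Injective (gram T k).mulVecLin := by
  rw [injective_iff_map_eq_zero]
  intro v hv
  set F : E n → ℂ := fun x => ∑ γ, v γ * tileMonomial T γ x with hF
  have hreal : ∀ (α : Fin n → ℕ) (x : E n),
      (starRingEnd ℂ) (tileMonomial T α x) = tileMonomial T α x := by
    intro α x
    by_cases hx : x ∈ interior T
    · simp [tileMonomial_of_mem hx, mono]
    · simp [tileMonomial_of_notMem hx]
  have hexp : ∀ x, (starRingEnd ℂ) (F x) * F x = ∑ α, ∑ γ,
      (starRingEnd ℂ) (v α) * v γ * (tileMonomial T α x * tileMonomial T γ x) := by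
    intro x
    simp only [hF, map_sum, map_mul, hreal, Finset.sum_mul_sum]
    exact Finset.sum_congr rfl fun α _ => Finset.sum_congr rfl fun γ _ => by ring
  have hint : Integrable fun x => (starRingEnd ℂ) (F x) * F x := by
    simp_rw [hexp]
    exact integrable_finsetSum _ fun α _ => integrable_finsetSum _ fun γ _ =>
      (integrable_tileMonomial_mul hT _ _).const_mul _
  have h0 : ∫ x, (starRingEnd ℂ) (F x) * F x = 0 := by
    simp_rw [hexp]
    rw [integral_finsetSum _ fun α _ => integrable_finsetSum _ fun γ _ =>
      (integrable_tileMonomial_mul hT _ _).const_mul _]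
    refine Finset.sum_eq_zero fun α _ => ?_
    rw [integral_finsetSum _ fun γ _ => (integrable_tileMonomial_mul hT _ _).const_mul _]
    have := congrFun hv α
    rw [Matrix.mulVecLin_apply, Matrix.mulVec, dotProduct, Pi.zero_apply] at this
    rw [← mul_zero ((starRingEnd ℂ) (v α)), ← this, Finset.mul_sum]
    refine Finset.sum_congr rfl fun γ _ => ?_
    rw [integral_const_mul]
    simp only [gram]
    ring
  have hnorm : ∀ x, (starRingEnd ℂ) (F x) * F x = ((‖F x‖ ^ 2 : ℝ) : ℂ) := fun x => by
    rw [mul_comm, Complex.mul_conj, Complex.normSq_eq_norm_sq]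
  have hint' : Integrable fun x => ‖F x‖ ^ 2 := by
    have := hint.norm
    refine this.congr (Eventually.of_forall fun x => ?_)
    simp [pow_two]
  have h0' : ∫ x, ‖F x‖ ^ 2 = 0 := by
    simp_rw [hnorm] at h0
    rw [integral_complex_ofReal] at h0
    exact_mod_cast h0
  have hae := (integral_eq_zero_iff_of_nonneg (fun x => by positivity) hint').1 h0'
  have hvan : ∀ x ∈ interior T, ∑ γ, v γ * mono γ x = 0 := by
    set g : E n → ℂ := fun x => ∑ γ, v γ * mono γ x with hg
    have hgc : Continuous g := by
      refine continuous_finsetSum _ fun γ _ => continuous_const.mul (continuous_mono _)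
    by_contra! hx
    obtain ⟨x, hx, hgx⟩ := hx
    have hopen : IsOpen (interior T ∩ {x | g x ≠ 0}) :=
      isOpen_interior.inter (isOpen_ne_fun hgc continuous_const)
    have hnull : volume (interior T ∩ {x | g x ≠ 0}) = 0 := by
      refine measure_mono_null ?_ (ae_iff.1 hae)
      rintro y ⟨hy1, hy2⟩ h
      apply hy2
      have hFy : F y = 0 := by simpa using h
      rw [← hFy]
      simp only [hF, hg, tileMonomial_of_mem hy1]
    rw [hopen.measure_eq_zero_iff volume] at hnull
    have : x ∈ interior T ∩ {x | g x ≠ 0} := ⟨hx, hgx⟩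
    rw [hnull] at this
    exact this
  classical
  set w : (Fin n → ℕ) → ℂ := fun γ => if h : γ ∈ multiIdx n k then v ⟨γ, h⟩ else 0 with hw
  have hw0 := coeff_eq_zero_of_forall_sum_mono_eq_zero isOpen_interior hne (S := multiIdx n k) (v := w)
    fun x hx => by
      rw [← Finset.sum_coe_sort, ← hvan x hx]
      refine Finset.sum_congr rfl fun γ _ => ?_
      simp [hw]
  funext γ
  have := hw0 γ γ.2
  simpa [hw] using this

/-- The dual functions are combinations of the tile monomials, with coefficients given by the
inverse of the Gram matrix. -/
theorem exists_isDualFamily {M : Matrix (Fin n) (Fin n) ℤ} {T : Set (E n)}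
    (hT : IsSelfAffineTile M T) (hne : (interior T).Nonempty) (k : ℕ) :
    ∃ pd : (Fin n → ℕ) → E n → ℂ, IsDualFamily T k pd := by
  classical
  have hsurj : Function.Surjective (gram T k).mulVecLin :=
    LinearMap.injective_iff_surjective.1 (gram_mulVec_injective hT.isCompact hne k)
  have hex : ∀ β : multiIdx n k, ∃ v : multiIdx n k → ℂ,
      (gram T k).mulVecLin v = Pi.single β 1 := fun β => hsurj _
  choose v hv using hex
  set q : multiIdx n k → E n → ℂ := fun β x => ∑ γ, v β γ * tileMonomial T γ x with hq
  have hqm : ∀ β, Measurable (q β) := fun β =>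
    Finset.measurable_sum _ fun γ _ => (measurable_tileMonomial T γ).const_mul _
  have hqsupp : ∀ β x, x ∉ interior T → q β x = 0 := fun β x hx =>
    Finset.sum_eq_zero fun γ _ => by rw [tileMonomial_of_notMem hx, mul_zero]
  have hqbd : ∀ β, ∃ B : ℝ, 0 ≤ B ∧ ∀ x, ‖q β x‖ ≤ B := by
    intro β
    choose B hB0 hB using fun γ : multiIdx n k => exists_tileMonomial_le hT.isCompact (γ : Fin n → ℕ)
    refine ⟨∑ γ, ‖v β γ‖ * B γ, Finset.sum_nonneg fun γ _ => mul_nonneg (norm_nonneg _) (hB0 γ),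
      fun x => (norm_sum_le _ _).trans (Finset.sum_le_sum fun γ _ => ?_)⟩
    rw [norm_mul]
    gcongr
    exact hB γ x
  refine ⟨fun β x => if h : β ∈ multiIdx n k then (starRingEnd ℂ) (q ⟨β, h⟩ x) else 0, ?_, ?_⟩
  · intro β hβ
    simp only [hβ, dite_true]
    refine ⟨(Complex.continuous_conj.measurable.comp (hqm _)).aestronglyMeasurable, ?_⟩
    obtain ⟨B, hB0, hB⟩ := hqbd ⟨β, hβ⟩
    have hle : ∀ x, ∑' ν : Fin n → ℤ, ‖(starRingEnd ℂ) (q ⟨β, hβ⟩ (x - latVec ν))‖ₑ ≤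
        ENNReal.ofReal B := by
      intro x
      by_cases hx : ∃ ν : Fin n → ℤ, x - latVec ν ∈ interior T
      · obtain ⟨ν, hν⟩ := hx
        rw [tsum_eq_single ν]
        · rw [← ofReal_norm]
          refine ENNReal.ofReal_le_ofReal ?_
          simpa using hB _
        · intro κ hκ
          rw [hqsupp _ _ fun h => hκ (hT.interior_disjoint h hν)]
          simp
      · push Not at hx
        have : ∀ ν : Fin n → ℤ, ‖(starRingEnd ℂ) (q ⟨β, hβ⟩ (x - latVec ν))‖ₑ = 0 := fun ν => by
          rw [hqsupp _ _ (hx ν)]; simp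
        rw [tsum_congr this, tsum_zero]
        exact zero_le
    exact (eLpNorm_top_le_of_ae (Eventually.of_forall hle)).trans_lt ENNReal.ofReal_lt_top
  · intro α hα β hβ μ ν
    simp only [hβ, dite_true, pairing, Complex.conj_conj]
    by_cases hμν : μ = ν
    · subst hμν
      rw [integral_sub_right_eq_self
        (fun x => tileMonomial T α x * q ⟨β, hβ⟩ x) (latVec μ)]
      have h1 : ∀ x, tileMonomial T α x * q ⟨β, hβ⟩ x =
          ∑ γ, v ⟨β, hβ⟩ γ * (tileMonomial T α x * tileMonomial T γ x) := by
        intro x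
        simp only [hq, Finset.mul_sum]
        exact Finset.sum_congr rfl fun γ _ => by ring
      simp_rw [h1]
      rw [integral_finsetSum _ fun γ _ =>
        (integrable_tileMonomial_mul hT.isCompact _ _).const_mul _]
      have h2 := congrFun (hv ⟨β, hβ⟩) ⟨α, hα⟩
      rw [Matrix.mulVecLin_apply, Matrix.mulVec, dotProduct] at h2
      simp only [gram] at h2
      simp only [true_and]
      rw [Pi.single_apply] at h2
      simp only [Subtype.mk.injEq] at h2
      rw [← h2]
      refine Finset.sum_congr rfl fun γ _ => ?_
      rw [integral_const_mul, mul_comm]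
    · simp only [hμν, false_and, if_false]
      refine integral_eq_zero_of_ae (Eventually.of_forall fun x => ?_)
      beta_reduce
      by_cases hx : x - latVec μ ∈ interior T
      · rw [hqsupp _ _ fun h => hμν (hT.interior_disjoint hx h), mul_zero]; rfl
      · rw [tileMonomial_of_notMem hx, zero_mul]; rfl

/-- Functions of the class `𝓛^∞` are integrable on the whole space. -/
theorem MemCalLinfty.integrable {M : Matrix (Fin n) (Fin n) ℤ} {T : Set (E n)}
    (hT : IsSelfAffineTile M T) {φ : E n → ℂ} (h : MemCalLinfty T φ) : Integrable φ := by
  refine ⟨h.1, ?_⟩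
  have h1 : ∫⁻ x, ‖φ x‖ₑ ≤ ∑' ν : Fin n → ℤ, ∫⁻ x in shiftSet T (latVec ν), ‖φ x‖ₑ := by
    rw [← setLIntegral_univ, ← hT.cover]
    exact lintegral_iUnion_le _ _
  have h2 : ∀ ν : Fin n → ℤ, ∫⁻ x in shiftSet T (latVec (-ν)), ‖φ x‖ₑ =
      ∫⁻ x in T, ‖φ (x - latVec ν)‖ₑ := by
    intro ν
    have hmp : MeasurePreserving (fun x : E n => x - latVec ν) volume volume :=
      measurePreserving_sub_right volume _
    have he : MeasurableEmbedding fun x : E n => x - latVec ν :=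
      (Homeomorph.subRight (latVec ν : E n)).measurableEmbedding
    have h3 := hmp.setLIntegral_comp_emb he (fun x => ‖φ x‖ₑ) T
    rw [h3]
    congr 2
    have hneg : (latVec (-ν) : E n) = -latVec ν := by ext i; simp [latVec]
    rw [shiftSet, hneg]
    simp [sub_eq_add_neg]
  have h3 : ∑' ν : Fin n → ℤ, ∫⁻ x in shiftSet T (latVec ν), ‖φ x‖ₑ =
      ∫⁻ x in T, ∑' ν : Fin n → ℤ, ‖φ (x - latVec ν)‖ₑ := by
    rw [lintegral_tsum]
    · rw [← (Equiv.neg (Fin n → ℤ)).tsum_eq]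
      exact tsum_congr h2
    · intro ν
      exact ((h.1.comp_measurePreserving
        (measurePreserving_sub_right volume (latVec ν))).enorm).restrict
  have h4 : ∫⁻ x in T, ∑' ν : Fin n → ℤ, ‖φ (x - latVec ν)‖ₑ ≤
      ∫⁻ _ in T, eLpNorm (fun x => ∑' ν : Fin n → ℤ, ‖φ (x - latVec ν)‖ₑ) ∞
        (volume.restrict T) :=
    lintegral_mono_ae (ae_le_eLpNorm_top _)
  refine (h1.trans (h3.le.trans h4)).trans_lt ?_
  rw [lintegral_const, Measure.restrict_apply_univ]
  exact ENNReal.mul_lt_top h.2 hT.isCompact.measure_lt_top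

/-! ### Kernels whose derivatives are differences -/

/-- A chain of `C¹` functions of one variable with compact support, each of which is a sliding
integral over an interval of length `b` of the next one. Thus the derivative of each is a difference
of the next one. -/
theorem exists_spline_chain (N : ℕ) {b ρ : ℝ} (hb : 0 < b) (hρ : N * b < ρ) :
    ∃ β : ℕ → ℝ → ℝ, (∀ m, ContDiff ℝ 1 (β m)) ∧ (∀ m, HasCompactSupport (β m)) ∧
      (∀ m < N, ∀ t, HasDerivAt (β m) (β (m + 1) (t + b) - β (m + 1) t) t) ∧
      (∀ t, β 0 t ≠ 0 → |t| < ρ) ∧ (∀ t, 0 ≤ β 0 t) ∧ ∃ t, 0 < β 0 t := by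
  induction N generalizing ρ with
  | zero =>
    have hρ' : 0 < ρ := by simpa using hρ
    let φ : ContDiffBump (0 : ℝ) := ⟨ρ / 3, ρ / 2, by positivity, by linarith⟩
    refine ⟨fun _ => φ, fun _ => φ.contDiff, fun _ => φ.hasCompactSupport, by simp,
      fun t ht => ?_, fun t => φ.nonneg, 0, ?_⟩
    · have : t ∈ Function.support φ := ht
      rw [φ.support_eq, mem_ball_zero_iff, Real.norm_eq_abs] at this
      have h2 : φ.rOut = ρ / 2 := rfl
      linarith
    · exact φ.pos_of_mem_ball (Metric.mem_ball_self φ.rOut_pos)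
  | succ N ih =>
    obtain ⟨β, h1, h2, h3, h4, h5, t₀, h6⟩ := ih (ρ := ρ - b) (by push_cast at hρ; linarith)
    set f : ℝ → ℝ := fun t => ∫ x in t..(t + b), β 0 x with hf
    have hc : Continuous (β 0) := (h1 0).continuous
    have hfd : ∀ t, HasDerivAt f (β 0 (t + b) - β 0 t) t := by
      intro t
      have hi : ∀ a c : ℝ, IntervalIntegrable (β 0) volume a c := fun a c =>
        hc.intervalIntegrable a c
      have hG : ∀ s, HasDerivAt (fun s => ∫ x in (0 : ℝ)..s, β 0 x) (β 0 s) s := fun s =>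
        intervalIntegral.integral_hasDerivAt_right (hi _ _)
          (hc.stronglyMeasurableAtFilter _ _) hc.continuousAt
      have hfe : f = fun t => (∫ x in (0 : ℝ)..(t + b), β 0 x) - ∫ x in (0 : ℝ)..t, β 0 x := by
        funext t
        exact (intervalIntegral.integral_interval_sub_left (hi _ _) (hi _ _)).symm
      rw [hfe]
      exact ((hG (t + b)).comp_add_const t b).sub (hG t)
    have hfc1 : ContDiff ℝ 1 f := by
      rw [contDiff_one_iff_deriv]
      refine ⟨fun t => (hfd t).differentiableAt, ?_⟩
      have : deriv f = fun t => β 0 (t + b) - β 0 t := funext fun t => (hfd t).deriv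
      rw [this]
      fun_prop
    have hfsupp : ∀ t, f t ≠ 0 → |t| < ρ := by
      intro t ht
      by_contra hge
      refine ht ?_
      have hz : ∀ x ∈ Set.uIcc t (t + b), β 0 x = 0 := by
        intro x hx
        rw [Set.uIcc_of_le (by linarith)] at hx
        by_contra hne
        have := abs_lt.1 (h4 x hne)
        rw [not_lt, le_abs] at hge
        rcases hge with hge | hge
        · linarith [hx.1, this.2]
        · linarith [hx.2, this.1]
      simp only [hf]
      rw [intervalIntegral.integral_congr (g := fun _ => (0 : ℝ)) hz]
      simp
    refine ⟨fun m => Nat.casesOn m f β, ?_, ?_, ?_, hfsupp, ?_, t₀, ?_⟩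
    · rintro (_ | m)
      · exact hfc1
      · exact h1 m
    · rintro (_ | m)
      · refine HasCompactSupport.intro (isCompact_Icc (a := -ρ) (b := ρ)) fun t ht => ?_
        by_contra hne
        have := abs_lt.1 (hfsupp t hne)
        exact ht ⟨this.1.le, this.2.le⟩
      · exact h2 m
    · rintro (_ | m) hm t
      · exact hfd t
      · exact h3 m (by omega) t
    · intro t
      exact intervalIntegral.integral_nonneg (by linarith) fun x _ => h5 x
    · exact intervalIntegral.integral_pos (by linarith) hc.continuousOn (fun x _ => h5 x)
        ⟨t₀, ⟨le_rfl, by linarith⟩, h6⟩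

/-- The `i`-th standard basis vector. -/
noncomputable abbrev stdVec (i : Fin n) : E n := EuclideanSpace.single i 1

/-- `F` is differentiable with partial derivatives `F' i`. -/
def HasPartials (F : E n → ℂ) (F' : Fin n → E n → ℂ) : Prop :=
  ∀ x, ∃ D : E n →L[ℝ] ℂ, HasFDerivAt F D x ∧ ∀ i, D (stdVec i) = F' i x

theorem HasPartials.continuous {F : E n → ℂ} {F' : Fin n → E n → ℂ} (h : HasPartials F F') :
    Continuous F :=
  continuous_iff_continuousAt.2 fun x => by
    obtain ⟨D, hD, -⟩ := h x
    exact hD.continuousAt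

theorem HasPartials.fwdDiff {F : E n → ℂ} {F' : Fin n → E n → ℂ} (h : HasPartials F F') (v : E n) :
    HasPartials (fwdDiff v F) fun i => fwdDiff v (F' i) := by
  intro x
  obtain ⟨D, hD, hDi⟩ := h x
  obtain ⟨D', hD', hDi'⟩ := h (x + v)
  refine ⟨D' - D, ?_, fun i => ?_⟩
  · have h1 : HasFDerivAt (fun y => F (y + v)) D' x := by
      have h2 := HasFDerivAt.comp x hD' ((hasFDerivAt_id x).add_const v)
      rw [ContinuousLinearMap.comp_id] at h2
      exact h2
    exact h1.sub hD
  · simp [hDi, hDi', _root_.fwdDiff]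

/-- A family of kernels indexed by multi-indices: up to order `N`, the `i`-th partial derivative of
`ψ α` is the difference with step `b` in the `i`-th direction of the kernel of the next multi-index.
The kernel `ψ 0` has integral one and is supported in the ball of radius `ρ`. -/
structure KernelFamily (n N : ℕ) (b ρ : ℝ) where
  ψ : (Fin n → ℕ) → E n → ℝ
  contDiff : ∀ α, ContDiff ℝ 1 (ψ α)
  hasCompactSupport : ∀ α, HasCompactSupport (ψ α)
  fderiv_apply : ∀ α i, α i < N → ∀ x, fderiv ℝ (ψ α) x (stdVec i) =
    ψ (Function.update α i (α i + 1)) (x + b • stdVec i) - ψ (Function.update α i (α i + 1)) x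
  support_lt : ∀ x, ψ 0 x ≠ 0 → ‖x‖ < ρ
  integral_eq_one : ∫ x, ψ 0 x = 1

/-- The kernels are tensor products of the splines of `exists_spline_chain`, normalized by the integral
of `ψ 0`. -/
theorem exists_kernelFamily (n N : ℕ) {ρ : ℝ} (hρ : 0 < ρ) {b : ℝ} (hb : 0 < b)
    (hbρ : (n + 1) * (N * b) < ρ) : Nonempty (KernelFamily n N b ρ) := by
  obtain ⟨β, h1, h2, h3, h4, h5, t₀, h6⟩ := exists_spline_chain N hb (ρ := ρ / (n + 1))
    (by rw [lt_div_iff₀ (by positivity)]; linarith)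
  set φ : (Fin n → ℕ) → E n → ℝ := fun α x => ∏ i, β (α i) (x i) with hφ
  have hcd : ∀ α, ContDiff ℝ 1 (φ α) := fun α =>
    contDiff_prod fun i _ => (h1 (α i)).comp (contDiff_piLp_apply (p := 2))
  have hcs : ∀ α, HasCompactSupport (φ α) := by
    intro α
    have hex : ∀ i : Fin n, ∃ R : ℝ, ∀ t, β (α i) t ≠ 0 → |t| ≤ R := by
      intro i
      obtain ⟨R, hR⟩ := (h2 (α i)).isCompact.isBounded.exists_norm_le
      exact ⟨R, fun t ht => hR t (subset_tsupport _ ht)⟩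
    choose R hR using hex
    have hK : IsCompact ((WithLp.toLp 2 : (Fin n → ℝ) → E n) ''
        Set.pi Set.univ fun i => Set.Icc (-R i) (R i)) :=
      (isCompact_univ_pi fun i => isCompact_Icc).image (PiLp.continuous_toLp 2 _)
    refine HasCompactSupport.intro hK fun x hx => ?_
    by_contra hne
    refine hx ⟨x.ofLp, fun i _ => abs_le.1 (hR i _ ?_), rfl⟩
    exact Finset.prod_ne_zero_iff.1 hne i (Finset.mem_univ i)
  have hder : ∀ α i, α i < N → ∀ x, fderiv ℝ (φ α) x (stdVec i) =
      φ (Function.update α i (α i + 1)) (x + b • stdVec i) -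
        φ (Function.update α i (α i + 1)) x := by
    intro α i hi x
    have hd : DifferentiableAt ℝ (φ α) x := ((hcd α).differentiable one_ne_zero).differentiableAt
    rw [← hd.lineDeriv_eq_fderiv]
    refine HasLineDerivAt.lineDeriv ?_
    set c : ℝ := ∏ j ∈ Finset.univ.erase i, β (α j) (x j) with hc
    have hsplit : ∀ (α' : Fin n → ℕ) (t : ℝ), (∀ j, j ≠ i → α' j = α j) →
        φ α' (x + t • stdVec i) = β (α' i) (x i + t) * c := by
      intro α' t hα'
      simp only [hφ]
      rw [← Finset.mul_prod_erase _ _ (Finset.mem_univ i)]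
      congr 1
      · simp
      · refine Finset.prod_congr rfl fun j hj => ?_
        have hji := Finset.ne_of_mem_erase hj
        rw [hα' j hji]
        simp [hji]
    have hupd : ∀ j, j ≠ i → Function.update α i (α i + 1) j = α j := fun j hj => by simp [hj]
    have e1 := hsplit _ b hupd
    have e2 := hsplit _ 0 hupd
    rw [zero_smul, add_zero, add_zero] at e2
    rw [e1, e2, ← sub_mul, Function.update_self]
    have h7 : (fun t : ℝ => φ α (x + t • stdVec i)) = fun t => β (α i) (x i + t) * c :=
      funext fun t => hsplit α t fun _ _ => rfl
    rw [HasLineDerivAt, h7]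
    have h8 := h3 (α i) hi (x i + 0)
    rw [add_zero] at h8
    have h9 : HasDerivAt (fun t => β (α i) (x i + t)) _ 0 :=
      HasDerivAt.comp_const_add (x i) 0 (by rw [add_zero]; exact h8)
    exact h9.mul_const c
  have hnonneg : ∀ x, 0 ≤ φ 0 x := fun x => Finset.prod_nonneg fun i _ => h5 _
  have hI : 0 < ∫ x, φ 0 x := by
    refine (hcd 0).continuous.integral_pos_of_hasCompactSupport_nonneg_nonzero (hcs 0) hnonneg
      (x := WithLp.toLp 2 fun _ => t₀) ?_
    exact (Finset.prod_pos fun i _ => h6).ne'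
  set I : ℝ := ∫ x, φ 0 x with hIdef
  refine ⟨⟨fun α x => I⁻¹ * φ α x, fun α => contDiff_const.mul (hcd α), fun α => (hcs α).mul_left,
    fun α i hi x => ?_, fun x hx => ?_, ?_⟩⟩
  · have hd : DifferentiableAt ℝ (φ α) x := ((hcd α).differentiable one_ne_zero).differentiableAt
    rw [fderiv_const_mul hd]
    simp only [_root_.smul_apply, hder α i hi x, smul_eq_mul]
    ring
  · have hx' : φ 0 x ≠ 0 := right_ne_zero_of_mul hx
    have hi : ∀ i, |x i| < ρ / (n + 1) := fun i =>
      h4 _ (Finset.prod_ne_zero_iff.1 hx' i (Finset.mem_univ i))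
    calc ‖x‖ = ‖∑ i, x i • (stdVec i : E n)‖ := by
          congr 1
          have := (EuclideanSpace.basisFun (Fin n) ℝ).sum_repr x
          simpa using this.symm
      _ ≤ ∑ i, ‖x i • (stdVec i : E n)‖ := norm_sum_le _ _
      _ ≤ ∑ _i : Fin n, ρ / (n + 1) := by
          refine Finset.sum_le_sum fun i _ => ?_
          rw [norm_smul]
          simpa using (hi i).le
      _ = n * (ρ / (n + 1)) := by simp
      _ < ρ := by
          rw [mul_div_assoc', div_lt_iff₀ (by positivity)]
          linarith
  · rw [integral_const_mul]
    exact inv_mul_cancel₀ hI.ne'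

/-- The convolution of a function with a real kernel. -/
noncomputable def conv (ψ : E n → ℝ) (G : E n → ℂ) (x : E n) : ℂ := ∫ t, (ψ t : ℂ) * G (x - t)

theorem conv_eq (ψ : E n → ℝ) (G : E n → ℂ) :
    conv ψ G = convolution ψ G (ContinuousLinearMap.lsmul ℝ ℝ) volume := by
  funext x
  simp [conv, convolution]

theorem integrable_conv {ψ : E n → ℝ} (hψ : Continuous ψ) (hc : HasCompactSupport ψ) {G : E n → ℂ}
    (hG : LocallyIntegrable G volume) (x : E n) :
    Integrable fun t => (ψ t : ℂ) * G (x - t) := by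
  have := (hc.convolutionExists_left (ContinuousLinearMap.lsmul ℝ ℝ) hψ hG) x
  simpa [ConvolutionExistsAt] using this

theorem conv_fwdDiff {ψ : E n → ℝ} (hψ : Continuous ψ) (hc : HasCompactSupport ψ) {G : E n → ℂ}
    (hG : LocallyIntegrable G volume) (v : E n) :
    conv ψ (fwdDiff v G) = fwdDiff v (conv ψ G) := by
  funext x
  simp only [conv, fwdDiff]
  rw [← integral_sub (integrable_conv hψ hc hG _) (integrable_conv hψ hc hG _)]
  refine integral_congr_ae (Eventually.of_forall fun t => ?_)
  simp only
  rw [show x + v - t = x - t + v by abel]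
  ring

/-- The derivative can be put on the kernel, where it becomes a difference, and the difference can be
moved out of the convolution. -/
theorem KernelFamily.hasPartials_conv {N : ℕ} {b ρ : ℝ} (Ψ : KernelFamily n N b ρ) {G : E n → ℂ}
    (hG : LocallyIntegrable G volume) (α : Fin n → ℕ) (hα : ∀ i, α i < N) :
    HasPartials (conv (Ψ.ψ α) G) fun i =>
      fwdDiff (b • stdVec i) (conv (Ψ.ψ (Function.update α i (α i + 1))) G) := by
  intro x
  refine ⟨_, by
    rw [conv_eq]
    exact (Ψ.hasCompactSupport α).hasFDerivAt_convolution_left _ (Ψ.contDiff α) hG x, fun i => ?_⟩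
  have hex : ConvolutionExistsAt (fderiv ℝ (Ψ.ψ α)) G x
      ((ContinuousLinearMap.lsmul ℝ ℝ : ℝ →L[ℝ] ℂ →L[ℝ] ℂ).precompL (E n)) volume :=
    ((Ψ.hasCompactSupport α).fderiv (𝕜 := ℝ)).convolutionExists_left _
      ((Ψ.contDiff α).continuous_fderiv one_ne_zero) hG x
  rw [convolution, ContinuousLinearMap.integral_apply hex]
  set ψ' := Ψ.ψ (Function.update α i (α i + 1)) with hψ'
  have hψc : Continuous ψ' := (Ψ.contDiff _).continuous
  have hψs : HasCompactSupport ψ' := Ψ.hasCompactSupport _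
  have hi1 := integrable_conv hψc hψs hG x
  have hi2 := integrable_conv hψc hψs hG (x + b • stdVec i)
  simp only [fwdDiff, conv]
  have hshift : ∫ t, (ψ' t : ℂ) * G (x + b • stdVec i - t) =
      ∫ t, (ψ' (t + b • stdVec i) : ℂ) * G (x - t) := by
    rw [← integral_add_right_eq_self _ (b • stdVec i : E n)]
    refine integral_congr_ae (Eventually.of_forall fun t => ?_)
    simp only
    rw [show x + b • stdVec i - (t + b • stdVec i) = x - t by abel]
  have hi2' : Integrable fun t => (ψ' (t + b • stdVec i) : ℂ) * G (x - t) := by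
    have := hi2.comp_add_right (b • stdVec i : E n)
    refine this.congr (Eventually.of_forall fun t => ?_)
    simp only
    rw [show x + b • stdVec i - (t + b • stdVec i) = x - t by abel]
  rw [hshift, ← integral_sub hi2' hi1]
  refine integral_congr_ae (Eventually.of_forall fun t => ?_)
  simp only [ContinuousLinearMap.precompL_apply, ContinuousLinearMap.lsmul_apply]
  rw [Ψ.fderiv_apply α i (hα i), Complex.real_smul]
  push_cast
  ring

/-- Minkowski's inequality for averages with respect to a kernel of compact support. -/
theorem eLpNorm_integral_kernel_le {ψ : E n → ℝ} (hψ : Continuous ψ) (hc : HasCompactSupport ψ)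
    {F : E n → E n → ℂ} (hF : Measurable (Function.uncurry F)) {p c : ℝ≥0∞} (hp : 1 ≤ p)
    (h : ∀ t, ψ t ≠ 0 → eLpNorm (fun x => F x t) p volume ≤ c) :
    eLpNorm (fun x => ∫ t, (ψ t : ℂ) * F x t) p volume ≤ (∫⁻ t, ‖ψ t‖ₑ) * c := by
  set μ : Measure (E n) := volume.withDensity fun t => ‖ψ t‖ₑ with hμ
  have hμu : μ Set.univ = ∫⁻ t, ‖ψ t‖ₑ := by
    rw [hμ, withDensity_apply _ MeasurableSet.univ, Measure.restrict_univ]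
  have : IsFiniteMeasure μ :=
    ⟨by rw [hμu]; exact (hψ.integrable_of_hasCompactSupport hc).hasFiniteIntegral⟩
  have hmeas : Measurable (Function.uncurry fun (x t : E n) => ‖F x t‖ₑ) := hF.enorm
  rw [← hμu]
  refine le_trans (eLpNorm_mono_enorm fun x => ?_)
    (eLpNorm_lintegral_le (ν := volume) hmeas hp (c := c) ?_)
  · rw [enorm_eq_self, hμ, lintegral_withDensity_eq_lintegral_mul _ hψ.measurable.enorm
      (show Measurable fun t => ‖F x t‖ₑ from hmeas.comp measurable_prodMk_left)]
    refine (enorm_integral_le_lintegral_enorm _).trans (lintegral_mono fun t => ?_)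
    rw [enorm_mul]
    simp [← ofReal_norm]
  · rw [hμ, ae_withDensity_iff hψ.measurable.enorm]
    refine Eventually.of_forall fun t ht => ?_
    rw [eLpNorm_enorm (fun x => F x t)]
    exact h t (by simpa using ht)

/-- Convolution with an integrable kernel is bounded on `L^p`. -/
theorem eLpNorm_conv_le {ψ : E n → ℝ} (hψ : Continuous ψ) (hc : HasCompactSupport ψ) {G : E n → ℂ}
    (hG : Measurable G) {p : ℝ≥0∞} (hp : 1 ≤ p) :
    eLpNorm (conv ψ G) p volume ≤ (∫⁻ t, ‖ψ t‖ₑ) * eLpNorm G p volume :=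
  eLpNorm_integral_kernel_le hψ hc (F := fun x t => G (x - t))
    (hG.comp (measurable_fst.sub measurable_snd)) hp fun t _ =>
      (eLpNorm_comp_measurePreserving hG.aestronglyMeasurable
        (measurePreserving_sub_right volume t)).le

/-! ### Mixed differences -/

/-- The mixed difference `Δ_{u_{m-1}} ⋯ Δ_{u_0} G`. -/
def mixDiff (u : ℕ → E n) : ℕ → (E n → ℂ) → E n → ℂ
  | 0, G => G
  | m + 1, G => fwdDiff (u m) (mixDiff u m G)

theorem mixDiff_congr {u v : ℕ → E n} {m : ℕ} (h : ∀ j < m, u j = v j) (G : E n → ℂ) :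
    mixDiff u m G = mixDiff v m G := by
  induction m with
  | zero => rfl
  | succ m ih =>
    rw [mixDiff, mixDiff, h m (by omega), ih fun j hj => h j (by omega)]

theorem mixDiff_eq_sum (u : ℕ → E n) (m : ℕ) (G : E n → ℂ) (x : E n) :
    mixDiff u m G x = ∑ A ∈ (Finset.range m).powerset,
      (-1 : ℂ) ^ (m + A.card) * G (x + ∑ j ∈ A, u j) := by
  induction m generalizing x with
  | zero => simp [mixDiff]
  | succ m ih =>
    rw [mixDiff, fwdDiff, ih, ih, Finset.range_add_one, Finset.sum_powerset_insert (by simp),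
      sub_eq_add_neg, add_comm, ← Finset.sum_neg_distrib]
    congr 1
    · refine Finset.sum_congr rfl fun A _ => ?_
      rw [add_right_comm, pow_succ]
      ring
    · refine Finset.sum_congr rfl fun A hA => ?_
      have hm : m ∉ A := fun h => by simpa using Finset.mem_powerset.1 hA h
      rw [Finset.card_insert_of_notMem hm, Finset.sum_insert hm, ← add_assoc x,
        show m + 1 + (A.card + 1) = m + A.card + 2 by ring, pow_add _ (m + A.card) 2]
      simp

/-- An alternating sum over subsets vanishes if some element `j` has no influence on the terms: the sets
`A` and `A ∪ {j}` cancel. -/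
theorem sum_powerset_alternating {S : Finset ℕ} {j : ℕ} (hj : j ∈ S) {h : Finset ℕ → ℂ}
    (hh : ∀ A, j ∉ A → h (insert j A) = h A) :
    ∑ A ∈ S.powerset, (-1 : ℂ) ^ A.card * h A = 0 := by
  rw [← Finset.insert_erase hj, Finset.sum_powerset_insert (Finset.notMem_erase _ _),
    ← Finset.sum_add_distrib]
  refine Finset.sum_eq_zero fun A hA => ?_
  have hm : j ∉ A := fun h => by simpa using Finset.mem_powerset.1 hA h
  rw [Finset.card_insert_of_notMem hm, hh A hm, pow_succ]
  ring

/-- Kemperman's identity: a mixed difference of order `N` is a combination of pure differences of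
order `N`. After expanding the pure differences, all terms but the one of index `0` cancel in pairs:
in the term of index `r` the vector `u_{r-1}` does not occur. -/
theorem mixDiff_eq_sum_fwdDiff (u : ℕ → E n) (N : ℕ) (G : E n → ℂ) (x : E n) :
    mixDiff u N G x = ∑ A ∈ (Finset.range N).powerset, (-1 : ℂ) ^ A.card *
      (fwdDiff (-∑ j ∈ A, ((j : ℝ) + 1)⁻¹ • u j))^[N] G (x + ∑ j ∈ A, u j) := by
  have h1 : ∀ A : Finset ℕ,
      (fwdDiff (-∑ j ∈ A, ((j : ℝ) + 1)⁻¹ • u j))^[N] G (x + ∑ j ∈ A, u j) =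
      ∑ i ∈ Finset.range (N + 1), (((-1 : ℤ) ^ (N - i) * N.choose i : ℤ) : ℂ) *
        G (x + ∑ j ∈ A, (1 - (i : ℝ) * ((j : ℝ) + 1)⁻¹) • u j) := by
    intro A
    rw [fwdDiff_iter_eq_sum_shift]
    refine Finset.sum_congr rfl fun i _ => ?_
    rw [zsmul_eq_mul]
    congr 2
    rw [add_assoc]
    congr 1
    simp only [sub_smul, one_smul, Finset.sum_sub_distrib, mul_smul, ← Finset.smul_sum]
    rw [smul_neg, ← sub_eq_add_neg, Nat.cast_smul_eq_nsmul]
  simp_rw [h1, Finset.mul_sum]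
  rw [Finset.sum_comm, Finset.sum_range_succ', Finset.sum_eq_zero, zero_add, mixDiff_eq_sum]
  · refine Finset.sum_congr rfl fun A _ => ?_
    simp [pow_add]
    ring
  · intro i hi
    have hi' : i ∈ Finset.range N := hi
    have h2 := sum_powerset_alternating hi' (h := fun A =>
      G (x + ∑ j ∈ A, (1 - ((i + 1 : ℕ) : ℝ) * ((j : ℝ) + 1)⁻¹) • u j)) fun A hA => by
        rw [Finset.sum_insert hA]
        have h0 : (1 - ((i + 1 : ℕ) : ℝ) * ((i : ℝ) + 1)⁻¹) = 0 := by
          push_cast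
          rw [mul_inv_cancel₀ (by positivity), sub_self]
        rw [h0, zero_smul, zero_add]
    rw [← mul_zero (((-1 : ℤ) ^ (N - (i + 1)) * N.choose (i + 1) : ℤ) : ℂ), ← h2, Finset.mul_sum]
    exact Finset.sum_congr rfl fun A _ => by ring

/-- By Kemperman's identity, `L^p` bounds for pure differences give bounds for mixed differences. -/
theorem eLpNorm_mixDiff_le {G : E n → ℂ} (hG : Measurable G) {u : ℕ → E n} {N : ℕ} {δ : ℝ}
    (hu : ∀ j < N, ‖u j‖ ≤ δ) {p c : ℝ≥0∞} (hp : 1 ≤ p)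
    (hc : ∀ w : E n, ‖w‖ ≤ N * δ → eLpNorm ((fwdDiff w)^[N] G) p volume ≤ c) :
    eLpNorm (mixDiff u N G) p volume ≤ 2 ^ N * c := by
  have h1 : mixDiff u N G = ∑ A ∈ (Finset.range N).powerset, (-1 : ℂ) ^ A.card •
      fun x => (fwdDiff (-∑ j ∈ A, ((j : ℝ) + 1)⁻¹ • u j))^[N] G (x + ∑ j ∈ A, u j) := by
    funext x
    rw [mixDiff_eq_sum_fwdDiff, Finset.sum_apply]
    rfl
  rw [h1]
  have hm : ∀ w v : E n, Measurable fun x => (fwdDiff w)^[N] G (x + v) := fun w v =>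
    (measurable_fwdDiff_iter hG w N).comp (measurable_id.add_const v)
  refine (eLpNorm_sum_le (fun A _ => (hm _ _).aestronglyMeasurable.const_smul _) hp).trans ?_
  refine (Finset.sum_le_sum (g := fun _ => c) fun A hA => ?_).trans ?_
  · rw [eLpNorm_const_smul]
    have hn : ‖((-1 : ℂ) ^ A.card)‖ₑ = 1 := by simp
    rw [hn, one_mul]
    set w := -∑ j ∈ A, ((j : ℝ) + 1)⁻¹ • u j with hw
    refine ((eLpNorm_comp_measurePreserving
      (measurable_fwdDiff_iter hG w N).aestronglyMeasurable
      (measurePreserving_add_right volume (∑ j ∈ A, u j))).le).trans (hc w ?_)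
    have hAN : ∀ j ∈ A, j < N := fun j hj => by simpa using Finset.mem_powerset.1 hA hj
    rw [hw, norm_neg]
    calc _ ≤ ∑ j ∈ A, ‖((j : ℝ) + 1)⁻¹ • u j‖ := norm_sum_le _ _
      _ ≤ ∑ j ∈ Finset.range N, δ := by
          refine (Finset.sum_le_sum (g := fun _ => δ) fun j hj => ?_).trans ?_
          · rw [norm_smul, Real.norm_eq_abs, abs_of_nonneg (by positivity)]
            have h2 : ((j : ℝ) + 1)⁻¹ ≤ 1 := inv_le_one_of_one_le₀ (by linarith [j.cast_nonneg (α := ℝ)])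
            calc _ ≤ 1 * ‖u j‖ := by gcongr
              _ ≤ δ := by rw [one_mul]; exact hu j (hAN j hj)
          · refine Finset.sum_le_sum_of_subset_of_nonneg (Finset.mem_powerset.1 hA)
              fun j hj _ => (norm_nonneg _).trans (hu j (Finset.mem_range.1 hj))
      _ = N * δ := by simp
  · simp

/-! ### Chains of partial derivatives and Taylor's formula -/

/-- The mixed difference with steps `b` in the directions of a list of coordinates. -/
noncomputable def listDiff (b : ℝ) : List (Fin n) → (E n → ℂ) → E n → ℂ
  | [], G => G
  | i :: L, G => fwdDiff (b • stdVec i) (listDiff b L G)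

theorem fwdDiff_comm (v w : E n) (G : E n → ℂ) :
    fwdDiff v (fwdDiff w G) = fwdDiff w (fwdDiff v G) := by
  funext x
  simp only [fwdDiff]
  rw [add_right_comm]
  ring

theorem listDiff_fwdDiff (b : ℝ) (L : List (Fin n)) (v : E n) (G : E n → ℂ) :
    listDiff b L (fwdDiff v G) = fwdDiff v (listDiff b L G) := by
  induction L with
  | nil => rfl
  | cons i L ih => rw [listDiff, listDiff, ih, fwdDiff_comm]

theorem exists_listDiff_eq_mixDiff {b : ℝ} (hb : 0 ≤ b) (L : List (Fin n)) (G : E n → ℂ) :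
    ∃ u : ℕ → E n, (∀ j < L.length, ‖u j‖ ≤ b) ∧ listDiff b L G = mixDiff u L.length G := by
  induction L with
  | nil => exact ⟨0, by simp, rfl⟩
  | cons i L ih =>
    obtain ⟨u, hu, hL⟩ := ih
    refine ⟨Function.update u L.length (b • stdVec i), fun j hj => ?_, ?_⟩
    · rcases eq_or_ne j L.length with rfl | hne
      · simp [norm_smul, abs_of_nonneg hb]
      · rw [Function.update_of_ne hne]
        exact hu j (by simp at hj; omega)
    · rw [listDiff, List.length_cons, mixDiff, hL, Function.update_self]
      congr 1
      exact mixDiff_congr (fun j hj => by rw [Function.update_of_ne hj.ne]) G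

theorem measurable_listDiff (b : ℝ) (L : List (Fin n)) {G : E n → ℂ} (hG : Measurable G) :
    Measurable (listDiff b L G) := by
  induction L with
  | nil => exact hG
  | cons i L ih => exact (ih.comp (measurable_id.add_const _)).sub ih

theorem continuous_listDiff (b : ℝ) (L : List (Fin n)) {G : E n → ℂ} (hG : Continuous G) :
    Continuous (listDiff b L G) := by
  induction L with
  | nil => exact hG
  | cons i L ih => exact (ih.comp (continuous_id.add continuous_const)).sub ih

theorem memLp_listDiff (b : ℝ) (L : List (Fin n)) {G : E n → ℂ} {p : ℝ≥0∞}
    (hG : MemLp G p volume) : MemLp (listDiff b L G) p volume := by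
  induction L with
  | nil => exact hG
  | cons i L ih =>
    exact (ih.comp_measurePreserving (measurePreserving_add_right volume _)).sub ih

theorem conv_listDiff {ψ : E n → ℝ} (hψ : Continuous ψ) (hc : HasCompactSupport ψ) {G : E n → ℂ}
    {p : ℝ≥0∞} (hp : 1 ≤ p) (hG : MemLp G p volume) (b : ℝ) (L : List (Fin n)) :
    conv ψ (listDiff b L G) = listDiff b L (conv ψ G) := by
  induction L with
  | nil => rfl
  | cons i L ih =>
    rw [listDiff, listDiff, conv_fwdDiff hψ hc
      ((memLp_listDiff b L hG).locallyIntegrable hp), ih]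

theorem HasPartials.listDiff {F : E n → ℂ} {F' : Fin n → E n → ℂ} (h : HasPartials F F') (b : ℝ)
    (L : List (Fin n)) :
    HasPartials (listDiff b L F) fun i => SelfAffine.listDiff b L (F' i) := by
  induction L with
  | nil => exact h
  | cons i L ih => exact ih.fwdDiff _

/-- The iterated partial derivatives of `ψ₀ ⋆ G`, indexed by lists of coordinates: each of them is
a mixed difference of the convolution of `G` with another kernel. -/
noncomputable def KernelFamily.chain {N : ℕ} {b ρ : ℝ} (Ψ : KernelFamily n N b ρ) (G : E n → ℂ)
    (L : List (Fin n)) : E n → ℂ :=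
  listDiff b L (conv (Ψ.ψ fun i => L.count i) G)

theorem KernelFamily.hasPartials_chain {N : ℕ} {b ρ : ℝ} (Ψ : KernelFamily n N b ρ) {G : E n → ℂ}
    (hG : LocallyIntegrable G volume) {L : List (Fin n)} (hL : L.length < N) :
    HasPartials (Ψ.chain G L) fun i => Ψ.chain G (i :: L) := by
  have h1 := (Ψ.hasPartials_conv hG (fun i => L.count i)
    fun i => List.count_le_length.trans_lt hL).listDiff b L
  have h2 : (fun i => Ψ.chain G (i :: L)) = fun i => listDiff b L (fwdDiff (b • stdVec i)
      (conv (Ψ.ψ (Function.update (fun i => L.count i) i (L.count i + 1))) G)) := by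
    funext i
    rw [listDiff_fwdDiff, KernelFamily.chain, listDiff]
    congr 4
    funext j
    rcases eq_or_ne j i with rfl | hne
    · simp
    · simp [hne, hne.symm]
  rw [h2]
  exact h1

theorem KernelFamily.continuous_chain {N : ℕ} {b ρ : ℝ} (Ψ : KernelFamily n N b ρ) {G : E n → ℂ}
    (hG : LocallyIntegrable G volume) (L : List (Fin n)) : Continuous (Ψ.chain G L) := by
  refine continuous_listDiff b L ?_
  rw [conv_eq]
  exact (Ψ.hasCompactSupport _).continuous_convolution_left _ (Ψ.contDiff _).continuous hG

/-- The homogeneous term of degree `i` of Taylor's formula (up to the factor `1 / i!`) at the point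
`x`, for the function `K L` whose iterated partial derivatives are the functions `K (a :: L)`,
`K (a' :: a :: L)`, and so on. -/
noncomputable def taylorTerm (K : List (Fin n) → E n → ℂ) : ℕ → List (Fin n) → E n → E n → ℂ
  | 0, L, x, _ => K L x
  | i + 1, L, x, z => ∑ a, ((z a : ℝ) : ℂ) * taylorTerm K i (a :: L) x z

theorem continuous_taylorTerm {K : List (Fin n) → E n → ℂ} (hK : ∀ L, Continuous (K L)) (i : ℕ)
    (L : List (Fin n)) : Continuous fun z : E n × E n => taylorTerm K i L z.1 z.2 := by
  induction i generalizing L with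
  | zero => exact (hK L).comp continuous_fst
  | succ i ih =>
    simp only [taylorTerm]
    refine continuous_finsetSum _ fun a _ => ?_
    have := ih (a :: L)
    fun_prop

theorem hasDerivAt_taylorTerm {K : List (Fin n) → E n → ℂ} {N : ℕ}
    (hK : ∀ L, L.length < N → HasPartials (K L) fun i => K (i :: L)) {i : ℕ} {L : List (Fin n)}
    (hL : i + L.length < N) (x z : E n) (t : ℝ) :
    HasDerivAt (fun t : ℝ => taylorTerm K i L (x + t • z) z)
      (taylorTerm K (i + 1) L (x + t • z) z) t := by
  induction i generalizing L with
  | zero =>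
    obtain ⟨D, hD, hDi⟩ := hK L (by omega) (x + t • z)
    have hline : HasDerivAt (fun t : ℝ => x + t • z) z t := by
      simpa using ((hasDerivAt_id t).smul_const z).const_add x
    have h1 := hD.comp_hasDerivAt t hline
    have h2 : D z = taylorTerm K 1 L (x + t • z) z := by
      have hz : z = ∑ a, z a • (stdVec a : E n) := by
        have := (EuclideanSpace.basisFun (Fin n) ℝ).sum_repr z
        simpa using this.symm
      conv_lhs => rw [hz, map_sum]
      simp only [taylorTerm, map_smul, hDi, Complex.real_smul]
    rw [← h2]
    exact h1
  | succ i ih =>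
    have h1 : HasDerivAt (fun t : ℝ => ∑ a, ((z a : ℝ) : ℂ) * taylorTerm K i (a :: L) (x + t • z) z)
        (∑ a, ((z a : ℝ) : ℂ) * taylorTerm K (i + 1) (a :: L) (x + t • z) z) t :=
      HasDerivAt.fun_sum fun a _ => (ih (L := a :: L) (by simp; omega)).const_mul _
    exact h1

/-- Taylor's formula for the function `K []`, with the remainder in integral form. -/
theorem taylor_integral_remainder {K : List (Fin n) → E n → ℂ} {k : ℕ}
    (hK : ∀ L, L.length < k + 1 → HasPartials (K L) fun i => K (i :: L))
    (hc : ∀ L, Continuous (K L)) (x z : E n) :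
    K [] (x + z) - ∑ i ∈ Finset.range (k + 1), ((i.factorial : ℂ))⁻¹ * taylorTerm K i [] x z =
      ∫ t in (0 : ℝ)..1, ((((1 - t) ^ k * (k.factorial : ℝ)⁻¹ : ℝ)) : ℂ) *
        taylorTerm K (k + 1) [] (x + t • z) z := by
  have hder : ∀ m ≤ k, ∀ t : ℝ, HasDerivAt (fun t : ℝ => ∑ i ∈ Finset.range (m + 1),
      ((((1 - t) ^ i * (i.factorial : ℝ)⁻¹ : ℝ)) : ℂ) * taylorTerm K i [] (x + t • z) z)
      (((((1 - t) ^ m * (m.factorial : ℝ)⁻¹ : ℝ)) : ℂ) *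
        taylorTerm K (m + 1) [] (x + t • z) z) t := by
    intro m
    induction m with
    | zero =>
      intro _ t
      simpa using hasDerivAt_taylorTerm hK (i := 0) (L := []) (by simp) x z t
    | succ m ih =>
      intro hm t
      have h1 := hasDerivAt_taylorTerm hK (i := m + 1) (L := []) (by simp; omega) x z t
      have h2 : HasDerivAt (fun t : ℝ => ((1 - t) ^ (m + 1) * ((m + 1).factorial : ℝ)⁻¹ : ℝ))
          (-((1 - t) ^ m * (m.factorial : ℝ)⁻¹)) t := by
        have h3 := ((((hasDerivAt_id t).const_sub 1).pow (m + 1)).mul_const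
          (((m + 1).factorial : ℝ)⁻¹))
        refine h3.congr_deriv ?_
        have h4 : (m.factorial : ℝ) ≠ 0 := by positivity
        rw [Nat.factorial_succ]
        push_cast
        simp only [id]
        field_simp
      have h5 := (ih (by omega) t).add (h2.ofReal_comp.mul h1)
      simp_rw [Finset.sum_range_succ _ (m + 1)]
      refine h5.congr_deriv ?_
      push_cast
      ring
  have hcont : Continuous fun t : ℝ => ((((1 - t) ^ k * (k.factorial : ℝ)⁻¹ : ℝ)) : ℂ) *
      taylorTerm K (k + 1) [] (x + t • z) z := by
    have h1 : Continuous fun t : ℝ => taylorTerm K (k + 1) [] (x + t • z) z :=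
      (continuous_taylorTerm hc (k + 1) []).comp
        (f := fun t : ℝ => ((x + t • z, z) : E n × E n)) (by fun_prop)
    fun_prop
  rw [intervalIntegral.integral_eq_sub_of_hasDerivAt (fun t _ => hder k le_rfl t)
    (hcont.intervalIntegrable _ _)]
  congr 1
  · rw [Finset.sum_eq_single 0]
    · simp [taylorTerm]
    · intro i _ hi
      simp [hi]
    · simp
  · refine Finset.sum_congr rfl fun i _ => ?_
    simp

theorem eLpNorm_taylorTerm_le {K : List (Fin n) → E n → ℂ} (hK : ∀ L, Continuous (K L)) {N : ℕ}
    {p c : ℝ≥0∞} (hp : 1 ≤ p) (hc : ∀ L : List (Fin n), L.length = N → eLpNorm (K L) p volume ≤ c)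
    (z : E n) (i : ℕ) (L : List (Fin n)) (hL : i + L.length = N) :
    eLpNorm (fun x => taylorTerm K i L x z) p volume ≤ (n * ENNReal.ofReal ‖z‖) ^ i * c := by
  induction i generalizing L with
  | zero => simpa [taylorTerm] using hc L (by omega)
  | succ i ih =>
    have h1 : (fun x => taylorTerm K (i + 1) L x z) =
        ∑ a, ((z a : ℝ) : ℂ) • fun x => taylorTerm K i (a :: L) x z := by
      funext x
      rw [Finset.sum_apply]
      rfl
    rw [h1]
    have hm : ∀ a, Continuous fun x => taylorTerm K i (a :: L) x z := fun a =>
      (continuous_taylorTerm hK i (a :: L)).comp (f := fun x => (x, z)) (by fun_prop)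
    refine (eLpNorm_sum_le (fun a _ => (hm a).aestronglyMeasurable.const_smul _) hp).trans ?_
    refine (Finset.sum_le_sum (g := fun _ => ENNReal.ofReal ‖z‖ *
      ((n * ENNReal.ofReal ‖z‖) ^ i * c)) fun a _ => ?_).trans ?_
    · rw [eLpNorm_const_smul]
      gcongr
      · rw [← ofReal_norm, Complex.norm_real]
        exact ENNReal.ofReal_le_ofReal (PiLp.norm_apply_le z a)
      · exact ih (a :: L) (by simp; omega)
    · rw [Finset.sum_const, Finset.card_univ, Fintype.card_fin, nsmul_eq_mul, pow_succ]
      exact le_of_eq (by ring)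

/-- The error of Taylor's formula in `L^p`, uniformly in the displacement `z`. -/
theorem eLpNorm_taylor_remainder_le {K : List (Fin n) → E n → ℂ} {k : ℕ}
    (hK : ∀ L, L.length < k + 1 → HasPartials (K L) fun i => K (i :: L))
    (hcont : ∀ L, Continuous (K L)) {p c : ℝ≥0∞} (hp : 1 ≤ p)
    (hc : ∀ L : List (Fin n), L.length = k + 1 → eLpNorm (K L) p volume ≤ c) (z : E n) :
    eLpNorm (fun x => K [] (x + z) -
      ∑ i ∈ Finset.range (k + 1), ((i.factorial : ℂ))⁻¹ * taylorTerm K i [] x z) p volume ≤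
      (n * ENNReal.ofReal ‖z‖) ^ (k + 1) * c := by
  simp_rw [taylor_integral_remainder hK hcont]
  have hjc : Continuous fun y : E n × ℝ => taylorTerm K (k + 1) [] (y.1 + y.2 • z) z :=
    (continuous_taylorTerm hcont (k + 1) []).comp
      (f := fun y : E n × ℝ => ((y.1 + y.2 • z, z) : E n × E n)) (by fun_prop)
  have hmeas : Measurable (Function.uncurry fun (x : E n) (t : ℝ) =>
      ‖taylorTerm K (k + 1) [] (x + t • z) z‖ₑ) := hjc.measurable.enorm
  have hμ : (volume.restrict (Set.Ioc (0 : ℝ) 1)) Set.univ = 1 := by simp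
  rw [← one_mul ((n * ENNReal.ofReal ‖z‖) ^ (k + 1) * c), ← hμ]
  refine le_trans (eLpNorm_mono_enorm fun x => ?_)
    (eLpNorm_lintegral_le (ν := volume) hmeas hp (Eventually.of_forall fun t => ?_))
  · rw [enorm_eq_self, intervalIntegral.integral_of_le zero_le_one]
    refine (enorm_integral_le_lintegral_enorm _).trans ?_
    refine setLIntegral_mono' measurableSet_Ioc fun t ht => ?_
    rw [enorm_mul]
    refine mul_le_of_le_one_left zero_le ?_
    rw [← ofReal_norm, Complex.norm_real, Real.norm_eq_abs, ENNReal.ofReal_le_one, abs_mul]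
    refine mul_le_one₀ ?_ (abs_nonneg _) ?_
    · rw [abs_pow]
      exact pow_le_one₀ (abs_nonneg _) (abs_le.2 ⟨by linarith [ht.2], by linarith [ht.1]⟩)
    · rw [abs_of_nonneg (by positivity)]
      exact inv_le_one_of_one_le₀ (by exact_mod_cast Nat.factorial_pos k)
  · rw [eLpNorm_enorm (fun x => taylorTerm K (k + 1) [] (x + t • z) z)]
    have hcz : Continuous fun x => taylorTerm K (k + 1) [] x z :=
      (continuous_taylorTerm hcont (k + 1) []).comp (f := fun x => (x, z)) (by fun_prop)
    refine (eLpNorm_comp_measurePreserving hcz.aestronglyMeasurable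
      (measurePreserving_add_right volume (t • z))).le.trans ?_
    exact eLpNorm_taylorTerm_le hcont hp hc z (k + 1) [] (by simp)

/-- For fixed `x`, the terms of Taylor's formula are polynomials in the displacement `z`. -/
theorem exists_taylorTerm_polynomial (K : List (Fin n) → E n → ℂ) (s : ℝ) (x : E n) (i : ℕ)
    (L : List (Fin n)) : ∃ P : MvPolynomial (Fin n) ℂ, P.totalDegree ≤ i ∧
      ∀ z : E n, MvPolynomial.eval (fun a => ((z a : ℝ) : ℂ)) P = taylorTerm K i L x (s • z) := by
  induction i generalizing L with
  | zero => exact ⟨MvPolynomial.C (K L x), by simp, by simp [taylorTerm]⟩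
  | succ i ih =>
    choose P hP hPe using ih
    refine ⟨∑ a, MvPolynomial.C (s : ℂ) * MvPolynomial.X a * P (a :: L), ?_, fun z => ?_⟩
    · refine MvPolynomial.totalDegree_finsetSum_le fun a _ => ?_
      refine (MvPolynomial.totalDegree_mul _ _).trans ?_
      have h1 : (MvPolynomial.C (s : ℂ) * MvPolynomial.X a :
          MvPolynomial (Fin n) ℂ).totalDegree ≤ 1 :=
        (MvPolynomial.totalDegree_mul _ _).trans (by simp)
      have h2 := hP (a :: L)
      omega
    · simp [taylorTerm, hPe]

theorem exists_eval_eq_sum_mono {k : ℕ} {P : MvPolynomial (Fin n) ℂ} (hP : P.totalDegree ≤ k) :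
    ∃ c : (Fin n → ℕ) → ℂ, ∀ z : E n,
      MvPolynomial.eval (fun a => ((z a : ℝ) : ℂ)) P = ∑ α ∈ multiIdx n k, c α * mono α z := by
  classical
  refine ⟨fun α => P.coeff (Finsupp.equivFunOnFinite.symm α), fun z => ?_⟩
  have hmap : ∑ α ∈ P.support.map Finsupp.equivFunOnFinite.toEmbedding,
      P.coeff (Finsupp.equivFunOnFinite.symm α) * mono α z =
      MvPolynomial.eval (fun a => ((z a : ℝ) : ℂ)) P := by
    rw [Finset.sum_map, MvPolynomial.eval_eq']
    exact Finset.sum_congr rfl fun d _ => by simp [mono]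
  rw [← hmap]
  refine Finset.sum_subset ?_ ?_
  · intro α hα
    obtain ⟨d, hd, rfl⟩ := Finset.mem_map.1 hα
    rw [mem_multiIdx]
    have := MvPolynomial.le_totalDegree hd
    rw [Finsupp.sum_fintype _ _ (by simp)] at this
    exact this.trans hP
  · intro α _ hα
    have : P.coeff (Finsupp.equivFunOnFinite.symm α) = 0 := by
      by_contra hne
      refine hα (Finset.mem_map.2 ⟨Finsupp.equivFunOnFinite.symm α, ?_, by simp⟩)
      exact MvPolynomial.mem_support_iff.2 hne
    rw [this, zero_mul]

/-! ### Local polynomial approximation -/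

/-- The modulus of smoothness of order `k + 1` in `L^p`, with increments `(k + 1) |u| < r / 2`. -/
noncomputable def modulus (k : ℕ) (r : ℝ) (p : ℝ≥0∞) (g : E n → ℂ) : ℝ≥0∞ :=
  ⨆ (u : E n) (_ : ((k : ℝ) + 1) * ‖u‖ < r / 2), eLpNorm ((fwdDiff u)^[k + 1] g) p volume

theorem le_modulus {k : ℕ} {r : ℝ} {p : ℝ≥0∞} (g : E n → ℂ) {u : E n}
    (hu : ((k : ℝ) + 1) * ‖u‖ < r / 2) :
    eLpNorm ((fwdDiff u)^[k + 1] g) p volume ≤ modulus k r p g :=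
  le_iSup₂ (f := fun (u : E n) (_ : ((k : ℝ) + 1) * ‖u‖ < r / 2) =>
    eLpNorm ((fwdDiff u)^[k + 1] g) p volume) u hu

/-- The homothety of ratio `c` as an automorphism of `ℝⁿ`. -/
noncomputable def homothety (n : ℕ) {c : ℝ} (hc : c ≠ 0) : E n ≃L[ℝ] E n :=
  (LinearEquiv.smulOfNeZero ℝ (E n) c hc).toContinuousLinearEquiv

theorem homothety_apply {c : ℝ} (hc : c ≠ 0) (x : E n) : homothety n hc x = c • x := rfl

theorem eLpNorm_comp_smul {c : ℝ} (hc : c ≠ 0) (F : E n → ℂ) (p : ℝ≥0∞) :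
    eLpNorm (fun x => F (c • x)) p volume =
      volFactor (homothety n hc) ^ (1 / p).toReal * eLpNorm F p volume := by
  have := eLpNorm_comp_affine (homothety n hc) 0 F p
  simpa [homothety_apply] using this

theorem volFactor_rpow_ne_top (A : E n ≃L[ℝ] E n) (p : ℝ≥0∞) :
    volFactor A ^ (1 / p).toReal ≠ ∞ :=
  ENNReal.rpow_ne_top_of_nonneg ENNReal.toReal_nonneg (volFactor_ne_top A)

theorem fwdDiff_iter_comp_smul (g : E n → ℂ) (c : ℝ) (w : E n) (N : ℕ) :
    (fwdDiff w)^[N] (fun x => g (c • x)) = fun x => (fwdDiff (c • w))^[N] g (c • x) := by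
  funext x
  rw [fwdDiff_iter_eq_sum_shift, fwdDiff_iter_eq_sum_shift]
  refine Finset.sum_congr rfl fun j _ => ?_
  rw [smul_add, smul_comm c j w]

/-- The derivatives of order `k + 1` of `ψ₀ ⋆ g(c ·)` are controlled by the modulus of smoothness
of `g`, if the step `b` of the kernels is small. -/
theorem eLpNorm_chain_le {k : ℕ} {b ρ r : ℝ} (hb : 0 < b) (Ψ : KernelFamily n (k + 1) b ρ) {c : ℝ}
    (hc0 : 0 < c) (hc : ((k : ℝ) + 1) * (c * (((k : ℝ) + 1) * b)) < r / 2) {p : ℝ≥0∞}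
    (hp : 1 ≤ p) {g : E n → ℂ} (hg : Measurable g) (hgp : MemLp (fun x => g (c • x)) p volume)
    {L : List (Fin n)} (hL : L.length = k + 1) :
    eLpNorm (Ψ.chain (fun x => g (c • x)) L) p volume ≤
      (∫⁻ t, ‖Ψ.ψ (fun i => L.count i) t‖ₑ) * (2 ^ (k + 1) *
        (volFactor (homothety n hc0.ne') ^ (1 / p).toReal * modulus k r p g)) := by
  have hψ := (Ψ.contDiff fun i => L.count i).continuous
  have hψc := Ψ.hasCompactSupport fun i => L.count i
  have hgm : Measurable fun x : E n => g (c • x) := hg.comp (measurable_const_smul c)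
  rw [KernelFamily.chain, ← conv_listDiff hψ hψc hp hgp]
  refine (eLpNorm_conv_le hψ hψc (measurable_listDiff b L hgm) hp).trans ?_
  gcongr
  obtain ⟨u, hu, hLu⟩ := exists_listDiff_eq_mixDiff hb.le L fun x : E n => g (c • x)
  rw [hLu, hL]
  rw [hL] at hu
  refine eLpNorm_mixDiff_le hgm hu hp fun w hw => ?_
  rw [fwdDiff_iter_comp_smul, eLpNorm_comp_smul hc0.ne']
  gcongr
  refine le_modulus g (lt_of_le_of_lt ?_ hc)
  rw [norm_smul, Real.norm_eq_abs, abs_of_pos hc0]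
  push_cast at hw
  gcongr

/-- The error of Taylor's formula for the dilated function `x ↦ K [] (s x)`, `0 < s ≤ 1`. -/
theorem eLpNorm_scaled_taylor_remainder_le {K : List (Fin n) → E n → ℂ} {k : ℕ}
    (hK : ∀ L, L.length < k + 1 → HasPartials (K L) fun i => K (i :: L))
    (hcont : ∀ L, Continuous (K L)) {p c : ℝ≥0∞} (hp : 1 ≤ p)
    (hc : ∀ L : List (Fin n), L.length = k + 1 → eLpNorm (K L) p volume ≤ c) {s : ℝ} (hs : 0 < s)
    (hs1 : s ≤ 1) {w : E n} {R : ℝ} (hw : ‖w‖ ≤ R) :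
    eLpNorm (fun x => K [] (s • x + s • w) - ∑ i ∈ Finset.range (k + 1),
      ((i.factorial : ℂ))⁻¹ * taylorTerm K i [] (s • x) (s • w)) p volume ≤
      volFactor (homothety n hs.ne') ^ (1 / p).toReal *
        ((n * ENNReal.ofReal R) ^ (k + 1) * c) := by
  have h1 := eLpNorm_taylor_remainder_le hK hcont hp hc (s • w)
  have h2 := eLpNorm_comp_smul hs.ne' (fun x => K [] (x + s • w) -
    ∑ i ∈ Finset.range (k + 1), ((i.factorial : ℂ))⁻¹ * taylorTerm K i [] x (s • w)) p
  have h3 : ‖s • w‖ ≤ R := by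
    rw [norm_smul, Real.norm_eq_abs, abs_of_pos hs]
    exact (mul_le_of_le_one_left (norm_nonneg _) hs1).trans hw
  refine h2.le.trans ?_
  gcongr
  exact h1.trans (by gcongr)

theorem measurable_fwdDiff_iter_neg {g : E n → ℂ} (hg : Measurable g) (N : ℕ) (w : E n) :
    Measurable fun y : E n × E n => (fwdDiff (-y.2))^[N] g (y.1 + w) := by
  have : (fun y : E n × E n => (fwdDiff (-y.2))^[N] g (y.1 + w)) = fun y => ∑ j ∈
      Finset.range (N + 1), (((-1 : ℤ) ^ (N - j) * N.choose j : ℤ) : ℂ) *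
        g (y.1 + w + j • (-y.2)) := by
    funext y
    rw [fwdDiff_iter_eq_sum_shift]
    exact Finset.sum_congr rfl fun j _ => zsmul_eq_mul _ _
  rw [this]
  refine Finset.measurable_sum _ fun j _ => measurable_const.mul (hg.comp ?_)
  fun_prop

theorem aestronglyMeasurable_average_fwdDiff {ψ : E n → ℝ} (hψ : Continuous ψ) {g : E n → ℂ}
    (hg : Measurable g) (N : ℕ) (w : E n) :
    AEStronglyMeasurable (fun x => ∫ t, (ψ t : ℂ) * (fwdDiff (-t))^[N] g (x + w)) volume := by
  have h1 : StronglyMeasurable (Function.uncurry fun (x t : E n) =>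
      (ψ t : ℂ) * (fwdDiff (-t))^[N] g (x + w)) := by
    refine Measurable.stronglyMeasurable (Measurable.mul ?_ (measurable_fwdDiff_iter_neg hg N w))
    exact Complex.measurable_ofReal.comp (hψ.measurable.comp measurable_snd)
  exact h1.integral_prod_right.aestronglyMeasurable

/-- The increments `-t` of the differences that occur in the average are those admitted in the modulus
of smoothness. -/
theorem eLpNorm_average_fwdDiff_le {ψ : E n → ℝ} (hψ : Continuous ψ) (hψs : HasCompactSupport ψ)
    {k : ℕ} {r : ℝ} (hsupp : ∀ t, ψ t ≠ 0 → ((k : ℝ) + 1) * ‖t‖ < r / 2) {g : E n → ℂ}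
    (hg : Measurable g) {p : ℝ≥0∞} (hp : 1 ≤ p) (w : E n) :
    eLpNorm (fun x => ∫ t, (ψ t : ℂ) * (fwdDiff (-t))^[k + 1] g (x + w)) p volume ≤
      (∫⁻ t, ‖ψ t‖ₑ) * modulus k r p g := by
  refine eLpNorm_integral_kernel_le hψ hψs (F := fun x t => (fwdDiff (-t))^[k + 1] g (x + w))
    (measurable_fwdDiff_iter_neg hg (k + 1) w) hp fun t ht => ?_
  refine (eLpNorm_comp_measurePreserving
    (measurable_fwdDiff_iter hg (-t) (k + 1)).aestronglyMeasurable
    (measurePreserving_add_right volume w)).le.trans (le_modulus g ?_)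
  rw [norm_neg]
  exact hsupp t ht

/-- The coefficient of `g(x + j u)` in the difference `Δ_u^N g(x)`. -/
def diffCoeff (N j : ℕ) : ℂ := (((-1 : ℤ) ^ (N - j) * N.choose j : ℤ) : ℂ)

theorem diffCoeff_zero_mul_self (N : ℕ) : diffCoeff N 0 * diffCoeff N 0 = 1 := by
  simp only [diffCoeff]
  push_cast
  simp [← mul_pow]

/-- A function is the sum of an average of its differences of order `N` and of a combination of
its convolutions with dilates of a kernel of integral one. -/
theorem eq_average_sub_sum_conv {ψ : E n → ℝ} (hψ : Continuous ψ) (hψs : HasCompactSupport ψ)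
    (hψ1 : ∫ t, ψ t = 1) {g : E n → ℂ} {N : ℕ}
    (hg : ∀ j : ℕ, LocallyIntegrable (fun y => g (((j : ℝ) + 1) • y)) volume) (x : E n) :
    g x = diffCoeff N 0 * (∫ t, (ψ t : ℂ) * (fwdDiff (-t))^[N] g x) -
      diffCoeff N 0 * ∑ j ∈ Finset.range N, diffCoeff N (j + 1) *
        conv ψ (fun y => g (((j : ℝ) + 1) • y)) (((j : ℝ) + 1)⁻¹ • x) := by
  have hj0 : ∀ j : ℕ, (j : ℝ) + 1 ≠ 0 := fun j => by positivity
  have h1 : ∀ t, (ψ t : ℂ) * (fwdDiff (-t))^[N] g x = (∑ j ∈ Finset.range N, diffCoeff N (j + 1) *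
      ((ψ t : ℂ) * g (((j : ℝ) + 1) • (((j : ℝ) + 1)⁻¹ • x - t)))) +
        diffCoeff N 0 * g x * (ψ t : ℂ) := by
    intro t
    rw [fwdDiff_iter_eq_sum_shift, Finset.sum_range_succ', mul_add, Finset.mul_sum]
    congr 1
    · refine Finset.sum_congr rfl fun j _ => ?_
      rw [zsmul_eq_mul, smul_sub, smul_inv_smul₀ (hj0 j), smul_neg, ← sub_eq_add_neg,
        ← Nat.cast_smul_eq_nsmul ℝ (j + 1) t, Nat.cast_add_one, diffCoeff]
      ring
    · rw [zsmul_eq_mul, zero_smul, add_zero, diffCoeff]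
      ring
  have hi : ∀ j : ℕ, Integrable fun t =>
      (ψ t : ℂ) * g (((j : ℝ) + 1) • (((j : ℝ) + 1)⁻¹ • x - t)) := fun j =>
    integrable_conv hψ hψs (hg j) _
  have hi0 : Integrable fun t => (ψ t : ℂ) := (hψ.integrable_of_hasCompactSupport hψs).ofReal
  have h2 : ∫ t, (ψ t : ℂ) = 1 := by rw [integral_complex_ofReal, hψ1, Complex.ofReal_one]
  simp_rw [h1]
  rw [integral_add (integrable_finsetSum _ fun j _ => (hi j).const_mul _) (hi0.const_mul _),
    integral_finsetSum _ fun j _ => (hi j).const_mul _, integral_const_mul, h2]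
  simp_rw [integral_const_mul]
  simp only [conv]
  linear_combination (-(g x)) * diffCoeff_zero_mul_self N

/-- Whitney's theorem in integrated form: a function with small differences of order `k + 1` is
close in `L^p`, uniformly in the displacement `|w| ≤ R`, to polynomials in `w` of degree at most `k`
that depend on the base point `x`. They are combinations of the Taylor polynomials of the functions
`ψ₀ ⋆ g(j ·)`, `1 ≤ j ≤ k + 1`. -/
theorem exists_polynomial_approx (n k : ℕ) {r : ℝ} (hr : 0 < r) (R : ℝ) {p : ℝ≥0∞} (hp : 1 ≤ p) :
    ∃ C : ℝ≥0∞, C ≠ ∞ ∧ ∀ g : E n → ℂ, Measurable g → eLpNorm g p volume ≠ ∞ →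
      ∃ τ : E n → E n → ℂ, Measurable (Function.uncurry τ) ∧
        (∀ x, ∃ c : (Fin n → ℕ) → ℂ, ∀ w, τ x w = ∑ α ∈ multiIdx n k, c α * mono α w) ∧
        ∀ w, ‖w‖ ≤ R → eLpNorm (fun x => g (x + w) - τ x w) p volume ≤ C * modulus k r p g := by
  set N := k + 1 with hN
  -- The radius `ρ` of the support of `ψ₀` makes the increments of the pure differences admissible,
  -- and the step `b` those of the pure differences of `g(j ·)`, `j ≤ N`, that make up a mixed one.
  set ρ : ℝ := r / (2 * N) with hρ
  have hρ0 : 0 < ρ := by positivity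
  set b : ℝ := ρ / (2 * (n + 1) * N ^ 2) with hbdef
  have hb : 0 < b := by positivity
  have hN1 : (1 : ℝ) ≤ N := by rw [hN]; push_cast; linarith [k.cast_nonneg (α := ℝ)]
  have hb1 : (n + 1) * (N * b) < ρ := by
    have : (n + 1) * (N * b) = ρ / (2 * N) := by rw [hbdef]; field_simp
    rw [this, div_lt_iff₀ (by positivity)]
    nlinarith
  have hb2 : ((k : ℝ) + 1) * (N * (((k : ℝ) + 1) * b)) < r / 2 := by
    have hNk : (k : ℝ) + 1 = N := by rw [hN]; push_cast; ring
    have h1 : (N : ℝ) * (N * (N * b)) = r / (4 * (n + 1)) := by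
      rw [hbdef, hρ]; field_simp; norm_num
    rw [hNk, h1, div_lt_div_iff₀ (by positivity) (by positivity)]
    nlinarith [n.cast_nonneg (α := ℝ)]
  obtain ⟨Ψ⟩ := exists_kernelFamily n N hρ0 hb hb1
  have hψc := (Ψ.contDiff 0).continuous
  have hψs := Ψ.hasCompactSupport 0
  set d : ℕ → ℂ := diffCoeff N with hd
  have hj0 : ∀ j : ℕ, (0 : ℝ) < (j : ℝ) + 1 := fun j => by positivity
  have hji : ∀ j : ℕ, 0 < ((j : ℝ) + 1)⁻¹ := fun j => inv_pos.2 (hj0 j)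
  -- A bound for the `L¹` norms of all kernels that occur in derivatives of order `N`.
  set I : ℝ≥0∞ := ∑ α ∈ multiIdx n N, ∫⁻ t, ‖Ψ.ψ α t‖ₑ with hI
  have hItop : I ≠ ∞ := ENNReal.sum_ne_top.2 fun α _ =>
    (((Ψ.contDiff α).continuous.integrable_of_hasCompactSupport
      (Ψ.hasCompactSupport α)).hasFiniteIntegral).ne
  set V : ℕ → ℝ≥0∞ := fun j => volFactor (homothety n (hj0 j).ne') ^ (1 / p).toReal with hV
  set V' : ℕ → ℝ≥0∞ := fun j => volFactor (homothety n (hji j).ne') ^ (1 / p).toReal with hV'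
  have hVtop : ∀ j, V j ≠ ∞ := fun j => volFactor_rpow_ne_top _ p
  have hV'top : ∀ j, V' j ≠ ∞ := fun j => volFactor_rpow_ne_top _ p
  set B : ℕ → ℝ≥0∞ := fun j => V' j * ((n * ENNReal.ofReal R) ^ N * (I * (2 ^ N * V j))) with hB
  have hBtop : ∀ j, B j ≠ ∞ := fun j => by
    simp only [hB]
    have := hVtop j
    have := hV'top j
    finiteness
  set J : ℝ≥0∞ := ∫⁻ t, ‖Ψ.ψ 0 t‖ₑ with hJ
  have hJtop : J ≠ ∞ := ((hψc.integrable_of_hasCompactSupport hψs).hasFiniteIntegral).ne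
  set C : ℝ≥0∞ := ‖d 0‖ₑ * (J + ∑ j ∈ Finset.range N, ‖d (j + 1)‖ₑ * B j) with hC
  refine ⟨C, ?_, fun g hg hgp => ?_⟩
  · have h1 : ∑ j ∈ Finset.range N, ‖d (j + 1)‖ₑ * B j ≠ ∞ :=
      ENNReal.sum_ne_top.2 fun j _ => ENNReal.mul_ne_top enorm_ne_top (hBtop j)
    exact ENNReal.mul_ne_top enorm_ne_top (ENNReal.add_ne_top.2 ⟨hJtop, h1⟩)
  set ω := modulus k r p g with hω
  have hgM : MemLp g p volume := ⟨hg.aestronglyMeasurable, hgp.lt_top⟩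
  set G : ℕ → E n → ℂ := fun j x => g (((j : ℝ) + 1) • x) with hG
  have hGm : ∀ j, Measurable (G j) := fun j => hg.comp (measurable_const_smul _)
  have hGM : ∀ j, MemLp (G j) p volume := fun j => by
    refine ⟨(hGm j).aestronglyMeasurable, ?_⟩
    simp only [hG]
    rw [eLpNorm_comp_smul (hj0 j).ne']
    exact ENNReal.mul_lt_top (volFactor_rpow_ne_top _ p).lt_top hgp.lt_top
  have hGl : ∀ j, LocallyIntegrable (G j) volume := fun j => (hGM j).locallyIntegrable hp
  set K : ℕ → List (Fin n) → E n → ℂ := fun j => Ψ.chain (G j) with hK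
  have hKp : ∀ j, ∀ L : List (Fin n), L.length < k + 1 →
      HasPartials (K j L) fun i => K j (i :: L) := fun j L hL => Ψ.hasPartials_chain (hGl j) hL
  have hKc : ∀ j L, Continuous (K j L) := fun j L => Ψ.continuous_chain (hGl j) L
  have hK0 : ∀ j x, K j [] x = conv (Ψ.ψ 0) (G j) x := fun j x => by
    simp only [hK, KernelFamily.chain, listDiff, List.count_nil]
    rfl
  set P : ℕ → E n → E n → ℂ := fun j x w => ∑ i ∈ Finset.range (k + 1),
    ((i.factorial : ℂ))⁻¹ * taylorTerm (K j) i [] (((j : ℝ) + 1)⁻¹ • x) (((j : ℝ) + 1)⁻¹ • w)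
    with hP
  have hPc : ∀ j, Continuous fun z : E n × E n => P j z.1 z.2 := fun j => by
    refine continuous_finsetSum _ fun i _ => continuous_const.mul ?_
    exact (continuous_taylorTerm (hKc j) i []).comp (f := fun z : E n × E n =>
      ((((j : ℝ) + 1)⁻¹ • z.1, ((j : ℝ) + 1)⁻¹ • z.2) : E n × E n)) (by fun_prop)
  set τ : E n → E n → ℂ := fun x w => -(d 0 * ∑ j ∈ Finset.range N, d (j + 1) * P j x w) with hτ
  refine ⟨τ, ?_, fun x => ?_, fun w hw => ?_⟩
  · have : Continuous (Function.uncurry τ) := by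
      refine (continuous_const.mul (continuous_finsetSum _ fun j _ => ?_)).neg
      exact continuous_const.mul (hPc j)
    exact this.measurable
  · choose Q hQ hQe using fun (j i : ℕ) => exists_taylorTerm_polynomial (K j) (((j : ℝ) + 1)⁻¹)
      (((j : ℝ) + 1)⁻¹ • x) i []
    set S : MvPolynomial (Fin n) ℂ := -(MvPolynomial.C (d 0) * ∑ j ∈ Finset.range N,
      MvPolynomial.C (d (j + 1)) * ∑ i ∈ Finset.range (k + 1),
        MvPolynomial.C ((i.factorial : ℂ))⁻¹ * Q j i) with hS
    have hCmul : ∀ (c : ℂ) (q : MvPolynomial (Fin n) ℂ), q.totalDegree ≤ k →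
        (MvPolynomial.C c * q).totalDegree ≤ k := fun c q hq =>
      (MvPolynomial.totalDegree_mul _ _).trans (by simpa using hq)
    have hSdeg : S.totalDegree ≤ k := by
      rw [hS, MvPolynomial.totalDegree_neg]
      refine hCmul _ _ (MvPolynomial.totalDegree_finsetSum_le fun j _ => hCmul _ _
        (MvPolynomial.totalDegree_finsetSum_le fun i hi => hCmul _ _ ((hQ j i).trans ?_)))
      have := Finset.mem_range.1 hi
      omega
    obtain ⟨c, hc⟩ := exists_eval_eq_sum_mono hSdeg
    refine ⟨c, fun w => ?_⟩
    rw [← hc w, hS]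
    simp [hτ, hP, hQe]
  have hsmooth : ∀ x, g x = d 0 * (∫ t, (Ψ.ψ 0 t : ℂ) * (fwdDiff (-t))^[N] g x) -
      d 0 * ∑ j ∈ Finset.range N, d (j + 1) * K j [] (((j : ℝ) + 1)⁻¹ • x) := by
    intro x
    simp_rw [hK0]
    exact eq_average_sub_sum_conv hψc hψs Ψ.integral_eq_one hGl x
  have hsplit : (fun x => g (x + w) - τ x w) = d 0 • ((fun x => ∫ t, (Ψ.ψ 0 t : ℂ) *
      (fwdDiff (-t))^[N] g (x + w)) - ∑ j ∈ Finset.range N, d (j + 1) • fun x =>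
        (K j [] (((j : ℝ) + 1)⁻¹ • x + ((j : ℝ) + 1)⁻¹ • w) - P j x w)) := by
    funext x
    rw [hsmooth (x + w)]
    simp only [hτ, Pi.smul_apply, Pi.sub_apply, Finset.sum_apply, smul_eq_mul, smul_add, mul_sub,
      Finset.sum_sub_distrib]
    ring
  have hΦm := aestronglyMeasurable_average_fwdDiff hψc hg N w
  have hΦle := eLpNorm_average_fwdDiff_le (k := k) (r := r) hψc hψs (fun t ht => ?_) hg hp w
  swap
  · have hNk : (k : ℝ) + 1 = N := by rw [hN]; push_cast; ring
    calc ((k : ℝ) + 1) * ‖t‖ < ((k : ℝ) + 1) * ρ := by gcongr; exact Ψ.support_lt t ht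
      _ = r / 2 := by rw [hNk, hρ]; field_simp
  set Θ : ℕ → E n → ℂ := fun j x =>
    K j [] (((j : ℝ) + 1)⁻¹ • x + ((j : ℝ) + 1)⁻¹ • w) - P j x w with hΘ
  have hΘm : ∀ j, AEStronglyMeasurable (Θ j) volume := fun j => by
    have h1 : Continuous fun x => K j [] (((j : ℝ) + 1)⁻¹ • x + ((j : ℝ) + 1)⁻¹ • w) :=
      (hKc j []).comp (by fun_prop)
    have h2 : Continuous fun x => P j x w := (hPc j).comp (f := fun x => (x, w)) (by fun_prop)
    exact (h1.sub h2).aestronglyMeasurable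
  have hΘle : ∀ j ∈ Finset.range N, eLpNorm (Θ j) p volume ≤ B j * ω := by
    intro j hj
    have hjN : (j : ℝ) + 1 ≤ N := by exact_mod_cast Finset.mem_range.1 hj
    have hchain : ∀ L : List (Fin n), L.length = k + 1 →
        eLpNorm (K j L) p volume ≤ I * (2 ^ N * (V j * ω)) := by
      intro L hL
      refine (eLpNorm_chain_le (r := r) hb Ψ (hj0 j) ?_ hp hg (hGM j) hL).trans ?_
      · refine lt_of_le_of_lt ?_ hb2
        gcongr
      · gcongr
        refine Finset.single_le_sum (f := fun α => ∫⁻ t, ‖Ψ.ψ α t‖ₑ) (fun _ _ => zero_le) ?_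
        rw [mem_multiIdx]
        have h5 := Multiset.sum_count_eq_card (s := Finset.univ) (m := (L : Multiset (Fin n)))
          fun a _ => Finset.mem_univ a
        simp only [Multiset.coe_count, Multiset.coe_card] at h5
        rw [h5, hL]
    refine (eLpNorm_scaled_taylor_remainder_le (hKp j) (hKc j) hp hchain (hji j)
      (inv_le_one_of_one_le₀ (by linarith [j.cast_nonneg (α := ℝ)])) hw).trans (le_of_eq ?_)
    simp only [hB, hV']
    ring
  rw [hsplit, eLpNorm_const_smul, hC, mul_assoc]
  gcongr
  refine (eLpNorm_sub_le hΦm (Finset.aestronglyMeasurable_sum _ fun j _ =>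
    (hΘm j).const_smul _) hp).trans ?_
  rw [add_mul, Finset.sum_mul]
  gcongr
  refine (eLpNorm_sum_le (fun j _ => (hΘm j).const_smul _) hp).trans
    (Finset.sum_le_sum fun j hj => ?_)
  rw [eLpNorm_const_smul, mul_assoc]
  gcongr
  exact hΘle j hj

/-! ### The error of quasi-interpolation on the unit scale -/

/-- The error of quasi-interpolation on the cell `T + x` of scale zero, in the coordinate
`w = y - x ∈ T`. -/
noncomputable def unitOmega (T : Set (E n)) (k : ℕ) (pd : (Fin n → ℕ) → E n → ℂ) (p : ℝ≥0∞)
    (g : E n → ℂ) (x : E n) : ℝ≥0∞ :=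
  avgNorm p T fun w => g (x + w) - ∑ α ∈ multiIdx n k,
    (∫ y, g (x + y) * (starRingEnd ℂ) (pd α y)) * tileMonomial T α w

theorem avgNorm_comp_affine (A : E n ≃L[ℝ] E n) (v : E n) {T : Set (E n)} (hT : MeasurableSet T)
    (p : ℝ≥0∞) (F : E n → ℂ) :
    avgNorm p ((fun y => A y + v) ⁻¹' T) (fun y => F (A y + v)) = avgNorm p T F := by
  set e : E n → E n := fun y => A y + v with he
  have hemb : MeasurableEmbedding e := measurableEmbedding_affine A v
  have h1 := hemb.eLpNorm_map_measure (g := F) (p := p)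
    (μ := (volume (e ⁻¹' T))⁻¹ • volume.restrict (e ⁻¹' T))
  rw [Measure.map_smul, ← Measure.restrict_map hemb.measurable hT, map_affine_volume,
    Measure.restrict_smul, smul_smul, volume_preimage_affine,
    ENNReal.mul_inv (Or.inl (volFactor_ne_zero A)) (Or.inl (volFactor_ne_top A)), mul_right_comm,
    ENNReal.inv_mul_cancel (volFactor_ne_zero A) (volFactor_ne_top A), one_mul] at h1
  rw [avgNorm, avgNorm, h1, volume_preimage_affine,
    ENNReal.mul_inv (Or.inl (volFactor_ne_zero A)) (Or.inl (volFactor_ne_top A))]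
  rfl

/-- The normalizing factors `m^{l/2}` of the dual functions and of the tile monomials together make up
for the change of volume under `M^l`. -/
theorem abs_det_pow_mul_volFactor {M : Matrix (Fin n) (Fin n) ℤ} (hM : IsDilation M) (l : ℕ) :
    (|(M.det : ℝ)| ^ ((l : ℝ) / 2)) * (|(M.det : ℝ)| ^ ((l : ℝ) / 2)) *
      (volFactor (dilEquiv M hM l)).toReal = 1 := by
  have h0 : 0 < |(M.det : ℝ)| := abs_pos.2 (det_ne_zero hM)
  have hdet : LinearMap.det ((dilEquiv M hM l : E n ≃L[ℝ] E n) : E n →ₗ[ℝ] E n) =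
      (M.det : ℝ) ^ l := det_dilMap_pow M l
  rw [volFactor, hdet, ENNReal.toReal_ofReal (abs_nonneg _), ← Real.rpow_add h0, add_halves,
    Real.rpow_natCast, abs_inv, abs_pow]
  exact mul_inv_cancel₀ (pow_ne_zero _ h0.ne')

/-- On the scale `l`, the error of quasi-interpolation of `f` is that of `f ∘ M^{-l}` on the unit
scale. -/
theorem Omega_eq_unitOmega {M : Matrix (Fin n) (Fin n) ℤ} (hM : IsDilation M) {T : Set (E n)}
    (hT : IsCompact T) (a : E n) (k : ℕ) (pd : (Fin n → ℕ) → E n → ℂ) (p : ℝ≥0∞) (f : E n → ℂ)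
    (l : ℕ) (x : E n) :
    Omega M T a k pd p f l x = unitOmega T k pd p (fun y => f ((dilEquiv M hM l).symm y))
      (dilEquiv M hM l x + a) := by
  set A := dilEquiv M hM l with hA
  set v : E n := -A x - a with hv
  rw [Omega, cell_eq_preimage hM, unitOmega, ← avgNorm_comp_affine A v hT.measurableSet]
  congr 1
  funext y
  have hback : ∀ z, A.symm (A x + a + (A z + v)) = z := fun z => by
    rw [hv, show A x + a + (A z + (-A x - a)) = A z by abel, A.symm_apply_apply]
  have harg : ∀ z, (dilMap M ^ l) (z - x) - a = A z + v := fun z => by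
    rw [hv, map_sub]
    change A z - A x - a = _
    abel
  rw [hback, quasiInterp]
  congr 1
  refine Finset.sum_congr rfl fun α _ => ?_
  set m : ℝ := |(M.det : ℝ)| ^ ((l : ℝ) / 2) with hm
  have h1 : pairing f (rescale M a l x (pd α)) = (m : ℂ) * ((volFactor A).toReal : ℂ) *
      ∫ y, f (A.symm (A x + a + y)) * (starRingEnd ℂ) (pd α y) := by
    have h2 := integral_comp_affine A v
      fun y => f (A.symm (A x + a + y)) * (starRingEnd ℂ) (pd α y)
    rw [mul_assoc, ← h2, ← integral_const_mul, pairing]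
    refine integral_congr_ae (Eventually.of_forall fun z => ?_)
    simp only [rescale, harg, hback, map_mul, Complex.conj_ofReal]
    ring
  rw [h1, rescale, harg]
  have h3 : (m : ℂ) * (m : ℂ) * ((volFactor A).toReal : ℂ) = 1 := by
    have h4 := abs_det_pow_mul_volFactor hM l
    rw [← hm, ← hA] at h4
    rw [← Complex.ofReal_mul, ← Complex.ofReal_mul, h4, Complex.ofReal_one]
  linear_combination ((∫ y, f (A.symm (A x + a + y)) * (starRingEnd ℂ) (pd α y)) *
    tileMonomial T α (A y + v)) * h3

open Classical in
/-- The lattice point `ν` such that `y` lies in the interior of `T + ν` (and `0` if there is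
none). -/
noncomputable def nearLat (T : Set (E n)) (y : E n) : Fin n → ℤ :=
  if h : ∃ ν : Fin n → ℤ, y - latVec ν ∈ interior T then h.choose else 0

theorem IsSelfAffineTile.nearLat_eq {M : Matrix (Fin n) (Fin n) ℤ} {T : Set (E n)}
    (hT : IsSelfAffineTile M T) {y : E n} {ν : Fin n → ℤ} (h : y - latVec ν ∈ interior T) :
    nearLat T y = ν := by
  have hex : ∃ ν : Fin n → ℤ, y - latVec ν ∈ interior T := ⟨ν, h⟩
  rw [nearLat, dif_pos hex]
  exact hT.interior_disjoint hex.choose_spec h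

theorem measurableSet_latCell (T : Set (E n)) (ν : Fin n → ℤ) :
    MeasurableSet {y : E n | y - latVec ν ∈ interior T} :=
  (isOpen_interior.preimage (by fun_prop)).measurableSet

theorem IsSelfAffineTile.measurable_nearLat {M : Matrix (Fin n) (Fin n) ℤ} {T : Set (E n)}
    (hT : IsSelfAffineTile M T) : Measurable (nearLat T) := by
  have hU : MeasurableSet {y : E n | ∃ ν : Fin n → ℤ, y - latVec ν ∈ interior T} := by
    rw [show {y : E n | ∃ ν : Fin n → ℤ, y - latVec ν ∈ interior T} =
      ⋃ ν : Fin n → ℤ, {y : E n | y - latVec ν ∈ interior T} by ext; simp]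
    exact MeasurableSet.iUnion fun ν => measurableSet_latCell T ν
  refine measurable_to_countable' fun ν => ?_
  by_cases hν : ν = 0
  · have : nearLat T ⁻¹' {ν} = {y : E n | y - latVec ν ∈ interior T} ∪
        {y : E n | ∃ ν : Fin n → ℤ, y - latVec ν ∈ interior T}ᶜ := by
      ext y
      by_cases hex : ∃ κ : Fin n → ℤ, y - latVec κ ∈ interior T
      · obtain ⟨κ, hκ⟩ := hex
        have h1 : y ∈ {y : E n | ∃ ν : Fin n → ℤ, y - latVec ν ∈ interior T} := ⟨κ, hκ⟩
        simp only [Set.mem_preimage, Set.mem_singleton_iff, Set.mem_union, Set.mem_compl_iff, h1,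
          not_true_eq_false, or_false]
        rw [hT.nearLat_eq hκ]
        exact ⟨fun h => h ▸ hκ, fun h => hT.interior_disjoint hκ h⟩
      · have h1 : y ∈ {y : E n | ∃ ν : Fin n → ℤ, y - latVec ν ∈ interior T}ᶜ := hex
        simp only [Set.mem_preimage, Set.mem_singleton_iff, Set.mem_union, h1, or_true, iff_true]
        rw [nearLat, dif_neg hex, hν]
    rw [this]
    exact (measurableSet_latCell T ν).union hU.compl
  · have : nearLat T ⁻¹' {ν} = {y : E n | y - latVec ν ∈ interior T} := by
      ext y
      refine ⟨fun h => ?_, fun h => hT.nearLat_eq h⟩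
      by_cases hex : ∃ κ : Fin n → ℤ, y - latVec κ ∈ interior T
      · obtain ⟨κ, hκ⟩ := hex
        have h1 : nearLat T y = ν := h
        rw [hT.nearLat_eq hκ] at h1
        exact h1 ▸ hκ
      · have h1 : nearLat T y = ν := h
        rw [nearLat, dif_neg hex] at h1
        exact absurd h1.symm hν
    rw [this]
    exact measurableSet_latCell T ν

/-- Quasi-interpolation recovers the coefficients of a function that is, on the interior of each
tile `T + ν`, a polynomial in `y - ν` of degree at most `k`. -/
theorem integral_piecewise_polynomial {M : Matrix (Fin n) (Fin n) ℤ} {T : Set (E n)}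
    (hT : IsSelfAffineTile M T) (h0 : volume (frontier T) = 0) {k : ℕ}
    {pd : (Fin n → ℕ) → E n → ℂ} (hpd : IsDualFamily T k pd) {S : E n → ℂ}
    {c : (Fin n → ℤ) → (Fin n → ℕ) → ℂ} (hS : ∀ ν y, y - latVec ν ∈ interior T →
      S y = ∑ α ∈ multiIdx n k, c ν α * mono α (y - latVec ν))
    {β : Fin n → ℕ} (hβ : β ∈ multiIdx n k)
    (hint : Integrable fun y => S y * (starRingEnd ℂ) (pd β y)) :
    ∫ y, S y * (starRingEnd ℂ) (pd β y) = c 0 β := by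
  set U : (Fin n → ℤ) → Set (E n) := fun ν => {y : E n | y - latVec ν ∈ interior T} with hU
  have hUm : ∀ ν, MeasurableSet (U ν) := measurableSet_latCell T
  have hdisj : Pairwise (Function.onFun Disjoint U) := fun μ ν hμν =>
    Set.disjoint_left.2 fun y hy hy' => hμν (hT.interior_disjoint hy hy')
  have hsum := hasSum_integral_iUnion hUm hdisj hint.integrableOn
  have hfull : (volume : Measure (E n)).restrict (⋃ ν, U ν) = volume := by
    refine Measure.restrict_eq_self_of_ae_mem ?_
    filter_upwards [hT.ae_mem_interior h0] with y hy
    simpa [hU] using hy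
  rw [hfull] at hsum
  have hpiece : ∀ ν, ∫ y in U ν, S y * (starRingEnd ℂ) (pd β y) = if ν = 0 then c 0 β else 0 := by
    intro ν
    have h1 : ∀ y, (U ν).indicator (fun y => S y * (starRingEnd ℂ) (pd β y)) y =
        ∑ α ∈ multiIdx n k, c ν α * (tileMonomial T α (y - latVec ν) *
          (starRingEnd ℂ) (pd β (y - latVec 0))) := by
      intro y
      by_cases hy : y ∈ U ν
      · rw [Set.indicator_of_mem hy, hS ν y hy, Finset.sum_mul, latVec_zero, sub_zero]
        refine Finset.sum_congr rfl fun α _ => ?_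
        rw [tileMonomial_of_mem hy]
        ring
      · rw [Set.indicator_of_notMem hy]
        refine (Finset.sum_eq_zero fun α _ => ?_).symm
        rw [tileMonomial_of_notMem hy]
        ring
    have hi : ∀ α, Integrable fun y => tileMonomial T α (y - latVec ν) *
        (starRingEnd ℂ) (pd β (y - latVec 0)) := by
      intro α
      obtain ⟨B, -, hB⟩ := exists_tileMonomial_le hT.isCompact α
      have h2 : Integrable fun y => (starRingEnd ℂ) (pd β (y - latVec 0)) := by
        have h3 := (hpd.1 β hβ).integrable hT
        have h4 : Integrable fun y => (starRingEnd ℂ) (pd β y) :=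
          Complex.conjCLE.toContinuousLinearMap.integrable_comp h3
        simpa using h4
      refine h2.bdd_mul (c := B) ?_ (Eventually.of_forall fun y => hB _)
      exact ((measurable_tileMonomial T α).comp (measurable_id.sub_const _)).aestronglyMeasurable
    rw [← integral_indicator (hUm ν)]
    simp_rw [h1]
    rw [integral_finsetSum _ fun α _ => (hi α).const_mul _]
    simp_rw [integral_const_mul]
    have h5 : ∀ α ∈ multiIdx n k, c ν α * ∫ y, tileMonomial T α (y - latVec ν) *
        (starRingEnd ℂ) (pd β (y - latVec 0)) = if α = β then (if ν = 0 then c 0 β else 0) else 0 := by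
      intro α hα
      have := hpd.2 α hα β hβ ν 0
      rw [pairing] at this
      rw [this]
      by_cases hαβ : α = β <;> by_cases hν : ν = 0 <;> simp [hαβ, hν]
    rw [Finset.sum_congr rfl h5]
    simp [hβ]
  simp_rw [hpiece] at hsum
  exact hsum.unique (hasSum_ite_eq 0 (c 0 β))

theorem measurable_lintegral_right {W : Type*} [MeasurableSpace W] {μ : Measure W} [SFinite μ]
    {F : E n → W → ℝ≥0∞} (hF : Measurable (Function.uncurry F)) :
    Measurable fun x => ∫⁻ w, F x w ∂μ :=
  hF.lintegral_prod_right'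

/-- The error of quasi-interpolation on the unit scale is controlled by the modulus of smoothness.
Compared with the local polynomials `τ x` of `exists_polynomial_approx`, the error has two parts:
`g - τ x` on the cell, and the quasi-interpolant of the difference of `g` and the piecewise
polynomial function made of all the `τ (x + ν)`, `ν ∈ ℤⁿ`. The dual functions need not have compact
support, but they are integrable, and Minkowski's inequality for the integral against them uses only
that the norm of `x ↦ g(x + y) - τ (x + ν) (y - ν)` does not depend on the shift by `ν`. -/
theorem exists_eLpNorm_unitOmega_le {M : Matrix (Fin n) (Fin n) ℤ} {T : Set (E n)}
    (hT : IsSelfAffineTile M T) (h0 : volume (frontier T) = 0) (hT0 : volume T ≠ 0) {k : ℕ}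
    {pd : (Fin n → ℕ) → E n → ℂ} (hpd : IsDualFamily T k pd) {r : ℝ} (hr : 0 < r) {p : ℝ≥0∞}
    (hp : 1 ≤ p) :
    ∃ C : ℝ≥0∞, C ≠ ∞ ∧ ∀ g : E n → ℂ, Measurable g → eLpNorm g p volume ≠ ∞ →
      eLpNorm (unitOmega T k pd p g) p volume ≤ C * modulus k r p g := by
  have hTtop : volume T ≠ ∞ := hT.isCompact.measure_lt_top.ne
  obtain ⟨R, hR⟩ := hT.isCompact.isBounded.exists_norm_le
  obtain ⟨C₀, hC₀, happrox⟩ := exists_polynomial_approx n k hr R hp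
  choose B _ hB using fun α : Fin n → ℕ => exists_tileMonomial_le hT.isCompact α
  set J : (Fin n → ℕ) → ℝ≥0∞ := fun β => ∫⁻ y, ‖pd β y‖ₑ with hJ
  have hJtop : ∀ β ∈ multiIdx n k, J β ≠ ∞ := fun β hβ =>
    ((hpd.1 β hβ).integrable hT).hasFiniteIntegral.ne
  set D₀ : ℝ≥0∞ := ∑ β ∈ multiIdx n k, ENNReal.ofReal (B β) * J β with hD₀
  have hD₀top : D₀ ≠ ∞ := ENNReal.sum_ne_top.2 fun β hβ =>
    ENNReal.mul_ne_top ENNReal.ofReal_ne_top (hJtop β hβ)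
  refine ⟨(1 + D₀) * C₀, ENNReal.mul_ne_top (by finiteness) hC₀, fun g hg hgp => ?_⟩
  obtain ⟨τ, hτm, hτpoly, hτ⟩ := happrox g hg hgp
  choose c hc using hτpoly
  set ω := modulus k r p g with hω
  have hωtop : ω ≠ ∞ := by
    refine ne_top_of_le_ne_top (ENNReal.mul_ne_top (diffConst_ne_top (k + 1)) hgp) ?_
    refine iSup₂_le fun u _ => ?_
    have := eLpNorm_fwdDiff_restrict_le hg hp (K := Set.univ) (Q := Set.univ) (x := 0) (u := u)
      (N := k + 1) (by simp)
    simpa using this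
  set S : E n → E n → ℂ := fun x y =>
    τ (x + latVec (nearLat T y)) (y - latVec (nearLat T y)) with hS
  have hlat : Measurable fun y : E n => (latVec (nearLat T y) : E n) :=
    (measurable_of_countable fun ν : Fin n → ℤ => (latVec ν : E n)).comp hT.measurable_nearLat
  have hSm : Measurable (Function.uncurry S) :=
    hτm.comp (Measurable.prodMk (measurable_fst.add (hlat.comp measurable_snd))
      (measurable_snd.sub (hlat.comp measurable_snd)))
  have hgm : Measurable (Function.uncurry fun (x y : E n) => g (x + y)) :=
    hg.comp (measurable_fst.add measurable_snd)
  have hτsec : ∀ w, Measurable fun x => g (x + w) - τ x w := fun w =>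
    (hg.comp (measurable_id.add_const w)).sub (hτm.comp measurable_prodMk_right)
  have hErr : ∀ᵐ y : E n, eLpNorm (fun x => ‖g (x + y) - S x y‖ₑ) p volume ≤ C₀ * ω := by
    filter_upwards [hT.ae_mem_interior h0] with y hy
    obtain ⟨ν, hν⟩ := hy
    rw [eLpNorm_enorm (fun x => g (x + y) - S x y)]
    refine le_trans (le_of_eq ?_) (hτ (y - latVec ν) (hR _ (interior_subset hν)))
    rw [← eLpNorm_comp_measurePreserving (hτsec (y - latVec ν)).aestronglyMeasurable
      (measurePreserving_add_right volume (latVec ν))]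
    congr 1
    funext x
    simp only [hS, hT.nearLat_eq hν, Function.comp]
    rw [show x + latVec ν + (y - latVec ν) = x + y by abel]
  -- Integration against the dual functions.
  set μ : (Fin n → ℕ) → Measure (E n) := fun β => volume.withDensity fun y => ‖pd β y‖ₑ with hμ
  have hpdm : ∀ β ∈ multiIdx n k, AEMeasurable (fun y => ‖pd β y‖ₑ) volume := fun β hβ =>
    (hpd.1 β hβ).1.enorm
  have hμu : ∀ β, μ β Set.univ = J β := fun β => by
    simp only [hμ]
    rw [withDensity_apply _ MeasurableSet.univ, Measure.restrict_univ]
  have hμf : ∀ β ∈ multiIdx n k, IsFiniteMeasure (μ β) := fun β hβ =>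
    ⟨by rw [hμu]; exact (hJtop β hβ).lt_top⟩
  have hEm : Measurable (Function.uncurry fun (x y : E n) => ‖g (x + y) - S x y‖ₑ) :=
    (hgm.sub hSm).enorm
  set Φ : (Fin n → ℕ) → E n → ℝ≥0∞ := fun β x => ∫⁻ y, ‖g (x + y) - S x y‖ₑ ∂(μ β) with hΦ
  have hΦm : ∀ β ∈ multiIdx n k, Measurable (Φ β) := fun β hβ => by
    have := hμf β hβ
    exact measurable_lintegral_right hEm
  have hΦle : ∀ β ∈ multiIdx n k, eLpNorm (Φ β) p volume ≤ J β * (C₀ * ω) := fun β hβ => by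
    have := hμf β hβ
    rw [← hμu]
    exact eLpNorm_lintegral_le hEm hp ((withDensity_absolutelyContinuous _ _).ae_le hErr)
  have hconv : ∀ (H : E n → E n → ℂ), Measurable (Function.uncurry H) → ∀ β ∈ multiIdx n k,
      ∀ x, ∫⁻ y, ‖H x y * (starRingEnd ℂ) (pd β y)‖ₑ = ∫⁻ y, ‖H x y‖ₑ ∂(μ β) := by
    intro H hH β hβ x
    have h1 : Measurable fun y => ‖H x y‖ₑ := (hH.comp measurable_prodMk_left).enorm
    simp only [hμ]
    rw [lintegral_withDensity_eq_lintegral_mul₀ (hpdm β hβ) h1.aemeasurable]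
    refine lintegral_congr fun y => ?_
    rw [enorm_mul, Pi.mul_apply, mul_comm]
    congr 1
    simp [← ofReal_norm]
  have hmeasProd : ∀ (H : E n → E n → ℂ), Measurable (Function.uncurry H) → ∀ β ∈ multiIdx n k,
      ∀ x, AEStronglyMeasurable (fun y => H x y * (starRingEnd ℂ) (pd β y)) volume := by
    intro H hH β hβ x
    refine AEStronglyMeasurable.mul
      (hH.comp (measurable_prodMk_left (x := x))).aestronglyMeasurable ?_
    exact Complex.continuous_conj.comp_aestronglyMeasurable (hpd.1 β hβ).1
  have hfin1 : ∀ β ∈ multiIdx n k, ∀ᵐ x, Φ β x < ∞ := fun β hβ =>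
    ae_lt_top_of_eLpNorm (hΦm β hβ) hp (ne_top_of_le_ne_top
      (ENNReal.mul_ne_top (hJtop β hβ) (ENNReal.mul_ne_top hC₀ hωtop)) (hΦle β hβ))
  have hfin2 : ∀ β ∈ multiIdx n k, ∀ᵐ x, ∫⁻ y, ‖g (x + y)‖ₑ ∂(μ β) < ∞ := fun β hβ => by
    have := hμf β hβ
    refine ae_lt_top_of_eLpNorm (measurable_lintegral_right hgm.enorm) hp
      (ne_top_of_le_ne_top (ENNReal.mul_ne_top (hJtop β hβ) hgp) ?_)
    rw [← hμu]
    refine eLpNorm_lintegral_le hgm.enorm hp (Eventually.of_forall fun y => ?_)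
    rw [eLpNorm_enorm (fun x => g (x + y))]
    exact (eLpNorm_comp_measurePreserving hg.aestronglyMeasurable
      (measurePreserving_add_right volume y)).le
  have hcoef : ∀ᵐ x, ∀ β ∈ multiIdx n k,
      ‖(∫ y, g (x + y) * (starRingEnd ℂ) (pd β y)) - c x β‖ₑ ≤ Φ β x := by
    have h1 : ∀ᵐ x, ∀ β ∈ multiIdx n k, Φ β x < ∞ :=
      (Finset.eventually_all (multiIdx n k)).2 hfin1
    have h2 : ∀ᵐ x, ∀ β ∈ multiIdx n k, ∫⁻ y, ‖g (x + y)‖ₑ ∂(μ β) < ∞ :=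
      (Finset.eventually_all (multiIdx n k)).2 hfin2
    filter_upwards [h1, h2] with x hx1 hx2 β hβ
    have hig : Integrable fun y => g (x + y) * (starRingEnd ℂ) (pd β y) :=
      ⟨hmeasProd _ hgm β hβ x, by
        rw [hasFiniteIntegral_iff_enorm, hconv (fun x y => g (x + y)) hgm β hβ x]
        exact hx2 β hβ⟩
    have hid : Integrable fun y => (g (x + y) - S x y) * (starRingEnd ℂ) (pd β y) :=
      ⟨hmeasProd (fun x y => g (x + y) - S x y) (hgm.sub hSm) β hβ x, by
        rw [hasFiniteIntegral_iff_enorm, hconv (fun x y => g (x + y) - S x y) (hgm.sub hSm) β hβ x]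
        exact hx1 β hβ⟩
    have hiS : Integrable fun y => S x y * (starRingEnd ℂ) (pd β y) := by
      refine (hig.sub hid).congr (Eventually.of_forall fun y => ?_)
      simp only [Pi.sub_apply]
      ring
    have hval := integral_piecewise_polynomial hT h0 hpd
      (c := fun ν α => c (x + latVec ν) α) (S := S x) (fun ν y hy => by
        simp only [hS, hT.nearLat_eq hy]
        exact hc _ _) hβ hiS
    simp only [latVec_zero, add_zero] at hval
    rw [← hval, ← integral_sub hig hiS]
    refine (enorm_integral_le_lintegral_enorm _).trans (le_of_eq (Eq.trans
      (lintegral_congr fun y => ?_)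
      (hconv (fun x y => g (x + y) - S x y) (hgm.sub hSm) β hβ x)))
    rw [sub_mul]
  -- The normalized restriction to the tile.
  set μT : Measure (E n) := (volume T)⁻¹ • volume.restrict T with hμT
  have hprob : IsProbabilityMeasure μT := ⟨by
    rw [hμT, Measure.smul_apply, Measure.restrict_apply_univ, smul_eq_mul,
      ENNReal.inv_mul_cancel hT0 hTtop]⟩
  have hFm : Measurable (Function.uncurry fun (x w : E n) => ‖g (x + w) - τ x w‖ₑ) :=
    (hgm.sub hτm).enorm
  obtain ⟨N, hNm, hN, hNle⟩ := exists_measurable_majorant (ν := volume) (μ := μT) hFm hp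
    (c := C₀ * ω) (by
      refine Measure.ae_smul_measure ?_ _
      filter_upwards [ae_restrict_mem hT.isCompact.measurableSet] with w hw
      rw [eLpNorm_enorm (fun x => g (x + w) - τ x w)]
      exact hτ w (hR w hw))
  rw [measure_univ, ENNReal.one_rpow, one_mul] at hNle
  have hpt : ∀ᵐ x, unitOmega T k pd p g x ≤
      N x + ∑ β ∈ multiIdx n k, ENNReal.ofReal (B β) * Φ β x := by
    filter_upwards [hN, hcoef] with x hxN hxc
    set d : ℝ≥0∞ := ∑ β ∈ multiIdx n k, ENNReal.ofReal (B β) * Φ β x with hd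
    have h1 : ∀ᵐ w ∂μT, ‖g (x + w) - ∑ α ∈ multiIdx n k,
        (∫ y, g (x + y) * (starRingEnd ℂ) (pd α y)) * tileMonomial T α w‖ₑ ≤
          ‖g (x + w) - τ x w‖ₑ + d := by
      refine Measure.ae_smul_measure ?_ _
      filter_upwards [ae_mem_interior_of_volume_frontier hT.isCompact h0] with w hw
      have h2 : g (x + w) - ∑ α ∈ multiIdx n k,
          (∫ y, g (x + y) * (starRingEnd ℂ) (pd α y)) * tileMonomial T α w =
          (g (x + w) - τ x w) - ∑ α ∈ multiIdx n k,
            ((∫ y, g (x + y) * (starRingEnd ℂ) (pd α y)) - c x α) * tileMonomial T α w := by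
        rw [hc x w]
        simp only [sub_mul, Finset.sum_sub_distrib, tileMonomial_of_mem hw]
        ring
      rw [h2]
      refine (enorm_sub_le).trans ?_
      gcongr
      refine (enorm_sum_le _ _).trans (Finset.sum_le_sum fun α hα => ?_)
      rw [enorm_mul, mul_comm]
      gcongr
      · rw [← ofReal_norm]
        exact ENNReal.ofReal_le_ofReal (hB α w)
      · exact hxc α hα
    have h3 : AEStronglyMeasurable (fun w => ‖g (x + w) - τ x w‖ₑ) μT :=
      (hFm.comp (measurable_prodMk_left (x := x))).aestronglyMeasurable
    calc unitOmega T k pd p g x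
        ≤ eLpNorm ((fun w => ‖g (x + w) - τ x w‖ₑ) + fun _ => d) p μT :=
          eLpNorm_mono_enorm_ae h1
      _ ≤ eLpNorm (fun w => ‖g (x + w) - τ x w‖ₑ) p μT + eLpNorm (fun _ => d) p μT :=
          eLpNorm_add_le h3 aestronglyMeasurable_const hp
      _ ≤ N x + d := by
          gcongr
          rw [eLpNorm_const _ (zero_lt_one.trans_le hp).ne' (NeZero.ne μT)]
          simp
  calc eLpNorm (unitOmega T k pd p g) p volume
      ≤ eLpNorm (N + ∑ β ∈ multiIdx n k, fun x => ENNReal.ofReal (B β) * Φ β x) p volume := by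
        refine eLpNorm_mono_enorm_ae ?_
        filter_upwards [hpt] with x hx
        simpa using hx
    _ ≤ eLpNorm N p volume +
        ∑ β ∈ multiIdx n k, eLpNorm (fun x => ENNReal.ofReal (B β) * Φ β x) p volume := by
        have hm : ∀ β ∈ multiIdx n k, AEStronglyMeasurable
            (fun x => ENNReal.ofReal (B β) * Φ β x) volume := fun β hβ =>
          ((hΦm β hβ).const_mul _).aestronglyMeasurable
        refine (eLpNorm_add_le hNm.aestronglyMeasurable
          (Finset.aestronglyMeasurable_sum _ hm) hp).trans ?_
        gcongr
        exact eLpNorm_sum_le hm hp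
    _ ≤ C₀ * ω + ∑ β ∈ multiIdx n k, ENNReal.ofReal (B β) * (J β * (C₀ * ω)) := by
        gcongr with β hβ
        refine (eLpNorm_const_mul_le ENNReal.ofReal_ne_top _ hp).trans ?_
        gcongr
        exact hΦle β hβ
    _ = (1 + D₀) * C₀ * ω := by
        rw [hD₀]
        simp only [add_mul, Finset.sum_mul, one_mul, mul_assoc]

/-! ### Comparison at every scale -/

theorem fwdDiff_iter_comp_linear (A : E n ≃L[ℝ] E n) (f : E n → ℂ) (v : E n) (N : ℕ) (x : E n) :
    (fwdDiff v)^[N] (fun y => f (A.symm y)) (A x) = (fwdDiff (A.symm v))^[N] f x := by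
  simp only [fwdDiff_iter_eq_sum_shift, map_add, map_nsmul, A.symm_apply_apply]

/-- At every scale, the error of quasi-interpolation is controlled by the differences of `f`, with
a constant which does not depend on the scale. -/
theorem exists_eLpNorm_Omega_le_fwdDiff {M : Matrix (Fin n) (Fin n) ℤ} (hM : IsDilation M)
    {T : Set (E n)} (hT : IsSelfAffineTile M T) (h0 : volume (frontier T) = 0)
    (hT0 : volume T ≠ 0) (a : E n) {k : ℕ} {pd : (Fin n → ℕ) → E n → ℂ}
    (hpd : IsDualFamily T k pd) {r : ℝ} (hr : 0 < r) {p : ℝ≥0∞} (hp : 1 ≤ p) :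
    ∃ C : ℝ≥0∞, C ≠ ∞ ∧ ∀ f : E n → ℂ, Measurable f → eLpNorm f p volume ≠ ∞ → ∀ l : ℕ,
      eLpNorm (fun x => Omega M T a k pd p f l x) p volume ≤
        C * ⨆ (u : E n) (_ : ((k : ℝ) + 1) * ‖(dilMap M ^ l) u‖ < r / 2),
          eLpNorm ((fwdDiff u)^[k + 1] f) p volume := by
  obtain ⟨C, hC, hle⟩ := exists_eLpNorm_unitOmega_le hT h0 hT0 hpd hr hp
  refine ⟨C, hC, fun f hf hfp l => ?_⟩
  set A := dilEquiv M hM l with hA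
  set g : E n → ℂ := fun y => f (A.symm y) with hg
  set κ : ℝ≥0∞ := volFactor A ^ (1 / p).toReal with hκ
  have hκ0 : κ ≠ 0 := by
    simp [hκ, ENNReal.rpow_eq_zero_iff, volFactor_ne_zero A, volFactor_ne_top A]
  have hcomp : ∀ F : E n → ℂ, eLpNorm (fun x => F (A x)) p volume = κ * eLpNorm F p volume :=
    fun F => by simpa only [add_zero] using eLpNorm_comp_affine A 0 F p
  have hgm : Measurable g := hf.comp A.symm.continuous.measurable
  have hfg : eLpNorm f p volume = κ * eLpNorm g p volume := by
    rw [← hcomp g]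
    simp [hg]
  have hgp : eLpNorm g p volume ≠ ∞ := fun h => hfp (by rw [hfg, h, ENNReal.mul_top hκ0])
  have hmod : κ * modulus k r p g ≤
      ⨆ (u : E n) (_ : ((k : ℝ) + 1) * ‖(dilMap M ^ l) u‖ < r / 2),
        eLpNorm ((fwdDiff u)^[k + 1] f) p volume := by
    rw [modulus]
    simp only [ENNReal.mul_iSup]
    refine iSup₂_le fun v hv => ?_
    rw [← hcomp]
    have hv' : ((k : ℝ) + 1) * ‖(dilMap M ^ l) (A.symm v)‖ < r / 2 := by
      rwa [show (dilMap M ^ l) (A.symm v) = v from A.apply_symm_apply v]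
    refine le_trans (le_of_eq ?_) (le_iSup₂ (f := fun (u : E n)
      (_ : ((k : ℝ) + 1) * ‖(dilMap M ^ l) u‖ < r / 2) =>
        eLpNorm ((fwdDiff u)^[k + 1] f) p volume) (A.symm v) hv')
    congr 1
    funext x
    exact fwdDiff_iter_comp_linear A f v (k + 1) x
  calc eLpNorm (fun x => Omega M T a k pd p f l x) p volume
      = κ * eLpNorm (unitOmega T k pd p g) p volume := by
        rw [← eLpNorm_comp_affine A a]
        congr 1
        funext x
        exact Omega_eq_unitOmega hM hT.isCompact a k pd p f l x
    _ ≤ κ * (C * modulus k r p g) := by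
        gcongr
        exact hle g hgm hgp
    _ = C * (κ * modulus k r p g) := by ring
    _ ≤ _ := by gcongr

/-! ### Functions that agree almost everywhere -/

theorem avgNorm_congr_ae {f g : E n → ℂ} (h : f =ᵐ[volume] g) (p : ℝ≥0∞) (Q : Set (E n)) :
    avgNorm p Q f = avgNorm p Q g :=
  eLpNorm_congr_ae (Measure.ae_smul_measure (ae_restrict_of_ae h) _)

theorem osc_congr_ae {f g : E n → ℂ} (h : f =ᵐ[volume] g) (M : Matrix (Fin n) (Fin n) ℤ)
    (T : Set (E n)) (a : E n) (k : ℕ) (p : ℝ≥0∞) (l : ℕ) (x : E n) :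
    osc M T a k p f l x = osc M T a k p g l x := by
  refine iInf_congr fun P => iInf_congr fun _ => avgNorm_congr_ae ?_ p _
  filter_upwards [h] with y hy
  rw [hy]

theorem Omega_congr_ae {f g : E n → ℂ} (h : f =ᵐ[volume] g) (M : Matrix (Fin n) (Fin n) ℤ)
    (T : Set (E n)) (a : E n) (k : ℕ) (pd : (Fin n → ℕ) → E n → ℂ) (p : ℝ≥0∞) (l : ℕ) (x : E n) :
    Omega M T a k pd p f l x = Omega M T a k pd p g l x := by
  have hpair : ∀ φ : E n → ℂ, pairing f φ = pairing g φ := fun φ =>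
    integral_congr_ae (h.mono fun y hy => by simp only [hy])
  refine avgNorm_congr_ae ?_ p _
  filter_upwards [h] with y hy
  simp only [quasiInterp, hpair, hy]

theorem eLpNorm_fwdDiff_congr_ae {f g : E n → ℂ} (h : f =ᵐ[volume] g) (u : E n) (N : ℕ)
    (p : ℝ≥0∞) :
    eLpNorm ((fwdDiff u)^[N] f) p volume = eLpNorm ((fwdDiff u)^[N] g) p volume := by
  refine eLpNorm_congr_ae ?_
  have h1 : ∀ᵐ x : E n, ∀ j : ℕ, f (x + j • u) = g (x + j • u) :=
    ae_all_iff.2 fun j =>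
      (measurePreserving_add_right volume (j • u)).quasiMeasurePreserving.ae h
  filter_upwards [h1] with x hx
  simp only [fwdDiff_iter_eq_sum_shift, hx]

theorem besovNorm_congr_ae {f g : E n → ℂ} (h : f =ᵐ[volume] g) (M : Matrix (Fin n) (Fin n) ℤ)
    (T : Set (E n)) (a : E n) (k : ℕ) (s : ℝ) (p q : ℝ≥0∞) :
    besovNorm M T a k s p q f = besovNorm M T a k s p q g := by
  simp only [besovNorm, eLpNorm_congr_ae h, osc_congr_ae h]

theorem besovNormOmega_congr_ae {f g : E n → ℂ} (h : f =ᵐ[volume] g)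
    (M : Matrix (Fin n) (Fin n) ℤ) (T : Set (E n)) (a : E n) (k : ℕ)
    (pd : (Fin n → ℕ) → E n → ℂ) (s : ℝ) (p q : ℝ≥0∞) :
    besovNormOmega M T a k pd s p q f = besovNormOmega M T a k pd s p q g := by
  simp only [besovNormOmega, eLpNorm_congr_ae h, Omega_congr_ae h]

theorem besovNormDiff_congr_ae {f g : E n → ℂ} (h : f =ᵐ[volume] g)
    (M : Matrix (Fin n) (Fin n) ℤ) (r : ℝ) (k : ℕ) (s : ℝ) (p q : ℝ≥0∞) :
    besovNormDiff M r k s p q f = besovNormDiff M r k s p q g := by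
  simp only [besovNormDiff, eLpNorm_congr_ae h, eLpNorm_fwdDiff_congr_ae h]

/-! ### Equivalence of the norms -/

/-- A comparison at every scale gives a comparison of the norms. For `N = ∞` there is nothing to
compare, and no estimate is needed. -/
theorem add_lqNorm_le {q : ℝ≥0∞} (hq : 1 ≤ q) {N C : ℝ≥0∞} {w b c : ℕ → ℝ≥0∞}
    (h : N ≠ ∞ → ∀ l, b l ≤ C * c l) :
    N + lqNorm q (fun l => w l * b l) ≤ (1 + C) * (N + lqNorm q fun l => w l * c l) := by
  by_cases hN : N = ∞
  · rw [hN, top_add, top_add, ENNReal.mul_top (by simp)]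
  · have h1 : lqNorm q (fun l => w l * b l) ≤ C * lqNorm q fun l => w l * c l :=
      lqNorm_le_mul hq fun l => by
        rw [mul_left_comm]
        gcongr
        exact h hN l
    rw [mul_add]
    refine add_le_add (le_mul_of_one_le_left' (by simp)) (h1.trans ?_)
    gcongr
    simp

/-- Two quantities that do not change if `f` is modified on a null set need only be compared for Borel
measurable `f`. -/
theorem exists_forall_aestronglyMeasurable {X Y : (E n → ℂ) → ℝ≥0∞}
    (hX : ∀ f g : E n → ℂ, f =ᵐ[volume] g → X f = X g)
    (hY : ∀ f g : E n → ℂ, f =ᵐ[volume] g → Y f = Y g) {C D : ℝ≥0∞} (hC : C ≠ ∞) (hD : D ≠ ∞)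
    (hXY : ∀ f : E n → ℂ, Measurable f → X f ≤ C * Y f)
    (hYX : ∀ f : E n → ℂ, Measurable f → Y f ≤ D * X f) :
    ∃ K : ℝ≥0, ∀ f : E n → ℂ, AEStronglyMeasurable f volume → X f ≤ K * Y f ∧ Y f ≤ K * X f := by
  refine ⟨(C + D).toNNReal, fun f hf => ?_⟩
  rw [ENNReal.coe_toNNReal (ENNReal.add_ne_top.2 ⟨hC, hD⟩), hX f _ hf.ae_eq_mk,
    hY f _ hf.ae_eq_mk]
  have hm := hf.stronglyMeasurable_mk.measurable
  constructor
  · refine (hXY _ hm).trans ?_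
    gcongr
    exact le_self_add
  · refine (hYX _ hm).trans ?_
    gcongr
    exact le_add_self

end SelfAffine

theorem theorem1 (n : ℕ) (hn : 0 < n) (M : Matrix (Fin n) (Fin n) ℤ)
    (hM : SelfAffine.IsDilation M) (T : Set (SelfAffine.E n))
    (hT : SelfAffine.IsSelfAffineTile M T) (a : SelfAffine.E n) (r : ℝ) (hr : 0 < r)
    (hQ : Metric.ball (0 : SelfAffine.E n) r ⊆ SelfAffine.shiftSet T a)
    (s : ℝ) (hs : 0 < s) (k : ℕ) (hk : s < (k : ℝ) + 1)
    (p q : ℝ≥0∞) (hp : 1 ≤ p) (hq : 1 ≤ q) :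
    (∃ pd : (Fin n → ℕ) → SelfAffine.E n → ℂ, SelfAffine.IsDualFamily T k pd) ∧
    (∀ pd : (Fin n → ℕ) → SelfAffine.E n → ℂ, SelfAffine.IsDualFamily T k pd →
      ∃ C : ℝ≥0, ∀ f : SelfAffine.E n → ℂ, AEStronglyMeasurable f volume →
        SelfAffine.besovNorm M T a k s p q f ≤
            C * SelfAffine.besovNormOmega M T a k pd s p q f ∧
          SelfAffine.besovNormOmega M T a k pd s p q f ≤
            C * SelfAffine.besovNorm M T a k s p q f) ∧
    (∃ C : ℝ≥0, ∀ f : SelfAffine.E n → ℂ, AEStronglyMeasurable f volume →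
        SelfAffine.besovNorm M T a k s p q f ≤
            C * SelfAffine.besovNormDiff M r k s p q f ∧
          SelfAffine.besovNormDiff M r k s p q f ≤
            C * SelfAffine.besovNorm M T a k s p q f) := by
  have hball := SelfAffine.ball_neg_subset_of_ball_subset_shiftSet hQ
  have h0 : volume (frontier T) = 0 := hT.volume_frontier hn hM hr hball
  have hint : Metric.ball (-a) r ⊆ interior T :=
    interior_maximal hball Metric.isOpen_ball
  have hT0 : volume T ≠ 0 :=
    ((Metric.measure_ball_pos volume (-a) hr).trans_le (measure_mono hball)).ne'
  have hdual := SelfAffine.exists_isDualFamily hT ⟨-a, hint (Metric.mem_ball_self hr)⟩ k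
  obtain ⟨D, hD, hdiff⟩ :=
    SelfAffine.exists_eLpNorm_fwdDiff_le_osc hM hT.isCompact hr hQ k hp
  have hsup : ∀ f : SelfAffine.E n → ℂ, Measurable f → ∀ l : ℕ,
      (⨆ (u : SelfAffine.E n) (_ : ((k : ℝ) + 1) * ‖(SelfAffine.dilMap M ^ l) u‖ < r / 2),
        eLpNorm ((fwdDiff u)^[k + 1] f) p volume) ≤
      D * eLpNorm (fun x => SelfAffine.osc M T a k p f l x) p volume :=
    fun f hf l => iSup₂_le fun u hu => hdiff f hf l u hu
  have hosc : ∀ (pd : (Fin n → ℕ) → SelfAffine.E n → ℂ) (f : SelfAffine.E n → ℂ) (l : ℕ),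
      eLpNorm (fun x => SelfAffine.osc M T a k p f l x) p volume ≤
        eLpNorm (fun x => SelfAffine.Omega M T a k pd p f l x) p volume := fun pd f l =>
    eLpNorm_mono_enorm fun x => by
      simpa using SelfAffine.osc_le_Omega hM hT.isCompact h0 a k pd p f l x
  refine ⟨hdual, fun pd hpd => ?_, ?_⟩
  · obtain ⟨C, hC, hle⟩ := SelfAffine.exists_eLpNorm_Omega_le_fwdDiff hM hT h0 hT0 a hpd hr hp
    refine SelfAffine.exists_forall_aestronglyMeasurable
      (fun f g h => SelfAffine.besovNorm_congr_ae h M T a k s p q)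
      (fun f g h => SelfAffine.besovNormOmega_congr_ae h M T a k pd s p q)
      (C := 1 + 1) (D := 1 + C * D) (by simp)
      (ENNReal.add_ne_top.2 ⟨ENNReal.one_ne_top, ENNReal.mul_ne_top hC hD⟩)
      (fun f _ => SelfAffine.add_lqNorm_le hq fun _ l => by simpa using hosc pd f l)
      (fun f hf => SelfAffine.add_lqNorm_le hq fun hN l => ?_)
    rw [mul_assoc]
    exact (hle f hf hN l).trans (by gcongr; exact hsup f hf l)
  · obtain ⟨pd, hpd⟩ := hdual
    obtain ⟨C, hC, hle⟩ := SelfAffine.exists_eLpNorm_Omega_le_fwdDiff hM hT h0 hT0 a hpd hr hp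
    exact SelfAffine.exists_forall_aestronglyMeasurable
      (fun f g h => SelfAffine.besovNorm_congr_ae h M T a k s p q)
      (fun f g h => SelfAffine.besovNormDiff_congr_ae h M r k s p q)
      (C := 1 + C) (D := 1 + D) (ENNReal.add_ne_top.2 ⟨ENNReal.one_ne_top, hC⟩)
      (ENNReal.add_ne_top.2 ⟨ENNReal.one_ne_top, hD⟩)
      (fun f hf => SelfAffine.add_lqNorm_le hq fun hN l => (hosc pd f l).trans (hle f hf hN l))
      (fun f hf => SelfAffine.add_lqNorm_le hq fun _ l => hsup f hf l)
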